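/- Let $\epsilon>0$ be real. For a sequence $A=(a_n)_{n\ge 1}$ of positive integers let $\Sigma(A)$ be the set of all sums of finitely many terms of $A$ with distinct indices, and let $|A\cap[n]|$ be the number of terms of $A$ (counted with multiplicity) that are at most $n$. $A$ is \emph{complete} if $\Sigma(A)$ contains every sufficiently large integer, and \emph{$\epsilon$-complete} if every subsequence $A'$ of $A$ with $|A'\cap[n]|\ge\epsilon|A\cap[n]|$ for all sufficiently large $n$ is complete. Write $\Delta b_n=b_{n+1}-b_n$. For $0<\epsilon<1$, a sequence $B=(b_n)_{n\ge1}$ of positive integers is \emph{$\epsilon$-friendly} if (i) for some constant $C$, $b_n\le\sum_{1\le i\le\epsilon n+C}b_i$ for all $n\ge1$; (ii) $\lim_{n\to\infty}\Delta b_n=\infty$; (iii) $\lim_{i\to\infty}\big(|B\cap[2^{i+1}]|-|B\cap[2^i]|\big)/i=\infty$; (iv) there is $0<c<1$ such that for all $i<j$ one has $c\,\Delta b_i\le\Delta b_j$ and, if $b_j<2b_i$, also $\Delta b_j\le\frac1c\Delta b_i$; (v) $B$ is strictly increasing. Then the following hold. (1) Let $F=(f_n)_{n\ge1}$ be any sequence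 of positive integers with $f_n=\sum_{1\le i\le\epsilon n}f_i$ for all sufficiently large $n$ (this forces $\epsilon<1$). Then (a) every $\epsilon$-complete sequence $A=(a_n)_{n\ge1}$ of positive integers listed in non-decreasing order satisfies $a_n=O(f_n)$; (b) there is a strictly increasing $\epsilon$-complete sequence $(a_n)_{n\ge1}$ of positive integers with $a_n=\Theta(f_n)$; (c) $f_n=\exp\left(\left(\frac{1}{2\log(1/\epsilon)}+o(1)\right)(\log n)^2\right)$ as $n\to\infty$. (2) If $A=(a_n)_{n\ge1}$ is a non-decreasing $\epsilon$-complete sequence of positive integers, then there is $C$ such that $a_n\le\sum_{1\le i\le\epsilon n+C}a_i$ for all $n\ge1$. (3) If $0<\epsilon<1$ and $B=(b_n)_{n\ge1}$ is an $\epsilon$-friendly sequence of positive integers, then there is an $\epsilon$-complete sequence $A=(a_n)_{n\ge1}$ of positive integers with $b_n\le a_n<b_{n+1}$ for all $n\ge1$. -/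

import Mathlib

open Filter Topology

/-- Sequences `(a n)` with `n ≥ 1` are functions `ℕ → ℕ`; the value at the index `0` is never used.
`IsPosSeq a` says that all terms are positive integers. -/
def IsPosSeq (a : ℕ → ℕ) : Prop := ∀ n, 1 ≤ n → 0 < a n

/-- The partial sum `∑_{1 ≤ i ≤ x} a i` for a real number `x`. -/
noncomputable def sumUpTo (a : ℕ → ℕ) (x : ℝ) : ℕ := ∑ i ∈ Finset.Icc 1 ⌊x⌋₊, a i

/-- The number of terms `a i` with index `i ∈ S` that are at most `x` (counted with multiplicity).
For `S = {i | 1 ≤ i}` this is `|A ∩ [x]|`, in general it is `|A' ∩ [x]|`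
for the subsequence `A'` of `A` with index set `S`. -/
noncomputable def countIn (a : ℕ → ℕ) (S : Set ℕ) (x : ℕ) : ℕ∞ := {i | i ∈ S ∧ a i ≤ x}.encard

/-- The set of subset sums of the subsequence of `a` with index set `S`. -/
def subsetSums (a : ℕ → ℕ) (S : Set ℕ) : Set ℕ :=
  {m | ∃ T : Finset ℕ, (T : Set ℕ) ⊆ S ∧ ∑ i ∈ T, a i = m}

/-- The subsequence of `a` with index set `S` is complete: every sufficiently large integer
is one of its subset sums. -/
def IsCompleteOn (a : ℕ → ℕ) (S : Set ℕ) : Prop := ∀ᶠ m in atTop, m ∈ subsetSums a S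

/-- `a` is `ε`-complete: every subsequence with `|A' ∩ [n]| ≥ ε |A ∩ [n]|` for all sufficiently
large `n` is complete. -/
def IsEpsComplete (ε : ℝ) (a : ℕ → ℕ) : Prop :=
  ∀ S : Set ℕ, S ⊆ Set.Ici 1 →
    (∀ᶠ n in atTop,
      ENNReal.ofReal ε * (countIn a (Set.Ici 1) n : ENNReal) ≤ (countIn a S n : ENNReal)) →
    IsCompleteOn a S

/-- The discrete derivative `Δ b n = b (n + 1) - b n`. -/
def discDeriv (b : ℕ → ℕ) (n : ℕ) : ℝ := (b (n + 1) : ℝ) - (b n : ℝ)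

/-- `ε`-friendly sequences. -/
structure IsFriendly (ε : ℝ) (b : ℕ → ℕ) : Prop where
  growth : ∃ C : ℝ, ∀ n, 1 ≤ n → b n ≤ sumUpTo b (ε * n + C)
  tendsto_deriv : Tendsto (discDeriv b) atTop atTop
  tendsto_count : Tendsto
    (fun i : ℕ =>
      (((countIn b (Set.Ici 1) (2 ^ (i + 1))).toNat : ℝ)
        - ((countIn b (Set.Ici 1) (2 ^ i)).toNat : ℝ)) / (i : ℝ)) atTop atTop
  deriv_comparable : ∃ c : ℝ, 0 < c ∧ c < 1 ∧
    ∀ i j, 1 ≤ i → i < j →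
      c * discDeriv b i ≤ discDeriv b j ∧
      (b j < 2 * b i → discDeriv b j ≤ (1 / c) * discDeriv b i)
  strictMono : StrictMonoOn b (Set.Ici 1)

/-! Necessity of growth. If the growth condition fails for every constant, it fails at indices `u (k
+ 1)` that can be chosen very sparsely. Deleting the terms strictly between index about `ε * u (k +
1) + u k + 3` and `u (k + 1)`, together with the first term, keeps density `ε`, while the surviving
terms below `u (k + 1)` are too small to add up to `a (u (k + 1)) - 1` (`exists_not_isCompleteOn`).

Sufficiency. In each gap of a friendly sequence `b` one integer is chosen, working one dyadic block
at a time. Among integers `≡ 1` modulo a highly divisible `W`, few are nearly integral multiples of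
any given frequency away from `ℤ` (`exists_modulus_equidistributed`). A derandomised Chernoff bound
(`exists_choice_card_lt`) therefore yields choices for which no relevant frequency is nearly
integral on many terms of the block. A discrete circle method (`mem_subsetSums_of_cos_small`) then
shows that any positive proportion `τ` of a far enough block represents all integers in an interval
around half its sum (`IsFriendly.exists_interlacing`).

Such an interval grows without holes as long as each new term is at most the sum of the unused
earlier ones (`isCompleteOn_of_coversInterval`). For a set `S` of lower density at least `ε` there
are two cases. If almost every block meets `S` in a fixed proportion, the preceding block alone pays
for the next term. Otherwise some block rich in `S` comes shortly after a poor one. Then `S` is far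
from an initial segment, so the sum of its first terms beats the bound given by the growth condition
with room to spare (`sum_initial_add_le`), and the surplus covers the terms spent on the first
interval.

Size. The continuous analogue of the recursion is `F' x = ε * F (ε * x)`, solved by the power series
`lagSeries`. A shift of the index absorbs all bounded errors in the summation range
(`exists_le_mul_of_sum_le`), so every solution of the recursion has the order of `lagSeries`, and
every sequence with the growth condition is dominated by it. Rounding a multiple of `lagSeries`
gives a friendly sequence, hence an extremal `ε`-complete one. The logarithm of `lagSeries` is read
off from its largest term. -/

/-! ### Subset sums through trigonometric sums. -/

/-- This is the real part of `∏ (1 + e^{i t a}) * e^{-i t m}`, using `1 + e^{i x} = 2 cos (x / 2)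
e^{i x / 2}`. The induction pairs `T` with `insert x T`, which shifts `m`. -/
theorem sum_powerset_cos (a : ℕ → ℕ) (t m : ℝ) (U : Finset ℕ) :
    ∑ T ∈ U.powerset, Real.cos (t * ((∑ i ∈ T, (a i : ℝ)) - m)) =
      (∏ i ∈ U, 2 * Real.cos (t * a i / 2)) *
        Real.cos (t * ((∑ i ∈ U, (a i : ℝ)) / 2 - m)) := by
  classical
  induction U using Finset.induction_on generalizing m with
  | empty => simp
  | insert x U hx ih =>
    rw [Finset.sum_powerset_insert hx, ih, Finset.prod_insert hx, Finset.sum_insert hx]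
    have : ∑ T ∈ U.powerset, Real.cos (t * ((∑ i ∈ insert x T, (a i : ℝ)) - m)) =
        ∑ T ∈ U.powerset, Real.cos (t * ((∑ i ∈ T, (a i : ℝ)) - (m - a x))) := by
      refine Finset.sum_congr rfl fun T hT => ?_
      rw [Finset.sum_insert (fun h => hx (Finset.mem_powerset.1 hT h))]
      congr 1
      ring
    rw [this, ih, ← mul_add]
    have e1 : t * ((∑ i ∈ U, (a i : ℝ)) / 2 - m) =
        t * ((a x + ∑ i ∈ U, (a i : ℝ)) / 2 - m) - t * a x / 2 := by ring
    have e2 : t * ((∑ i ∈ U, (a i : ℝ)) / 2 - (m - a x)) =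
        t * ((a x + ∑ i ∈ U, (a i : ℝ)) / 2 - m) + t * a x / 2 := by ring
    rw [e1, e2, Real.cos_add, Real.cos_sub]
    ring

/-- Orthogonality of characters modulo `2 * H + 1`, with representatives symmetric about `0` so that
only cosines occur. Multiplying by `2 sin (π z / Q)` makes the sum telescope. -/
theorem sum_cos_eq_zero (H : ℕ) (z : ℤ) (hz : ¬ ((2 * H + 1 : ℕ) : ℤ) ∣ z) :
    ∑ h ∈ Finset.range (2 * H + 1),
      Real.cos (2 * Real.pi * (((h : ℝ) - H) / ((2 * H + 1 : ℕ) : ℝ)) * z) = 0 := by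
  set Q : ℝ := ((2 * H + 1 : ℕ) : ℝ) with hQ
  have hQ0 : Q ≠ 0 := by rw [hQ]; positivity
  have hs : Real.sin (Real.pi * z / Q) ≠ 0 := by
    intro h
    obtain ⟨n, hn⟩ := Real.sin_eq_zero_iff.1 h
    apply hz
    refine ⟨n, ?_⟩
    have : (n : ℝ) * Q = z := by
      have h3 : (n : ℝ) * Q * Real.pi = z * Real.pi := by
        rw [mul_right_comm, hn]; field_simp
      exact mul_right_cancel₀ Real.pi_ne_zero h3
    rw [hQ] at this
    have h4 : ((n * ((2 * H + 1 : ℕ) : ℤ) : ℤ) : ℝ) = (z : ℝ) := by push_cast; push_cast at this; exact this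
    have := Int.cast_injective h4
    rw [← this]; ring
  have key := Finset.sum_range_sub
    (fun h : ℕ => Real.sin (Real.pi * z * (2 * h - 2 * H - 1) / Q)) (2 * H + 1)
  have e : ∀ h ∈ Finset.range (2 * H + 1),
      Real.sin (Real.pi * z * (2 * (h + 1 : ℕ) - 2 * H - 1) / Q) -
        Real.sin (Real.pi * z * (2 * h - 2 * H - 1) / Q) =
      2 * Real.sin (Real.pi * z / Q) * Real.cos (2 * Real.pi * (((h : ℝ) - H) / Q) * z) := by
    intro h _
    have e1 : Real.pi * z * (2 * (h + 1 : ℕ) - 2 * H - 1) / Q =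
      2 * Real.pi * (((h : ℝ) - H) / Q) * z + Real.pi * z / Q := by push_cast; field_simp; ring
    have e2 : Real.pi * z * (2 * h - 2 * H - 1) / Q =
      2 * Real.pi * (((h : ℝ) - H) / Q) * z - Real.pi * z / Q := by field_simp
    rw [e1, e2, Real.sin_add, Real.sin_sub]; ring
  rw [Finset.sum_congr rfl e, ← Finset.mul_sum] at key
  have r1 : Real.sin (Real.pi * z * (2 * (2 * H + 1 : ℕ) - 2 * H - 1) / Q) = 0 := by
    have : Real.pi * z * (2 * (2 * H + 1 : ℕ) - 2 * H - 1) / Q = (z : ℝ) * Real.pi := by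
      rw [div_eq_iff hQ0, hQ]; push_cast; ring
    rw [this]; exact Real.sin_int_mul_pi z
  have r2 : Real.sin (Real.pi * z * (2 * (0 : ℕ) - 2 * H - 1) / Q) = 0 := by
    have : Real.pi * z * (2 * (0 : ℕ) - 2 * H - 1) / Q = ((-z : ℤ) : ℝ) * Real.pi := by
      rw [div_eq_iff hQ0, hQ]; push_cast; ring
    rw [this]; exact Real.sin_int_mul_pi _
  rw [r1, r2, sub_zero] at key
  simpa [hs] using key

theorem abs_cos_pi_mul_le (x : ℝ) :
    |Real.cos (Real.pi * x)| ≤ Real.exp (-(2 * |x - round x| ^ 2)) := by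
  set d := x - round x with hd
  have h1 : |d| ≤ 1 / 2 := abs_sub_round x
  have h2 : |Real.cos (Real.pi * x)| = |Real.cos (Real.pi * d)| := by
    have : Real.pi * x = Real.pi * d + (round x : ℤ) * Real.pi := by rw [hd]; ring
    rw [this, Real.cos_add_int_mul_pi, abs_mul]
    rcases Int.even_or_odd (round x) with h | h
    · rw [h.neg_one_zpow]; simp
    · rw [h.neg_one_zpow]; simp
  have hp := Real.pi_pos
  have h4 : |Real.pi * d| ≤ Real.pi / 2 := by
    rw [abs_mul, abs_of_pos hp]; nlinarith
  have h3 : 0 ≤ Real.cos (Real.pi * d) := by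
    apply Real.cos_nonneg_of_neg_pi_div_two_le_of_le
    · linarith [neg_abs_le (Real.pi * d)]
    · linarith [le_abs_self (Real.pi * d)]
  rw [h2, abs_of_nonneg h3]
  have h5 := Real.cos_le_one_sub_mul_cos_sq (x := Real.pi * d) (by linarith)
  have h6 : 2 / Real.pi ^ 2 * (Real.pi * d) ^ 2 = 2 * |d| ^ 2 := by
    rw [sq_abs]; field_simp
  rw [h6] at h5
  have := Real.add_one_le_exp (-(2 * |d| ^ 2))
  linarith

/-- Each term whose multiple of `θ` stays `κ` away from the integers costs a factor `exp (-2 κ²)`;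
the other factors are bounded by `1`. -/
theorem abs_prod_cos_le (a : ℕ → ℕ) (U : Finset ℕ) (θ κ : ℝ) (hκ : 0 ≤ κ) :
    |∏ i ∈ U, Real.cos (Real.pi * (a i * θ))| ≤
      Real.exp (-(2 * κ ^ 2 *
        (U.filter fun i => κ ≤ |(a i : ℝ) * θ - round ((a i : ℝ) * θ)|).card)) := by
  rw [Finset.abs_prod, ← Finset.prod_filter_mul_prod_filter_not U
    (fun i => κ ≤ |(a i : ℝ) * θ - round ((a i : ℝ) * θ)|)]
  have h1 : ∏ i ∈ U.filter (fun i => ¬ κ ≤ |(a i : ℝ) * θ - round ((a i : ℝ) * θ)|),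
      |Real.cos (Real.pi * (a i * θ))| ≤ 1 :=
    Finset.prod_le_one (fun _ _ => abs_nonneg _) (fun _ _ => Real.abs_cos_le_one _)
  have h2 : ∏ i ∈ U.filter (fun i => κ ≤ |(a i : ℝ) * θ - round ((a i : ℝ) * θ)|),
      |Real.cos (Real.pi * (a i * θ))| ≤
      ∏ i ∈ U.filter (fun i => κ ≤ |(a i : ℝ) * θ - round ((a i : ℝ) * θ)|),
        Real.exp (-(2 * κ ^ 2)) := by
    refine Finset.prod_le_prod (fun _ _ => abs_nonneg _) fun i hi => ?_
    refine (abs_cos_pi_mul_le _).trans (Real.exp_le_exp.2 ?_)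
    have := (Finset.mem_filter.1 hi).2
    have := pow_le_pow_left₀ hκ this 2
    linarith
  rw [Finset.prod_const, ← Real.exp_nat_mul] at h2
  refine (mul_le_of_le_one_right (Finset.prod_nonneg fun _ _ => abs_nonneg _) h1).trans
    (h2.trans (Real.exp_le_exp.2 ?_))
  linarith

/-- If the cosine products are tiny off the major arc, all integers close to half of the total
sum are subset sums. -/
theorem mem_subsetSums_of_cos_small (a : ℕ → ℕ) (U : Finset ℕ) (X H m : ℕ) (hX : 0 < X)
    (ha : ∀ i ∈ U, a i ≤ 4 * X) (hsum : ∑ i ∈ U, a i ≤ 2 * H) (hm : m ≤ 2 * H)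
    (hm1 : |2 * (m : ℝ) - ∑ i ∈ U, (a i : ℝ)| ≤ 4 * X)
    (hsmall : ∀ h ∈ Finset.range (2 * H + 1),
      1 / (8 * (X : ℝ)) ≤ |((h : ℝ) - H) / ((2 * H + 1 : ℕ) : ℝ)| →
      |∏ i ∈ U, Real.cos (Real.pi * (a i * (((h : ℝ) - H) / ((2 * H + 1 : ℕ) : ℝ))))| <
        1 / ((2 * H + 1 : ℕ) : ℝ)) :
    ∃ T ⊆ U, ∑ i ∈ T, a i = m := by
  by_contra! hno
  set Q : ℝ := ((2 * H + 1 : ℕ) : ℝ) with hQ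
  have hQ0 : 0 < Q := by rw [hQ]; positivity
  have hXr : (0 : ℝ) < X := by exact_mod_cast hX
  -- If `m` is not a subset sum, each subset contributes zero by orthogonality: the differences are
  -- nonzero and smaller than the modulus.
  have hzero : ∑ h ∈ Finset.range (2 * H + 1), ∑ T ∈ U.powerset,
      Real.cos (2 * Real.pi * (((h : ℝ) - H) / Q) * ((∑ i ∈ T, (a i : ℝ)) - m)) = 0 := by
    rw [Finset.sum_comm]
    refine Finset.sum_eq_zero fun T hT => ?_
    have hT' := Finset.mem_powerset.1 hT
    have hle : ∑ i ∈ T, a i ≤ 2 * H := (Finset.sum_le_sum_of_subset hT').trans hsum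
    have hne := hno T hT'
    have := sum_cos_eq_zero H ((∑ i ∈ T, a i : ℕ) - (m : ℤ)) (by
      intro hd
      have := Int.eq_zero_of_abs_lt_dvd hd (by rw [abs_lt]; constructor <;> omega)
      omega)
    push_cast at this
    rw [hQ]; push_cast
    exact this
  simp_rw [sum_powerset_cos, Finset.prod_mul_distrib, Finset.prod_const] at hzero
  set g : ℕ → ℝ := fun h => (∏ i ∈ U, Real.cos (Real.pi * (a i * (((h : ℝ) - H) / Q)))) *
    Real.cos (2 * Real.pi * (((h : ℝ) - H) / Q) * ((∑ i ∈ U, (a i : ℝ)) / 2 - m)) with hg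
  have hzero' : ∑ h ∈ Finset.range (2 * H + 1), g h = 0 := by
    have : (2 : ℝ) ^ U.card * ∑ h ∈ Finset.range (2 * H + 1), g h = 0 := by
      rw [Finset.mul_sum, ← hzero]
      refine Finset.sum_congr rfl fun h _ => ?_
      rw [hg]; simp only
      have : ∏ i ∈ U, Real.cos (Real.pi * (a i * (((h : ℝ) - H) / Q))) =
          ∏ i ∈ U, Real.cos (2 * Real.pi * (((h : ℝ) - H) / Q) * a i / 2) :=
        Finset.prod_congr rfl fun i _ => by congr 1; ring
      rw [this, ← mul_assoc]
    simpa using this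
  have hH : H ∈ Finset.range (2 * H + 1) := by simp; omega
  have hgH : g H = 1 := by simp [hg]
  have hlow : ∀ h ∈ (Finset.range (2 * H + 1)).erase H, -(1 / Q) ≤ g h := by
    intro h hh
    have hh' := Finset.mem_of_mem_erase hh
    set θ := ((h : ℝ) - H) / Q with hθ
    by_cases hc : 1 / (8 * (X : ℝ)) ≤ |θ|
    · have h1 := hsmall h hh' hc
      have h2 : |g h| ≤ 1 / Q := by
        rw [hg]; simp only
        rw [abs_mul]
        exact (mul_le_of_le_one_right (abs_nonneg _) (Real.abs_cos_le_one _)).trans h1.le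
      exact (abs_le.1 h2).1
    -- On the major arc positivity is enough: `a i ≤ 4 * X` keeps each angle within `π / 2`, and the
    -- closeness of `m` to half the total does the same for the phase.
    · push Not at hc
      have hc' : |θ| * (8 * X) < 1 := by rwa [lt_div_iff₀ (by positivity)] at hc
      have hp := Real.pi_pos
      have : 0 ≤ g h := by
        refine mul_nonneg (Finset.prod_nonneg fun i hi => ?_) ?_
        · have h1 : (a i : ℝ) ≤ 4 * X := by exact_mod_cast ha i hi
          have h2 : |(a i : ℝ) * θ| ≤ 1 / 2 := by
            rw [abs_mul, Nat.abs_cast]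
            nlinarith [abs_nonneg θ]
          rw [abs_le] at h2
          apply Real.cos_nonneg_of_neg_pi_div_two_le_of_le <;> nlinarith
        · set y := (∑ i ∈ U, (a i : ℝ)) / 2 - m with hy
          have h1 : |y| ≤ 2 * X := by
            have : y = -(2 * (m : ℝ) - ∑ i ∈ U, (a i : ℝ)) / 2 := by rw [hy]; ring
            rw [this, abs_div, abs_neg]; norm_num; linarith
          have h2 : |θ * y| ≤ 1 / 4 := by
            rw [abs_mul]
            nlinarith [abs_nonneg θ, abs_nonneg y]
          rw [abs_le] at h2
          have e : 2 * Real.pi * θ * y = Real.pi * (2 * (θ * y)) := by ring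
          rw [e]
          apply Real.cos_nonneg_of_neg_pi_div_two_le_of_le <;> nlinarith
      exact le_trans (by rw [neg_nonpos]; positivity) this
  have hs := Finset.sum_le_sum hlow
  rw [Finset.sum_const, Finset.card_erase_of_mem hH, Finset.card_range] at hs
  rw [← Finset.add_sum_erase _ _ hH, hgH] at hzero'
  -- The `2 * H` nonzero frequencies together lose less than the main term `1`.
  have h2 : (2 * H + 1 - 1) • (-(1 / Q)) > -1 := by
    simp only [Nat.add_sub_cancel, nsmul_eq_mul]
    have : ((2 * H : ℕ) : ℝ) * (1 / Q) < 1 := by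
      rw [mul_one_div, div_lt_one hQ0, hQ]; push_cast; linarith
    linarith
  linarith

/-! ### Equidistribution modulo one of integers in a residue class. -/

/-- Counting terms of an arithmetic progression with a small step that are close to an integer. -/
theorem card_near_int_le (Z : ℕ) (ψ c κ : ℝ) (hψ : ψ ≠ 0) (hκ : 0 < κ) :
    (((Finset.range Z).filter fun z : ℕ =>
      |(z * ψ + c) - round (z * ψ + c)| < κ).card : ℝ) ≤
      (Z * |ψ| + 2) * (2 * κ / |ψ| + 1) := by
  classical
  set G := (Finset.range Z).filter fun z : ℕ => |(z * ψ + c) - round (z * ψ + c)| < κ with hG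
  have hψ' : 0 < |ψ| := abs_pos.2 hψ
  -- integers in a real interval
  have hcard : ∀ (s : Finset ℤ) (l L : ℝ), 0 ≤ L → (∀ x ∈ s, l ≤ x ∧ (x : ℝ) ≤ l + L) →
      (s.card : ℝ) ≤ L + 1 := by
    intro s l L hL hs
    have h1 : s ⊆ Finset.Icc ⌈l⌉ ⌊l + L⌋ := fun x hx =>
      Finset.mem_Icc.2 ⟨Int.ceil_le.2 (hs x hx).1, Int.le_floor.2 (hs x hx).2⟩
    have h2 := Finset.card_le_card h1
    rw [Int.card_Icc] at h2
    have h3 : (s.card : ℤ) ≤ max (⌊l + L⌋ + 1 - ⌈l⌉) 0 := by omega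
    have h4 : (s.card : ℝ) ≤ max ((⌊l + L⌋ : ℝ) + 1 - ⌈l⌉) 0 := by exact_mod_cast h3
    refine h4.trans (max_le ?_ (by linarith))
    linarith [Int.floor_le (l + L), Int.le_ceil l]
  -- Count by nearest integer `r`: the `z` sharing one `r` lie in an interval of length `2 * κ /
  -- |ψ|`, and few values of `r` occur since `z * ψ` ranges over length `Z * |ψ|`.
  have hfib : ∀ r ∈ G.image (fun z : ℕ => round (z * ψ + c)),
      (G.filter fun z : ℕ => round (z * ψ + c) = r).card ≤ ⌊2 * κ / |ψ| + 1⌋₊ := by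
    intro r _
    apply Nat.le_floor
    rw [← Finset.card_image_of_injective _ (Nat.cast_injective (R := ℤ))]
    apply hcard _ ((r - c) / ψ - κ / |ψ|) _ (by positivity)
    intro x hx
    obtain ⟨z, hz, rfl⟩ := Finset.mem_image.1 hx
    obtain ⟨hz1, hz2⟩ := Finset.mem_filter.1 hz
    have hz3 := (Finset.mem_filter.1 hz1).2
    rw [hz2] at hz3
    have : |(z : ℝ) - (r - c) / ψ| < κ / |ψ| := by
      rw [lt_div_iff₀ hψ', ← abs_mul]
      have e : ((z : ℝ) - (r - c) / ψ) * ψ = z * ψ + c - r := by field_simp; ring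
      rwa [e]
    rw [abs_lt] at this
    have e2 : 2 * κ / |ψ| = 2 * (κ / |ψ|) := by ring
    rw [e2]
    push_cast
    constructor <;> linarith
  have h1 := Finset.card_le_mul_card_image G _ hfib
  have h2 : ((G.image (fun z : ℕ => round (z * ψ + c))).card : ℝ) ≤ Z * |ψ| + 2 := by
    have := hcard (G.image (fun z : ℕ => round (z * ψ + c)))
      (c - 1 / 2 + min 0 (Z * ψ)) (Z * |ψ| + 1) (by positivity) (by
        intro x hx
        obtain ⟨z, hz, rfl⟩ := Finset.mem_image.1 hx
        have hzZ : (z : ℝ) ≤ Z := by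
          exact_mod_cast (Finset.mem_range.1 (Finset.mem_filter.1 hz).1).le
        have hz0 : (0 : ℝ) ≤ z := Nat.cast_nonneg z
        have hr := abs_le.1 (abs_sub_round ((z : ℝ) * ψ + c))
        rcases le_total 0 ψ with h | h
        · rw [abs_of_nonneg h, min_eq_left (by positivity)]
          constructor <;> nlinarith
        · rw [abs_of_nonpos h, min_eq_right (by nlinarith)]
          constructor <;> nlinarith)
    linarith
  have h3 : (G.card : ℝ) ≤ (⌊2 * κ / |ψ| + 1⌋₊ : ℝ) *
      (G.image (fun z : ℕ => round (z * ψ + c))).card := by exact_mod_cast h1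
  refine h3.trans ?_
  rw [mul_comm]
  exact mul_le_mul h2 (Nat.floor_le (by positivity)) (by positivity) (by positivity)

theorem abs_sub_round_le_abs_sub_int (x : ℝ) (z : ℤ) : |x - round x| ≤ |x - z| := round_le x z

/-- The integers in `(0, 3X]` that are `≡ 1 mod W` and whose product with `θ` is close to an
integer. -/
noncomputable def nearIntSet (W X : ℕ) (κ θ : ℝ) : Finset ℕ :=
  (Finset.Ioc 0 (3 * X)).filter fun x : ℕ =>
    x % W = 1 % W ∧ |(x : ℝ) * θ - round ((x : ℝ) * θ)| < κ

theorem mem_nearIntSet {W X : ℕ} {κ θ : ℝ} {x : ℕ} : x ∈ nearIntSet W X κ θ ↔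
    (0 < x ∧ x ≤ 3 * X) ∧ x % W = 1 % W ∧ |(x : ℝ) * θ - round ((x : ℝ) * θ)| < κ := by
  simp [nearIntSet]

/-- Pigeonhole on cells of length `W * Q`: two members of the set in one cell differ by `q * W` with
`q ≤ Q`, and subtracting their approximations by integers doubles the error. -/
theorem exists_small_multiple_of_card_gt (W X Q : ℕ) (κ θ : ℝ) (hW : 1 ≤ W) (hQ : 1 ≤ Q)
    (hcard : (3 * X / (W * Q) + 1 : ℝ) < (nearIntSet W X κ θ).card) :
    ∃ q : ℕ, 1 ≤ q ∧ q ≤ Q ∧ |((q : ℝ) * W * θ) - round ((q : ℝ) * W * θ)| < 2 * κ := by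
  have hmaps : ∀ x ∈ nearIntSet W X κ θ, x / (W * Q) ∈ Finset.range (3 * X / (W * Q) + 1) := by
    intro x hx
    exact Finset.mem_range.2 (Nat.lt_succ_of_le (Nat.div_le_div_right (mem_nearIntSet.1 hx).1.2))
  have hlt : (Finset.range (3 * X / (W * Q) + 1)).card < (nearIntSet W X κ θ).card := by
    rw [Finset.card_range]
    have h1 : ((3 * X / (W * Q) + 1 : ℕ) : ℝ) ≤ 3 * X / (W * Q) + 1 := by
      push_cast
      have := @Nat.cast_div_le ℝ _ _ _ (3 * X) (W * Q)
      push_cast at this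
      linarith
    exact_mod_cast h1.trans_lt hcard
  obtain ⟨x, hx, y, hy, hxy, hcell⟩ := Finset.exists_ne_map_eq_of_card_lt_of_maps_to hlt hmaps
  wlog hlt' : x < y generalizing x y
  · exact this y hy x hx (Ne.symm hxy) hcell.symm (by omega)
  obtain ⟨_, hxm, hxκ⟩ := mem_nearIntSet.1 hx
  obtain ⟨_, hym, hyκ⟩ := mem_nearIntSet.1 hy
  have hdvd : W ∣ y - x := (Nat.modEq_iff_dvd' hlt'.le).1 (hxm.trans hym.symm)
  obtain ⟨q, hq⟩ := hdvd
  have hyx : y = x + W * q := by omega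
  refine ⟨q, ?_, ?_, ?_⟩
  · rcases Nat.eq_zero_or_pos q with h | h
    · rw [h] at hyx; omega
    · exact h
  · by_contra! h
    have h1 : x + W * Q ≤ y := by
      rw [hyx]
      have := Nat.mul_le_mul_left W h.le
      omega
    have h2 : x / (W * Q) + 1 ≤ y / (W * Q) := by
      rw [← Nat.add_div_right _ (by positivity)]
      exact Nat.div_le_div_right h1
    omega
  · refine (abs_sub_round_le_abs_sub_int _
      (round ((y : ℝ) * θ) - round ((x : ℝ) * θ))).trans_lt ?_
    have e : (q : ℝ) * W * θ - ((round ((y : ℝ) * θ) - round ((x : ℝ) * θ) : ℤ) : ℝ) =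
        ((y : ℝ) * θ - round ((y : ℝ) * θ)) - ((x : ℝ) * θ - round ((x : ℝ) * θ)) := by
      rw [hyx]; push_cast; ring
    rw [e]
    have := abs_sub ((y : ℝ) * θ - round ((y : ℝ) * θ)) ((x : ℝ) * θ - round ((x : ℝ) * θ))
    linarith

/-- Split `1 mod W` into `q` classes modulo `q * W`. Along each of them `x * θ` advances by `ψ`
modulo one, so `card_near_int_le` applies. -/
theorem card_nearIntSet_le (W X q : ℕ) (κ θ ψ : ℝ) (p : ℤ) (hW : 1 ≤ W) (hq : 1 ≤ q)
    (hκ : 0 < κ) (hψ : (q : ℝ) * W * θ - p = ψ) (hψ0 : ψ ≠ 0) :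
    ((nearIntSet W X κ θ).card : ℝ) ≤
      (3 * X / W + q) * (2 * κ + |ψ|) + q * (4 * κ / |ψ|) + 2 * q := by
  classical
  set Z := 3 * X / (q * W) + 1 with hZ
  have hψ' : 0 < |ψ| := abs_pos.2 hψ0
  let S : ℕ → Finset ℕ := fun ρ => (Finset.range Z).filter fun z : ℕ =>
    |(z * ψ + ((W * ρ + 1 : ℕ) : ℝ) * θ) - round (z * ψ + ((W * ρ + 1 : ℕ) : ℝ) * θ)| < κ
  have hsub : nearIntSet W X κ θ ⊆ (Finset.range q).biUnion fun ρ =>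
      (S ρ).image fun z => q * W * z + (W * ρ + 1) := by
    intro x hx
    obtain ⟨⟨h0, hx1⟩, hx2, hx3⟩ := mem_nearIntSet.1 hx
    obtain ⟨y, hy⟩ := (Nat.modEq_iff_dvd' h0).1 (show 1 ≡ x [MOD W] from hx2.symm)
    have hxy : x = W * y + 1 := by omega
    have hdm := Nat.div_add_mod y q
    have hxe : x = q * W * (y / q) + (W * (y % q) + 1) := by
      rw [hxy]; nth_rewrite 1 [← hdm]; ring
    refine Finset.mem_biUnion.2 ⟨y % q, Finset.mem_range.2
      (Nat.mod_lt _ hq), Finset.mem_image.2 ⟨y / q, Finset.mem_filter.2 ⟨?_, ?_⟩, hxe.symm⟩⟩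
    · rw [Finset.mem_range, hZ, Nat.lt_succ_iff, Nat.le_div_iff_mul_le (by positivity)]
      calc y / q * (q * W) = q * W * (y / q) := by ring
        _ ≤ 3 * X := by omega
    · have e : ((y / q : ℕ) : ℝ) * ψ + ((W * (y % q) + 1 : ℕ) : ℝ) * θ =
          (x : ℝ) * θ - ((((y / q : ℕ) : ℤ) * p : ℤ) : ℝ) := by
        have : (x : ℝ) = q * W * (y / q : ℕ) + (W * (y % q : ℕ) + 1) := by exact_mod_cast hxe
        rw [this, ← hψ, Int.cast_mul, Int.cast_natCast]; push_cast; ring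
      rw [e, round_sub_intCast]
      rw [Int.cast_sub, sub_sub_sub_cancel_right]
      exact hx3
  have h1 := (Finset.card_le_card hsub).trans Finset.card_biUnion_le
  have h2 : ((∑ ρ ∈ Finset.range q, ((S ρ).image fun z => q * W * z + (W * ρ + 1)).card : ℕ) : ℝ) ≤
      q * ((Z * |ψ| + 2) * (2 * κ / |ψ| + 1)) := by
    push_cast
    rw [← nsmul_eq_mul]
    conv_rhs => rw [← Finset.card_range q]
    refine Finset.sum_le_card_nsmul _ _ _ fun ρ _ => ?_
    exact le_trans (by exact_mod_cast Finset.card_image_le) (card_near_int_le Z ψ _ κ hψ0 hκ)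
  have h3 : ((nearIntSet W X κ θ).card : ℝ) ≤ q * ((Z * |ψ| + 2) * (2 * κ / |ψ| + 1)) :=
    le_trans (by exact_mod_cast h1) h2
  have hWr : (0 : ℝ) < W := by exact_mod_cast hW
  have hqr : (0 : ℝ) < q := by exact_mod_cast hq
  have hZ' : q * (Z : ℝ) ≤ 3 * X / W + q := by
    rw [hZ]; push_cast
    have := @Nat.cast_div_le ℝ _ _ _ (3 * X) (q * W)
    push_cast at this
    calc (q : ℝ) * (((3 * X / (q * W) : ℕ) : ℝ) + 1)
        ≤ q * (3 * X / (q * W) + 1) := by gcongr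
      _ = 3 * X / W + q := by field_simp
  have h4 : q * ((Z * |ψ| + 2) * (2 * κ / |ψ| + 1)) =
      (q * Z) * (2 * κ + |ψ|) + q * (4 * κ / |ψ|) + 2 * q := by
    field_simp; ring
  have h6 : (q * (Z : ℝ)) * (2 * κ + |ψ|) ≤ (3 * X / W + q) * (2 * κ + |ψ|) := by gcongr
  linarith

/-- If `θ` is extremely close to `p / (q * W)`, an `x` in the set makes `x * p` divisible by `q *
W`. But `x ≡ 1` modulo `W` and `q ∣ W` make `x` coprime to `q * W`, so the fraction is an integer,
which the lower bound on the distance of `θ` to `ℤ` forbids. This is why the residue class `1` is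
used. -/
theorem nearIntSet_eq_empty (W X q : ℕ) (κ θ ψ C : ℝ) (p : ℤ) (hX : 1 ≤ X) (hq : 1 ≤ q)
    (hW : 1 ≤ W) (hqW : q ∣ W) (hψ : (q : ℝ) * W * θ - p = ψ)
    (hψC : |ψ| < C / X) (hC : C ≤ 1 / 8) (hκC : κ + 3 * C ≤ 1 / (q * W))
    (hθ : 1 / (8 * (X : ℝ)) ≤ |θ - round θ|) :
    nearIntSet W X κ θ = ∅ := by
  by_contra hne
  obtain ⟨x, hx⟩ := Finset.nonempty_iff_ne_empty.2 hne
  obtain ⟨⟨h0, hx1⟩, hx2, hx3⟩ := mem_nearIntSet.1 hx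
  have hWr : (1 : ℝ) ≤ W := by exact_mod_cast hW
  have hqr : (1 : ℝ) ≤ q := by exact_mod_cast hq
  have hXr : (1 : ℝ) ≤ X := by exact_mod_cast hX
  have hqW1 : (1 : ℝ) ≤ (q : ℝ) * W := by nlinarith
  have hcopW : Nat.Coprime x W := by
    rw [Nat.coprime_iff_gcd_eq_one, Nat.ModEq.gcd_eq (show x ≡ 1 [MOD W] from hx2)]
    simp
  have hcop : Nat.Coprime (q * W) x :=
    (Nat.Coprime.mul_right (hcopW.coprime_dvd_right hqW) hcopW).symm
  have hxX : (x : ℝ) ≤ 3 * X := by exact_mod_cast hx1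
  have hψX : |ψ| * X < C := by rwa [lt_div_iff₀ (by linarith)] at hψC
  set r := round ((x : ℝ) * θ) with hr
  have hxψ : |(x : ℝ) * ψ| < 3 * C := by
    rw [abs_mul, Nat.abs_cast]
    nlinarith [abs_nonneg ψ]
  -- the integer `x p - r q W` is too small to be non-zero
  have hz : |((x * p - r * (q * W : ℕ) : ℤ) : ℝ)| < 1 := by
    have e : ((x * p - r * (q * W : ℕ) : ℤ) : ℝ) =
        (q * W) * ((x : ℝ) * θ - r) - x * ψ := by
      rw [← hψ]; push_cast; ring
    rw [e]
    rw [le_div_iff₀ (by linarith)] at hκC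
    have h1 := abs_sub ((q * W) * ((x : ℝ) * θ - r)) (x * ψ)
    rw [abs_mul ((q : ℝ) * W), abs_of_pos (show (0 : ℝ) < q * W by linarith)] at h1
    have h2 : (q : ℝ) * W * |(x : ℝ) * θ - r| < q * W * κ := by
      apply mul_lt_mul_of_pos_left hx3; linarith
    have hC0 : 0 ≤ C := by
      have := (abs_nonneg ((x : ℝ) * ψ)).trans hxψ.le
      linarith
    nlinarith
  have hz0 : x * p - r * (q * W : ℕ) = 0 := by
    rw [← Int.abs_lt_one_iff]; exact_mod_cast hz
  have hdvd : ((q * W : ℕ) : ℤ) ∣ x * p := ⟨r, by linarith⟩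
  obtain ⟨s, hs⟩ := (Nat.isCoprime_iff_coprime.2 hcop).dvd_of_dvd_mul_left hdvd
  have hθs : |θ - s| < 1 / (8 * X) := by
    have e : θ - s = ψ / (q * W) := by
      rw [← hψ, hs]; push_cast; field_simp
    rw [e, abs_div, abs_of_pos (show (0 : ℝ) < q * W by linarith)]
    rw [div_lt_div_iff₀ (by linarith) (by linarith)]
    nlinarith
  linarith [abs_sub_round_le_abs_sub_int θ s]

/-- For a suitable modulus `W`, the integers `≡ 1 mod W` are equidistributed enough with respect to
every frequency away from the integers. -/
theorem exists_modulus_equidistributed (τ : ℝ) (hτ : 0 < τ) (hτ1 : τ ≤ 1) :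
    ∃ W : ℕ, 1 ≤ W ∧ ∃ κ : ℝ, 0 < κ ∧ ∀ᶠ X : ℕ in atTop, ∀ θ : ℝ,
      1 / (8 * (X : ℝ)) ≤ |θ - round θ| → ((nearIntSet W X κ θ).card : ℝ) ≤ τ * X / W := by
  obtain ⟨Q, hQ⟩ := exists_nat_ge (6 / τ)
  have hQτ : 6 ≤ Q * τ := by rwa [div_le_iff₀ hτ] at hQ
  have hQ1 : 1 ≤ Q := by
    by_contra! h
    have : Q = 0 := by omega
    rw [this] at hQτ
    norm_num at hQτ
  set W := Q.factorial with hW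
  have hW1 : 1 ≤ W := Nat.factorial_pos Q
  have hQr : (1 : ℝ) ≤ Q := by exact_mod_cast hQ1
  have hWr : (1 : ℝ) ≤ W := by exact_mod_cast hW1
  have hQW : (1 : ℝ) ≤ (Q : ℝ) * W := by nlinarith
  set κ := τ / (100 * ((Q : ℝ) * W) ^ 2) with hκ
  have hκ0 : 0 < κ := by positivity
  have hκQW : κ * (100 * ((Q : ℝ) * W) ^ 2) = τ := by rw [hκ]; field_simp
  have hκ12 : 12 * κ ≤ τ / 3 := by
    have : (1 : ℝ) ≤ ((Q : ℝ) * W) ^ 2 := by nlinarith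
    nlinarith
  refine ⟨W, hW1, κ, hκ0, ?_⟩
  have hev : ∀ᶠ X : ℕ in atTop, (2 * W / τ + 3 * W * (4 * κ * Q + 2 * Q) / τ + 1 : ℝ) ≤ X :=
    tendsto_natCast_atTop_atTop.eventually_ge_atTop _
  filter_upwards [hev] with X hX θ hθ
  by_contra! hbig
  have hp1 : 0 ≤ 3 * W * (4 * κ * Q + 2 * Q) / τ := by positivity
  have hp2 : 0 ≤ 2 * W / τ := by positivity
  have hXp1 : (2 * W / τ : ℝ) ≤ X := by linarith
  have hXp2 : (3 * W * (4 * κ * Q + 2 * Q) / τ : ℝ) ≤ X := by linarith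
  have hX1 : (1 : ℝ) ≤ X := by linarith
  rw [div_le_iff₀ hτ] at hXp1 hXp2
  obtain ⟨q, hq1, hqQ, hqκ⟩ := exists_small_multiple_of_card_gt W X Q κ θ hW1 hQ1 (by
    refine lt_of_le_of_lt ?_ hbig
    have e : (3 * X / (W * Q) : ℝ) ≤ τ * X / W / 2 := by
      rw [div_div, div_le_div_iff₀ (by positivity) (by positivity)]
      have : (0 : ℝ) ≤ X * W := by positivity
      nlinarith
    have e2 : 1 ≤ τ * X / W / 2 := by
      rw [div_div, le_div_iff₀ (by positivity)]; linarith
    linarith)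
  set p := round ((q : ℝ) * W * θ) with hp
  set ψ := (q : ℝ) * W * θ - p with hψ
  have hqr : (1 : ℝ) ≤ q := by exact_mod_cast hq1
  have hqQr : (q : ℝ) ≤ Q := by exact_mod_cast hqQ
  have hqW : (1 : ℝ) ≤ (q : ℝ) * W := by nlinarith
  have hqWQW : (q : ℝ) * W ≤ (Q : ℝ) * W := by gcongr
  -- At this threshold the term `q * (4 * κ / |ψ|)` of `card_nearIntSet_le` is at most a third of `τ
  -- * X / W`; below it, `θ` is so close to a fraction that the set is empty.
  by_cases hcase : 12 * κ * Q * W / τ / X ≤ |ψ|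
  · have hψ0 : 0 < |ψ| := lt_of_lt_of_le (by positivity) hcase
    have h3 := card_nearIntSet_le W X q κ θ ψ p hW1 hq1 hκ0 hψ.symm (abs_pos.1 hψ0)
    have h5 : κ / |ψ| ≤ τ * X / (12 * Q * W) := by
      rw [div_le_div_iff₀ hψ0 (by positivity)]
      rw [div_div, div_le_iff₀ (by positivity)] at hcase
      linarith
    have h6 : (3 * X / W + (q : ℝ)) * (2 * κ + |ψ|) ≤ (3 * X / W + q) * (4 * κ) := by
      apply mul_le_mul_of_nonneg_left (by linarith) (by positivity)
    have h7 : q * (4 * κ / |ψ|) ≤ τ * X / (3 * W) := by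
      calc q * (4 * κ / |ψ|) = 4 * q * (κ / |ψ|) := by ring
        _ ≤ 4 * Q * (τ * X / (12 * Q * W)) := by gcongr
        _ = τ * X / (3 * W) := by field_simp; norm_num
    have h8 : 4 * κ * q + 2 * q ≤ τ * X / (3 * W) := by
      rw [le_div_iff₀ (by positivity)]
      have h81 : 4 * κ * q + 2 * q ≤ 4 * κ * Q + 2 * Q := by gcongr
      have h82 := mul_le_mul_of_nonneg_right h81 (show (0 : ℝ) ≤ 3 * W by positivity)
      linarith
    have h9 : 3 * X / W * (4 * κ) ≤ τ * X / (3 * W) := by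
      rw [div_mul_eq_mul_div, div_le_div_iff₀ (by positivity) (by positivity)]
      have h91 := mul_le_mul_of_nonneg_left hκ12 (show (0 : ℝ) ≤ 3 * X * W by positivity)
      linarith
    have h10 : τ * X / (3 * W) = τ * X / W / 3 := by field_simp
    rw [h10] at h7 h8 h9
    linarith
  · push Not at hcase
    have hC : 12 * κ * Q * W / τ = 12 / 100 * (1 / (Q * W)) := by
      rw [hκ]; field_simp
    have hle : 1 / ((Q : ℝ) * W) ≤ 1 / (q * W) :=
      one_div_le_one_div_of_le (by linarith) hqWQW
    have hone : 1 / ((Q : ℝ) * W) ≤ 1 := by rw [div_le_one (by linarith)]; exact hQW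
    have hκle : κ ≤ 1 / 100 * (1 / ((Q : ℝ) * W)) := by
      rw [hκ, div_mul_div_comm, one_mul, div_le_div_iff₀ (by positivity) (by positivity)]
      nlinarith
    have hemp := nearIntSet_eq_empty W X q κ θ ψ (12 * κ * Q * W / τ) p (by exact_mod_cast hX1)
      hq1 hW1 (Nat.dvd_factorial hq1 hqQ) hψ.symm hcase (by rw [hC]; linarith)
      (by rw [hC]; linarith) hθ
    rw [hemp, Finset.card_empty, Nat.cast_zero] at hbig
    have : 0 ≤ τ * X / W := by positivity
    linarith

/-! ### Derandomised choice of points. -/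

/-- Choosing points one after the other without increasing the average of a weighted sum of
products. -/
theorem exists_prod_le_avg {ι : Type*} (Θ : Finset ι) (g : ι → ℕ → ℝ)
    (J : ℕ → Finset ℕ) (K : Finset ℕ) (hJ : ∀ k ∈ K, (J k).Nonempty)
    (w : ι → ℝ) :
    ∃ a : ℕ → ℕ, (∀ k ∈ K, a k ∈ J k) ∧
      ∑ θ ∈ Θ, w θ * ∏ k ∈ K, g θ (a k) ≤
        ∑ θ ∈ Θ, w θ * ∏ k ∈ K, ((∑ x ∈ J k, g θ x) / (J k).card) := by
  classical
  induction K using Finset.induction_on generalizing w with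
  | empty => exact ⟨fun _ => 0, by simp, by simp⟩
  | insert k₀ K hk ih =>
    have hne := hJ k₀ (Finset.mem_insert_self _ _)
    have hc : (0 : ℝ) < (J k₀).card := by exact_mod_cast hne.card_pos
    set P : ι → ℝ := fun θ => ∏ k ∈ K, ((∑ x ∈ J k, g θ x) / (J k).card) with hP
    -- Method of conditional expectations: some value is no worse than the average over `J k₀`. Its
    -- factor is absorbed into the weights before recursing.
    obtain ⟨x₀, hx₀, hle⟩ : ∃ x ∈ J k₀, ∑ θ ∈ Θ, w θ * g θ x * P θ ≤
        ∑ θ ∈ Θ, w θ * ((∑ x ∈ J k₀, g θ x) / (J k₀).card) * P θ := by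
      apply Finset.exists_le_of_sum_le hne
      rw [Finset.sum_const, nsmul_eq_mul, Finset.sum_comm, Finset.mul_sum]
      refine (Finset.sum_congr rfl fun θ _ => ?_).le
      rw [← Finset.sum_mul, ← Finset.mul_sum]
      field_simp
    obtain ⟨a, ha, hsum⟩ := ih (fun k hk => hJ k (Finset.mem_insert_of_mem hk))
      (fun θ => w θ * g θ x₀)
    have hne' : ∀ k ∈ K, k ≠ k₀ := fun k hkK h => hk (h ▸ hkK)
    refine ⟨Function.update a k₀ x₀, ?_, ?_⟩
    · intro k hkK
      rcases Finset.mem_insert.1 hkK with rfl | h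
      · simpa using hx₀
      · rw [Function.update_of_ne (hne' k h)]; exact ha k h
    · calc ∑ θ ∈ Θ, w θ * ∏ k ∈ insert k₀ K, g θ (Function.update a k₀ x₀ k)
          = ∑ θ ∈ Θ, w θ * g θ x₀ * ∏ k ∈ K, g θ (a k) := by
            refine Finset.sum_congr rfl fun θ _ => ?_
            rw [Finset.prod_insert hk, Function.update_self, mul_assoc]
            congr 2
            exact Finset.prod_congr rfl fun k h => by rw [Function.update_of_ne (hne' k h)]
        _ ≤ ∑ θ ∈ Θ, w θ * g θ x₀ * P θ := hsum
        _ ≤ _ := hle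
        _ = _ := by
            refine Finset.sum_congr rfl fun θ _ => ?_
            rw [Finset.prod_insert hk, mul_assoc]

/-- A choice of one point in each of several disjoint sets such that, for each of finitely many
events, only few of the chosen points lie in the event. -/
theorem exists_choice_card_lt {ι : Type*} (Θ : Finset ι) (E : ι → Finset ℕ) (J : ℕ → Finset ℕ)
    (K : Finset ℕ) (hdisj : (K : Set ℕ).PairwiseDisjoint J) (D B s : ℝ) (hD : 0 < D)
    (hJ : ∀ k ∈ K, D ≤ (J k).card) (hB : ∀ θ ∈ Θ, ((E θ).card : ℝ) ≤ B)
    (hexp : Θ.card * Real.exp (2 * B / D) < Real.exp s) :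
    ∃ a : ℕ → ℕ, (∀ k ∈ K, a k ∈ J k) ∧
      ∀ θ ∈ Θ, ((K.filter fun k => a k ∈ E θ).card : ℝ) < s := by
  classical
  -- Chernoff weights: the product over `K` is `exp` of the number of chosen points in `E θ`. Each
  -- average is at most `1 + 2 p ≤ exp (2 p)`, where `p` is the proportion of `J k` in `E θ`, and
  -- disjointness of the `J k` bounds the total exponent.
  set g : ι → ℕ → ℝ := fun θ x => if x ∈ E θ then Real.exp 1 else 1 with hg
  have hg0 : ∀ θ x, 0 ≤ g θ x := by
    intro θ x; rw [hg]; dsimp only; split_ifs <;> positivity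
  have hJc : ∀ k ∈ K, (0 : ℝ) < (J k).card := fun k hk => hD.trans_le (hJ k hk)
  obtain ⟨a, ha, hsum⟩ := exists_prod_le_avg Θ g J K
    (fun k hk => Finset.card_pos.1 (by exact_mod_cast hJc k hk)) (fun _ => 1)
  refine ⟨a, ha, fun θ hθ => ?_⟩
  simp only [one_mul] at hsum
  have h1 : ∀ θ, ∏ k ∈ K, g θ (a k) = Real.exp (K.filter fun k => a k ∈ E θ).card := by
    intro θ
    rw [hg]; dsimp only
    rw [Finset.prod_ite]
    simp [← Real.exp_nat_mul]
  have h2 : ∀ θ ∈ Θ, ∏ k ∈ K, ((∑ x ∈ J k, g θ x) / (J k).card) ≤ Real.exp (2 * B / D) := by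
    intro θ hθ
    have h3 : ∀ k ∈ K, (∑ x ∈ J k, g θ x) / (J k).card ≤
        Real.exp (2 / D * ((J k).filter (· ∈ E θ)).card) := by
      intro k hk
      have e : ∑ x ∈ J k, g θ x =
          (J k).card + (Real.exp 1 - 1) * ((J k).filter (· ∈ E θ)).card := by
        rw [hg]; dsimp only
        rw [Finset.sum_ite, Finset.sum_const, Finset.sum_const]
        have := Finset.card_filter_add_card_filter_not (s := J k) (· ∈ E θ)
        have : ((J k).card : ℝ) = ((J k).filter (· ∈ E θ)).card +
          ((J k).filter (¬ · ∈ E θ)).card := by exact_mod_cast this.symm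
        simp only [nsmul_eq_mul, mul_one]
        rw [this]; ring
      have hk0 := hJc k hk
      have hexp1 : Real.exp 1 - 1 ≤ 2 := by linarith [Real.exp_one_lt_three]
      have h4 : (∑ x ∈ J k, g θ x) / (J k).card ≤
          1 + 2 / D * ((J k).filter (· ∈ E θ)).card := by
        rw [e, add_div, div_self hk0.ne']
        gcongr
        rw [div_le_iff₀ hk0]
        have h5 : (2 : ℝ) ≤ 2 / D * (J k).card := by
          rw [div_mul_eq_mul_div, le_div_iff₀ hD]
          linarith [hJ k hk]
        have h6 : (0 : ℝ) ≤ ((J k).filter (· ∈ E θ)).card := by positivity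
        nlinarith
      linarith [Real.add_one_le_exp (2 / D * ((J k).filter (· ∈ E θ)).card : ℝ)]
    refine (Finset.prod_le_prod (fun k hk => div_nonneg (Finset.sum_nonneg fun x _ => hg0 θ x)
      (hJc k hk).le) h3).trans ?_
    rw [← Real.exp_sum, ← Finset.mul_sum, Real.exp_le_exp]
    have h5 : ∑ k ∈ K, (((J k).filter (· ∈ E θ)).card : ℝ) ≤ B := by
      refine le_trans ?_ (hB θ hθ)
      rw [← Nat.cast_sum, ← Finset.card_biUnion]
      · exact_mod_cast Finset.card_le_card fun x hx => by
          obtain ⟨k, _, hx⟩ := Finset.mem_biUnion.1 hx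
          exact (Finset.mem_filter.1 hx).2
      · intro k hk l hl hkl
        exact (hdisj hk hl hkl).mono (Finset.filter_subset _ _) (Finset.filter_subset _ _)
    rw [mul_div_right_comm]
    gcongr
  have h7 : Real.exp ((K.filter fun k => a k ∈ E θ).card : ℝ) < Real.exp s := by
    rw [← h1]
    refine lt_of_le_of_lt ?_ hexp
    refine (Finset.single_le_sum (f := fun θ => ∏ k ∈ K, g θ (a k))
      (fun θ _ => Finset.prod_nonneg fun k _ => hg0 θ _) hθ).trans (hsum.trans ?_)
    rw [← nsmul_eq_mul]
    exact Finset.sum_le_card_nsmul _ _ _ h2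
  exact Real.exp_lt_exp.1 h7

/-! ### Counting terms and gaps in dyadic blocks. -/

theorem card_Ico_filter_mod_ge (u v W : ℕ) (hW : 1 ≤ W) :
    ((v : ℝ) - u) / W - 1 ≤ (((Finset.Ico u v).filter fun x => x % W = 1 % W).card : ℝ) := by
  have h := Nat.Ico_filter_modEq_card u v hW 1
  have h' : (((Finset.Ico u v).filter fun x => x % W = 1 % W).card : ℤ) =
      max (⌈((v : ℚ) - (1 : ℕ)) / W⌉ - ⌈((u : ℚ) - (1 : ℕ)) / W⌉) 0 := h
  have h2 : (((Finset.Ico u v).filter fun x => x % W = 1 % W).card : ℚ) ≥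
      ((v : ℚ) - u) / W - 1 := by
    have h3 : (((Finset.Ico u v).filter fun x => x % W = 1 % W).card : ℤ) ≥
      ⌈((v : ℚ) - (1 : ℕ)) / W⌉ - ⌈((u : ℚ) - (1 : ℕ)) / W⌉ := by rw [h']; exact le_max_left _ _
    have h4 : (((Finset.Ico u v).filter fun x => x % W = 1 % W).card : ℚ) ≥
      (⌈((v : ℚ) - (1 : ℕ)) / W⌉ : ℚ) - ⌈((u : ℚ) - (1 : ℕ)) / W⌉ := by exact_mod_cast h3
    have h5 := Int.le_ceil (((v : ℚ) - (1 : ℕ)) / W)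
    have h6 := Int.ceil_lt_add_one (((u : ℚ) - (1 : ℕ)) / W)
    have h7 : ((v : ℚ) - u) / W = ((v : ℚ) - (1 : ℕ)) / W - ((u : ℚ) - (1 : ℕ)) / W := by ring
    linarith
  exact_mod_cast h2

/-- The number of terms of the strictly increasing sequence `b` that are at most `x`. -/
def idx (b : ℕ → ℕ) (x : ℕ) : ℕ := ((Finset.Icc 1 x).filter fun k => b k ≤ x).card

theorem le_self_of_strictMonoOn {b : ℕ → ℕ} (hb : IsPosSeq b) (hm : StrictMonoOn b (Set.Ici 1))
    {k : ℕ} (hk : 1 ≤ k) : k ≤ b k := by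
  induction k, hk using Nat.le_induction with
  | base => exact hb 1 le_rfl
  | succ k hk ih =>
    have := hm (Set.mem_Ici.2 hk) (Set.mem_Ici.2 (by omega : 1 ≤ k + 1)) (Nat.lt_succ_self k)
    omega

theorem le_idx_iff {b : ℕ → ℕ} (hb : IsPosSeq b) (hm : StrictMonoOn b (Set.Ici 1))
    {k x : ℕ} (hk : 1 ≤ k) : k ≤ idx b x ↔ b k ≤ x := by
  constructor
  · intro h
    by_contra! hlt
    have hsub : (Finset.Icc 1 x).filter (fun k => b k ≤ x) ⊆ Finset.Icc 1 (k - 1) := by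
      intro l hl
      rw [Finset.mem_filter, Finset.mem_Icc] at hl
      rw [Finset.mem_Icc]
      refine ⟨hl.1.1, ?_⟩
      by_contra! hkl
      have := hm.monotoneOn (Set.mem_Ici.2 hk) (Set.mem_Ici.2 hl.1.1) (by omega : k ≤ l)
      omega
    have := Finset.card_le_card hsub
    rw [Nat.card_Icc] at this
    unfold idx at h
    omega
  · intro h
    have hsub : Finset.Icc 1 k ⊆ (Finset.Icc 1 x).filter (fun k => b k ≤ x) := by
      intro l hl
      rw [Finset.mem_Icc] at hl
      have h1 := hm.monotoneOn (Set.mem_Ici.2 hl.1) (Set.mem_Ici.2 hk) hl.2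
      have h2 := le_self_of_strictMonoOn hb hm hl.1
      rw [Finset.mem_filter, Finset.mem_Icc]
      exact ⟨⟨hl.1, by omega⟩, by omega⟩
    have := Finset.card_le_card hsub
    rw [Nat.card_Icc] at this
    unfold idx
    omega

theorem idx_mono (b : ℕ → ℕ) : Monotone (idx b) := by
  intro x y hxy
  refine Finset.card_le_card fun k hk => ?_
  rw [Finset.mem_filter, Finset.mem_Icc] at hk ⊢
  omega

theorem idx_le (b : ℕ → ℕ) (x : ℕ) : idx b x ≤ x := by
  refine (Finset.card_filter_le _ _).trans ?_
  simp

theorem idx_lt_iff {b : ℕ → ℕ} (hb : IsPosSeq b) (hm : StrictMonoOn b (Set.Ici 1))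
    {k x : ℕ} (hk : 1 ≤ k) : idx b x < k ↔ x < b k := by
  rw [← not_le, ← not_le, le_idx_iff hb hm hk]

theorem countIn_eq_idx {b : ℕ → ℕ} (hb : IsPosSeq b) (hm : StrictMonoOn b (Set.Ici 1)) (x : ℕ) :
    countIn b (Set.Ici 1) x = idx b x := by
  have : {i | i ∈ Set.Ici 1 ∧ b i ≤ x} = (Finset.Icc 1 (idx b x) : Set ℕ) := by
    ext i
    simp only [Set.mem_ofPred_eq, Set.mem_Ici, Finset.coe_Icc, Set.mem_Icc]
    refine and_congr_right fun hi => (le_idx_iff hb hm hi).symm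
  rw [countIn, this, Set.encard_coe_eq_coe_finsetCard, Nat.card_Icc]
  simp

/-- The indices `k` with `2 ^ i < b k ≤ 2 ^ (i + 1)`. -/
def dyadicBlock (b : ℕ → ℕ) (i : ℕ) : Finset ℕ := Finset.Ioc (idx b (2 ^ i)) (idx b (2 ^ (i + 1)))

theorem mem_dyadicBlock {b : ℕ → ℕ} (hb : IsPosSeq b) (hm : StrictMonoOn b (Set.Ici 1))
    {k i : ℕ} : k ∈ dyadicBlock b i ↔ 1 ≤ k ∧ 2 ^ i < b k ∧ b k ≤ 2 ^ (i + 1) := by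
  rw [dyadicBlock, Finset.mem_Ioc]
  constructor
  · rintro ⟨h1, h2⟩
    have hk : 1 ≤ k := by omega
    exact ⟨hk, (idx_lt_iff hb hm hk).1 h1, (le_idx_iff hb hm hk).1 h2⟩
  · rintro ⟨hk, h1, h2⟩
    exact ⟨(idx_lt_iff hb hm hk).2 h1, (le_idx_iff hb hm hk).2 h2⟩

theorem card_dyadicBlock (b : ℕ → ℕ) (i : ℕ) :
    (dyadicBlock b i).card = idx b (2 ^ (i + 1)) - idx b (2 ^ i) := by
  rw [dyadicBlock, Nat.card_Ioc]

theorem IsFriendly.tendsto_card_block {ε : ℝ} {b : ℕ → ℕ} (hb : IsPosSeq b) (h : IsFriendly ε b) :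
    Tendsto (fun i : ℕ => ((dyadicBlock b i).card : ℝ) / i) atTop atTop := by
  have := h.tendsto_count
  simp only [countIn_eq_idx hb h.strictMono, ENat.toNat_natCast] at this
  refine this.congr fun i => ?_
  rw [card_dyadicBlock, Nat.cast_sub (idx_mono b (Nat.pow_le_pow_right (by norm_num) (by omega)))]

theorem IsFriendly.eventually_card_block_ge {ε : ℝ} {b : ℕ → ℕ} (hb : IsPosSeq b)
    (h : IsFriendly ε b) (M : ℝ) :
    ∀ᶠ i : ℕ in atTop, M * i ≤ ((dyadicBlock b i).card : ℝ) := by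
  filter_upwards [(h.tendsto_card_block hb).eventually_ge_atTop M, eventually_gt_atTop 0]
    with i hi h0
  rwa [le_div_iff₀ (by exact_mod_cast h0)] at hi

theorem sub_le_of_discDeriv_le (b : ℕ → ℕ) (D : ℝ) {u v : ℕ} (huv : u ≤ v)
    (h : ∀ k, u ≤ k → k < v → discDeriv b k ≤ D) : (b v : ℝ) - b u ≤ (v - u) * D := by
  induction v, huv using Nat.le_induction with
  | base => simp
  | succ v hv ih =>
    have h1 := ih fun k hk hkv => h k hk (by omega)
    have h2 := h v hv (by omega)
    unfold discDeriv at h2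
    push_cast
    linarith

theorem le_sub_of_le_discDeriv (b : ℕ → ℕ) (D : ℝ) {u v : ℕ} (huv : u ≤ v)
    (h : ∀ k, u ≤ k → k < v → D ≤ discDeriv b k) : (v - u) * D ≤ (b v : ℝ) - b u := by
  induction v, huv using Nat.le_induction with
  | base => simp
  | succ v hv ih =>
    have h1 := ih fun k hk hkv => h k hk (by omega)
    have h2 := h v hv (by omega)
    unfold discDeriv at h2
    push_cast
    linarith

theorem discDeriv_pos {b : ℕ → ℕ} (hm : StrictMonoOn b (Set.Ici 1)) {k : ℕ} (hk : 1 ≤ k) :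
    0 < discDeriv b k := by
  have := hm (Set.mem_Ici.2 hk) (Set.mem_Ici.2 (by omega : 1 ≤ k + 1)) (Nat.lt_succ_self k)
  unfold discDeriv
  have : (b k : ℝ) < b (k + 1) := by exact_mod_cast this
  linarith

/-- The gaps of a friendly sequence in and after the `i`-th dyadic block, compared with the first
gap `δ` in the block. -/
theorem IsFriendly.exists_gap {ε : ℝ} {b : ℕ → ℕ} (hb : IsPosSeq b) (h : IsFriendly ε b) :
    ∃ c : ℝ, 0 < c ∧ c < 1 ∧ ∀ᶠ i : ℕ in atTop, ∃ δ : ℝ, 0 < δ ∧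
      (∀ k ∈ dyadicBlock b i, c * δ ≤ discDeriv b k ∧ discDeriv b k ≤ δ / c) ∧
      (2 ^ i : ℝ) ≤ ((dyadicBlock b i).card + 1) * (δ / c) ∧
      ∀ j, i ≤ j → (((dyadicBlock b j).card : ℝ) - 1) * (c * δ) ≤ 2 ^ j := by
  obtain ⟨c, hc0, hc1, hc⟩ := h.deriv_comparable
  have hm := h.strictMono
  refine ⟨c, hc0, hc1, ?_⟩
  have hb1 : ∀ᶠ i : ℕ in atTop, b 1 ≤ 2 ^ i :=
    (tendsto_pow_atTop_atTop_of_one_lt (by norm_num : 1 < 2)).eventually_ge_atTop (b 1)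
  filter_upwards [hb1, h.eventually_card_block_ge hb 1, eventually_ge_atTop 1] with i hi1 hcard hi0
  set P := idx b (2 ^ i) with hP
  have hP1 : 1 ≤ P := (le_idx_iff hb hm le_rfl).2 hi1
  set p := P + 1 with hp
  set δ := discDeriv b p with hδ
  have hδ0 : 0 < δ := discDeriv_pos hm (by omega)
  have hδc : δ ≤ δ / c := by rw [le_div_iff₀ hc0]; nlinarith
  have hcδ : c * δ ≤ δ := by nlinarith
  have hbp : 2 ^ i < b p := (idx_lt_iff hb hm (by omega)).1 (by omega)
  have hlow : ∀ k, p ≤ k → c * δ ≤ discDeriv b k := by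
    intro k hk
    rcases hk.eq_or_lt with rfl | hk
    · exact hcδ
    · exact (hc p k (by omega) hk).1
  have hcard1 : 1 ≤ (dyadicBlock b i).card := by
    have : (1 : ℝ) ≤ i := by exact_mod_cast hi0
    have : (1 : ℝ) ≤ (dyadicBlock b i).card := by linarith
    exact_mod_cast this
  have hup : ∀ k ∈ dyadicBlock b i, discDeriv b k ≤ δ / c := by
    intro k hk
    have hk' := (mem_dyadicBlock hb hm).1 hk
    have hpk : p ≤ k := (Finset.mem_Ioc.1 hk).1
    rcases hpk.eq_or_lt with hpk | hpk
    · rw [← hpk]; exact hδc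
    · have := (hc p k (by omega) hpk).2 (by rw [pow_succ] at hk'; omega)
      rwa [one_div_mul_eq_div] at this
  refine ⟨δ, hδ0, fun k hk => ⟨hlow k (Finset.mem_Ioc.1 hk).1, hup k hk⟩, ?_, ?_⟩
  -- From the last term at most `2 ^ i` to the first one above `2 ^ (i + 1)` there are `card + 1`
  -- gaps. The first of them precedes the block, and is bounded by comparing it with `δ` in the
  -- other direction.
  · set q := idx b (2 ^ (i + 1)) + 1 with hq
    rw [card_dyadicBlock] at hcard1
    have h1 := sub_le_of_discDeriv_le b (δ / c) (u := P) (v := q) (by omega) (by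
      intro k hPk hkq
      rcases hPk.eq_or_lt with hPk | hPk
      · rw [le_div_iff₀ hc0, mul_comm, ← hPk]
        exact (hc P p hP1 (by omega)).1
      · exact hup k (Finset.mem_Ioc.2 ⟨hPk, by omega⟩))
    have h2 : 2 ^ (i + 1) < b q := (idx_lt_iff hb hm (by omega)).1 (by omega)
    have h3 : b P ≤ 2 ^ i := (le_idx_iff hb hm hP1).1 le_rfl
    have h2' : (2 : ℝ) ^ (i + 1) ≤ b q := by exact_mod_cast h2.le
    have h3' : (b P : ℝ) ≤ 2 ^ i := by exact_mod_cast h3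
    have e : (q : ℝ) - P = (dyadicBlock b i).card + 1 := by
      rw [card_dyadicBlock, Nat.cast_sub (by omega), hq]; push_cast; ring
    rw [e] at h1
    rw [pow_succ] at h2'
    linarith
  · intro j hij
    rcases Nat.eq_zero_or_pos (dyadicBlock b j).card with h0 | h0
    · rw [h0]
      have : (0 : ℝ) < 2 ^ j := by positivity
      have : 0 < c * δ := by positivity
      push_cast; linarith
    · have hPj : P ≤ idx b (2 ^ j) := idx_mono b (Nat.pow_le_pow_right (by norm_num) hij)
      rw [card_dyadicBlock] at h0
      set u := idx b (2 ^ j) + 1 with hu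
      set v := idx b (2 ^ (j + 1)) with hv
      have h1 := le_sub_of_le_discDeriv b (c * δ) (u := u) (v := v) (by omega)
        fun k hk _ => hlow k (by omega)
      have h2 : 2 ^ j < b u := (idx_lt_iff hb hm (by omega)).1 (by omega)
      have h3 : b v ≤ 2 ^ (j + 1) := (le_idx_iff hb hm (by omega)).1 le_rfl
      have h2' : (2 : ℝ) ^ j ≤ b u := by exact_mod_cast h2.le
      have h3' : (b v : ℝ) ≤ 2 ^ (j + 1) := by exact_mod_cast h3
      have e : ((dyadicBlock b j).card : ℝ) - 1 = (v : ℝ) - u := by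
        rw [card_dyadicBlock, Nat.cast_sub (by omega), hu]; push_cast; ring
      rw [e]
      rw [pow_succ] at h3'
      linarith

/-! ### Interlacing sequences that are good on dyadic blocks. -/

theorem abs_le_abs_sub_round (θ : ℝ) (hθ : |θ| ≤ 1 / 2) : |θ| ≤ |θ - round θ| := by
  rcases eq_or_ne (round θ) 0 with h | h
  · rw [h]; simp
  · have h1 : (1 : ℝ) ≤ |(round θ : ℝ)| := by exact_mod_cast Int.one_le_abs h
    have h2 := abs_sub_abs_le_abs_sub (round θ : ℝ) θ
    rw [abs_sub_comm] at h2
    linarith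

/-- The terms `a k` with `k` in the `i`-th block of `b` are such that every subset of the block of
relative density `τ` has all integers near half of its sum as subset sums. -/
def IsGoodOnBlock (a b : ℕ → ℕ) (τ : ℝ) (i : ℕ) : Prop :=
  ∀ U ⊆ dyadicBlock b i, τ * (dyadicBlock b i).card ≤ U.card →
    ∀ m : ℕ, |2 * (m : ℝ) - ∑ k ∈ U, (a k : ℝ)| ≤ 4 * 2 ^ i → ∃ T ⊆ U, ∑ k ∈ T, a k = m

theorem IsGoodOnBlock.congr {a a' b : ℕ → ℕ} {τ : ℝ} {i : ℕ} (h : IsGoodOnBlock a b τ i)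
    (haa : ∀ k ∈ dyadicBlock b i, a k = a' k) : IsGoodOnBlock a' b τ i := by
  intro U hU hcard m hm
  have e : ∑ k ∈ U, (a' k : ℝ) = ∑ k ∈ U, (a k : ℝ) :=
    Finset.sum_congr rfl fun k hk => by rw [haa k (hU hk)]
  rw [e] at hm
  obtain ⟨T, hT, hs⟩ := h U hU hcard m hm
  exact ⟨T, hT, by rw [← hs]; exact Finset.sum_congr rfl fun k hk => (haa k (hU (hT hk))).symm⟩

/-- Points that avoid concentration near the integers at all frequencies are good. -/
theorem isGoodOnBlock_of_equidistributed {a b : ℕ → ℕ} {τ κ : ℝ} {i : ℕ} (hi : 1 ≤ i)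
    (hκ : 0 < κ)
    (ha : ∀ k ∈ dyadicBlock b i, a k ≤ 3 * 2 ^ i)
    (hcard : 10 * i ≤ κ ^ 2 * τ * (dyadicBlock b i).card)
    (hnear : ∀ h ∈ Finset.range (2 * (4 * 4 ^ i) + 1),
      1 / (8 * ((2 ^ i : ℕ) : ℝ)) ≤
        |((h : ℝ) - (4 * 4 ^ i : ℕ)) / ((2 * (4 * 4 ^ i) + 1 : ℕ) : ℝ)| →
      (((dyadicBlock b i).filter fun k =>
        |(a k : ℝ) * (((h : ℝ) - (4 * 4 ^ i : ℕ)) / ((2 * (4 * 4 ^ i) + 1 : ℕ) : ℝ)) -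
          round ((a k : ℝ) * (((h : ℝ) - (4 * 4 ^ i : ℕ)) /
            ((2 * (4 * 4 ^ i) + 1 : ℕ) : ℝ)))| < κ).card : ℝ) ≤
        τ * (dyadicBlock b i).card / 2) :
    IsGoodOnBlock a b τ i := by
  intro U hU hUcard m hm
  set n := (dyadicBlock b i).card with hn
  have h4 : (4 : ℕ) ^ i = 2 ^ i * 2 ^ i := by rw [← mul_pow]; norm_num
  have h1i : 1 ≤ 2 ^ i := Nat.one_le_two_pow
  have hsum : ∑ k ∈ U, a k ≤ 6 * 4 ^ i := by
    have h1 : ∑ k ∈ U, a k ≤ U.card * (3 * 2 ^ i) := by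
      rw [← smul_eq_mul]
      exact Finset.sum_le_card_nsmul _ _ _ fun k hk => ha k (hU hk)
    have h2 : U.card ≤ 2 ^ (i + 1) := (Finset.card_le_card hU).trans (by
      rw [card_dyadicBlock]
      exact (Nat.sub_le _ _).trans (idx_le _ _))
    calc ∑ k ∈ U, a k ≤ 2 ^ (i + 1) * (3 * 2 ^ i) := h1.trans (Nat.mul_le_mul_right _ h2)
      _ = 6 * 4 ^ i := by rw [h4, pow_succ]; ring
  have hmle : m ≤ 5 * 4 ^ i := by
    have h1 := (abs_le.1 hm).2
    have h2 : (∑ k ∈ U, (a k : ℝ)) ≤ 6 * 4 ^ i := by exact_mod_cast hsum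
    have h3 : (2 : ℝ) ^ i ≤ 4 ^ i := by gcongr; norm_num
    have : (m : ℝ) ≤ 5 * 4 ^ i := by linarith
    exact_mod_cast this
  -- `H = 4 * 4 ^ i` is valid for every `U`: the total is at most `6 * 4 ^ i` and `m` at most `5 * 4
  -- ^ i`. The number of frequencies stays `O(4 ^ i)`, which `exp (10 * i)` beats.
  refine mem_subsetSums_of_cos_small a U (2 ^ i) (4 * 4 ^ i) m (by positivity)
    (fun k hk => (ha k (hU hk)).trans (by omega)) (by omega) (by omega) (by exact_mod_cast hm) ?_
  intro h hh hmin
  set θ := ((h : ℝ) - (4 * 4 ^ i : ℕ)) / ((2 * (4 * 4 ^ i) + 1 : ℕ) : ℝ) with hθ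
  refine (abs_prod_cos_le a U θ κ hκ.le).trans_lt ?_
  -- At most half of the guaranteed `τ * n` terms of `U` are nearly integral at `θ`, whatever `U`
  -- is.
  have h1 : τ * n / 2 ≤
      ((U.filter fun k => κ ≤ |(a k : ℝ) * θ - round ((a k : ℝ) * θ)|).card : ℝ) := by
    have h2 := Finset.card_filter_add_card_filter_not (s := U)
      (fun k => κ ≤ |(a k : ℝ) * θ - round ((a k : ℝ) * θ)|)
    have h3 : (U.filter fun k => ¬ κ ≤ |(a k : ℝ) * θ - round ((a k : ℝ) * θ)|).card ≤
        ((dyadicBlock b i).filter fun k => |(a k : ℝ) * θ - round ((a k : ℝ) * θ)| < κ).card := by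
      refine Finset.card_le_card fun k hk => ?_
      rw [Finset.mem_filter, not_le] at hk
      exact Finset.mem_filter.2 ⟨hU hk.1, hk.2⟩
    have h4 := hnear h hh hmin
    have h5 : (((U.filter fun k => κ ≤ |(a k : ℝ) * θ - round ((a k : ℝ) * θ)|).card : ℝ)) +
      ((U.filter fun k => ¬ κ ≤ |(a k : ℝ) * θ - round ((a k : ℝ) * θ)|).card : ℝ) = U.card := by
      exact_mod_cast h2
    have h6 : ((U.filter fun k => ¬ κ ≤ |(a k : ℝ) * θ - round ((a k : ℝ) * θ)|).card : ℝ) ≤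
      ((dyadicBlock b i).filter fun k => |(a k : ℝ) * θ - round ((a k : ℝ) * θ)| < κ).card := by
      exact_mod_cast h3
    linarith
  have h2 : Real.exp (-(2 * κ ^ 2 *
      (U.filter fun k => κ ≤ |(a k : ℝ) * θ - round ((a k : ℝ) * θ)|).card)) ≤
      Real.exp (-(10 * i)) := by
    rw [Real.exp_le_exp]
    have := mul_le_mul_of_nonneg_left h1 (show 0 ≤ 2 * κ ^ 2 by positivity)
    linarith
  refine h2.trans_lt ?_
  rw [Real.exp_neg, inv_eq_one_div]
  apply one_div_lt_one_div_of_lt (by positivity)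
  have h36 : (36 : ℝ) ^ i ≤ Real.exp (10 * i) := by
    rw [mul_comm, Real.exp_nat_mul]
    gcongr
    have h10 : Real.exp 10 = Real.exp 1 ^ 10 := by
      rw [← Real.exp_nat_mul]; norm_num
    rw [h10]
    have h2 : (2 : ℝ) ≤ Real.exp 1 := by
      linarith [Real.add_one_le_exp (1 : ℝ)]
    calc (36 : ℝ) ≤ 2 ^ 10 := by norm_num
      _ ≤ _ := by gcongr
  refine lt_of_lt_of_le ?_ h36
  have h9 : (9 : ℝ) ≤ 9 ^ i := by
    calc (9 : ℝ) = 9 ^ 1 := by norm_num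
      _ ≤ 9 ^ i := by gcongr; norm_num
  have h36' : (36 : ℝ) ^ i = 9 ^ i * 4 ^ i := by rw [← mul_pow]; norm_num
  have h41 : (1 : ℝ) < 4 ^ i := one_lt_pow₀ (by norm_num) (by omega)
  push_cast
  rw [h36']
  nlinarith

/-- A friendly sequence is interlaced by a sequence that is good on almost all blocks. -/
theorem IsFriendly.exists_interlacing {ε : ℝ} {b : ℕ → ℕ} (hb : IsPosSeq b) (h : IsFriendly ε b)
    (τ : ℝ) (hτ : 0 < τ) (hτ1 : τ ≤ 1) :
    ∃ a : ℕ → ℕ, (∀ n, 1 ≤ n → b n ≤ a n ∧ a n < b (n + 1)) ∧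
      ∀ᶠ i : ℕ in atTop, IsGoodOnBlock a b τ i ∧ ∀ k ∈ dyadicBlock b i, a k ≤ 3 * 2 ^ i := by
  classical
  have hm := h.strictMono
  have hlt : ∀ n, 1 ≤ n → b n < b (n + 1) := fun n hn =>
    hm (Set.mem_Ici.2 hn) (Set.mem_Ici.2 (by omega)) (Nat.lt_succ_self n)
  suffices hblock : ∀ᶠ i : ℕ in atTop, ∃ a : ℕ → ℕ,
      (∀ k ∈ dyadicBlock b i, b k ≤ a k ∧ a k < b (k + 1) ∧ a k ≤ 3 * 2 ^ i) ∧
      IsGoodOnBlock a b τ i by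
    obtain ⟨i₀, hi₀⟩ := eventually_atTop.1 hblock
    choose! A hA hgood using hi₀
    -- Gluing of the blockwise choices. Blocks are open on the left and closed on the right, so the
    -- block of `k` is the logarithm of `b k - 1`.
    let a : ℕ → ℕ := fun k => if i₀ ≤ Nat.log 2 (b k - 1) ∧ 2 ≤ b k
      then A (Nat.log 2 (b k - 1)) k else b k
    have hlog : ∀ i, ∀ k ∈ dyadicBlock b i, Nat.log 2 (b k - 1) = i ∧ 2 ≤ b k := by
      intro i k hk
      have hk' := (mem_dyadicBlock hb hm).1 hk
      have := Nat.one_le_two_pow (n := i)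
      refine ⟨(Nat.log_eq_iff (Or.inr ⟨by norm_num, by omega⟩)).2 ⟨by omega, by omega⟩, by omega⟩
    have haA : ∀ i, i₀ ≤ i → ∀ k ∈ dyadicBlock b i, A i k = a k := by
      intro i hi k hk
      obtain ⟨h1, h2⟩ := hlog i k hk
      simp only [a, h1, hi, h2, and_self, if_true]
    refine ⟨a, fun n hn => ?_, eventually_atTop.2 ⟨i₀, fun i hi =>
      ⟨(hgood i hi).congr (haA i hi), fun k hk => ?_⟩⟩⟩
    · by_cases hc : i₀ ≤ Nat.log 2 (b n - 1) ∧ 2 ≤ b n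
      · have hn' : n ∈ dyadicBlock b (Nat.log 2 (b n - 1)) := by
          refine (mem_dyadicBlock hb hm).2 ⟨hn, ?_, ?_⟩
          · have := Nat.pow_log_le_self 2 (show b n - 1 ≠ 0 by omega)
            omega
          · have := Nat.lt_pow_succ_log_self (show 1 < 2 by norm_num) (b n - 1)
            omega
        have := hA _ hc.1 n hn'
        rw [haA _ hc.1 n hn'] at this
        exact ⟨this.1, this.2.1⟩
      · simp only [a, if_neg hc]
        exact ⟨le_rfl, hlt n hn⟩
    · rw [← haA i hi k hk]; exact (hA i hi k hk).2.2
  obtain ⟨c, hc0, hc1, hgap⟩ := h.exists_gap hb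
  set τE := c ^ 2 * τ / 32 with hτE
  have hτE0 : 0 < τE := by positivity
  have hτE1 : τE ≤ 1 := by
    rw [hτE, div_le_one (by norm_num)]
    have : c ^ 2 ≤ 1 := by nlinarith
    nlinarith
  obtain ⟨W, hW, κ, hκ, hE⟩ := exists_modulus_equidistributed τE hτE0 hτE1
  have hWr : (1 : ℝ) ≤ W := by exact_mod_cast hW
  have hE' : ∀ᶠ i : ℕ in atTop, ∀ θ : ℝ, 1 / (8 * ((2 ^ i : ℕ) : ℝ)) ≤ |θ - round θ| →
      ((nearIntSet W (2 ^ i) κ θ).card : ℝ) ≤ τE * (2 ^ i : ℕ) / W :=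
    (tendsto_pow_atTop_atTop_of_one_lt (by norm_num : 1 < 2)).eventually hE
  obtain ⟨k₀, hk₀⟩ := eventually_atTop.1 (h.tendsto_deriv.eventually_ge_atTop (2 * W : ℝ))
  have hbk : ∀ᶠ i : ℕ in atTop, b (k₀ + 1) ≤ 2 ^ i :=
    (tendsto_pow_atTop_atTop_of_one_lt (by norm_num : 1 < 2)).eventually_ge_atTop _
  filter_upwards [hgap, hE', hbk, h.eventually_card_block_ge hb (10 / (κ ^ 2 * τ)),
    h.eventually_card_block_ge hb (40 / τ),
    h.eventually_card_block_ge hb (1 + 1 / c ^ 2), eventually_ge_atTop 1]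
    with i ⟨δ, hδ, hδk, hδ1, hδ2⟩ hEi hki hn1 hn2 hn3 hi
  set n := (dyadicBlock b i).card with hn
  have hir : (1 : ℝ) ≤ i := by exact_mod_cast hi
  have hn1' : 10 * i ≤ κ ^ 2 * τ * n := by
    rw [div_mul_eq_mul_div, div_le_iff₀ (by positivity)] at hn1; linarith
  have hn2' : 40 * i ≤ τ * n := by
    rw [div_mul_eq_mul_div, div_le_iff₀ hτ] at hn2; linarith
  have hn3' : 1 + 1 / c ^ 2 ≤ n := by
    have : 0 ≤ 1 / c ^ 2 := by positivity
    nlinarith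
  have hn1r : (1 : ℝ) ≤ n := by
    have : 0 ≤ 1 / c ^ 2 := by positivity
    linarith
  have hδX : δ / c ≤ 2 ^ i := by
    have h1 := hδ2 i le_rfl
    have h2 : δ / c = (1 / c ^ 2) * (c * δ) := by field_simp
    rw [h2]
    refine le_trans ?_ h1
    apply mul_le_mul_of_nonneg_right _ (by positivity)
    linarith
  let J : ℕ → Finset ℕ := fun k => (Finset.Ico (b k) (b (k + 1))).filter fun x => x % W = 1 % W
  have hend : ∀ k ∈ dyadicBlock b i, b (k + 1) ≤ 3 * 2 ^ i := by
    intro k hk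
    have h1 := (hδk k hk).2
    have h2 := ((mem_dyadicBlock hb hm).1 hk).2.2
    have h2' : (b k : ℝ) ≤ 2 * 2 ^ i := by rw [pow_succ] at h2; exact_mod_cast (by linarith)
    unfold discDeriv at h1
    have : (b (k + 1) : ℝ) ≤ 3 * 2 ^ i := by linarith
    exact_mod_cast this
  let θ : ℕ → ℝ := fun h => ((h : ℝ) - (4 * 4 ^ i : ℕ)) / ((2 * (4 * 4 ^ i) + 1 : ℕ) : ℝ)
  obtain ⟨a, haJ, hanear⟩ := exists_choice_card_lt
    ((Finset.range (2 * (4 * 4 ^ i) + 1)).filter fun h : ℕ =>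
      1 / (8 * ((2 ^ i : ℕ) : ℝ)) ≤ |θ h|) (fun h => nearIntSet W (2 ^ i) κ (θ h)) J
    (dyadicBlock b i) (by
      intro k hk l hl hkl
      rw [Function.onFun, Finset.disjoint_left]
      intro x hxk hxl
      simp only [J, Finset.mem_filter, Finset.mem_Ico] at hxk hxl
      have hk1 := ((mem_dyadicBlock hb hm).1 hk).1
      have hl1 := ((mem_dyadicBlock hb hm).1 hl).1
      rcases lt_or_gt_of_ne hkl with hlt | hlt
      · have := hm.monotoneOn (Set.mem_Ici.2 (by omega : 1 ≤ k + 1)) (Set.mem_Ici.2 hl1)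
          (by omega : k + 1 ≤ l)
        omega
      · have := hm.monotoneOn (Set.mem_Ici.2 (by omega : 1 ≤ l + 1)) (Set.mem_Ici.2 hk1)
          (by omega : l + 1 ≤ k)
        omega)
    -- A gap has at least `c * δ / (2 * W)` candidates, the loss of `1` in the count being absorbed
    -- because gaps are eventually at least `2 * W`. With `τE = c ^ 2 * τ / 32` and `2 ^ i ≤ (n + 1)
    -- * (δ / c)`, the exponent `2 * B / D` is at most `τ * n / 4`; the other quarter pays for the
    -- `9 * 4 ^ i` frequencies.
    (c * δ / (2 * W)) (τE * 2 ^ i / W) (τ * n / 2) (by positivity) (by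
      intro k hk
      have h1 := card_Ico_filter_mod_ge (b k) (b (k + 1)) W hW
      refine le_trans ?_ h1
      have h2 := (hδk k hk).1
      have hkk : k₀ ≤ k := by
        by_contra! hcon
        have h3 := ((mem_dyadicBlock hb hm).1 hk)
        have := hm.monotoneOn (Set.mem_Ici.2 h3.1) (Set.mem_Ici.2 (by omega : 1 ≤ k₀ + 1))
          (by omega : k ≤ k₀ + 1)
        omega
      have h3 := hk₀ k hkk
      unfold discDeriv at h2 h3
      rw [div_sub_one (by positivity), div_le_div_iff₀ (by positivity) (by positivity)]
      nlinarith) (by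
      intro h hh
      obtain ⟨hh1, hh2⟩ := Finset.mem_filter.1 hh
      have h1 := hEi (θ h) (hh2.trans (abs_le_abs_sub_round _ ?_))
      · push_cast at h1; exact h1
      · simp only [θ]
        rw [abs_div, Nat.abs_cast, div_le_div_iff₀ (by positivity) (by norm_num)]
        have h3 : (h : ℝ) ≤ 2 * (4 * 4 ^ i) := by
          have := Finset.mem_range.1 hh1
          exact_mod_cast (by omega : h ≤ 2 * (4 * 4 ^ i))
        have h4 : |(h : ℝ) - (4 * 4 ^ i : ℕ)| ≤ 4 * 4 ^ i := by
          push_cast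
          rw [abs_le]
          constructor <;> linarith [Nat.cast_nonneg (α := ℝ) h]
        push_cast at h4 ⊢
        linarith) (by
      have h1 : 2 * (τE * 2 ^ i / W) / (c * δ / (2 * W)) ≤ τ * n / 4 := by
        have h2 : 2 * (τE * 2 ^ i / W) / (c * δ / (2 * W)) = τ * c / (8 * δ) * 2 ^ i := by
          rw [hτE]; field_simp; ring
        rw [h2]
        calc τ * c / (8 * δ) * 2 ^ i ≤ τ * c / (8 * δ) * ((n + 1) * (δ / c)) := by gcongr
          _ = τ * (n + 1) / 8 := by field_simp
          _ ≤ τ * n / 4 := by nlinarith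
      have h3 : (((Finset.range (2 * (4 * 4 ^ i) + 1)).filter fun h : ℕ =>
          1 / (8 * ((2 ^ i : ℕ) : ℝ)) ≤ |θ h|).card : ℝ) ≤ 9 * 4 ^ i := by
        have h4 := Finset.card_filter_le (Finset.range (2 * (4 * 4 ^ i) + 1))
          fun h : ℕ => 1 / (8 * ((2 ^ i : ℕ) : ℝ)) ≤ |θ h|
        rw [Finset.card_range] at h4
        have h5 : 1 ≤ 4 ^ i := Nat.one_le_pow _ _ (by norm_num)
        exact_mod_cast h4.trans (by omega)
      have h6 : (9 : ℝ) * 4 ^ i < Real.exp (τ * n / 4) := by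
        have h7 : Real.exp (i * 10) ≤ Real.exp (τ * n / 4) := by
          rw [Real.exp_le_exp]; linarith
        refine lt_of_lt_of_le ?_ h7
        rw [Real.exp_nat_mul]
        have h10 : Real.exp 10 = Real.exp 1 ^ 10 := by
          rw [← Real.exp_nat_mul]; norm_num
        have h2 : (2 : ℝ) ≤ Real.exp 1 := by linarith [Real.add_one_le_exp (1 : ℝ)]
        have h11 : (40 : ℝ) ≤ Real.exp 10 := by
          rw [h10]
          calc (40 : ℝ) ≤ 2 ^ 10 := by norm_num
            _ ≤ _ := by gcongr
        have h12 : (10 : ℝ) ≤ 10 ^ i := by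
          calc (10 : ℝ) = 10 ^ 1 := by norm_num
            _ ≤ 10 ^ i := by gcongr; norm_num
        calc (9 : ℝ) * 4 ^ i < 10 ^ i * 4 ^ i := by
              apply mul_lt_mul_of_pos_right _ (by positivity); linarith
          _ = 40 ^ i := by rw [← mul_pow]; norm_num
          _ ≤ _ := by gcongr
      calc _ ≤ 9 * 4 ^ i * Real.exp (τ * n / 4) := by gcongr
        _ < Real.exp (τ * n / 4) * Real.exp (τ * n / 4) := by gcongr
        _ = Real.exp (τ * n / 2) := by rw [← Real.exp_add]; ring_nf)
  have haJ' : ∀ k ∈ dyadicBlock b i, b k ≤ a k ∧ a k < b (k + 1) ∧ a k % W = 1 % W := by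
    intro k hk
    have := haJ k hk
    simp only [J, Finset.mem_filter, Finset.mem_Ico] at this
    exact ⟨this.1.1, this.1.2, this.2⟩
  have ha3 : ∀ k ∈ dyadicBlock b i, a k ≤ 3 * 2 ^ i := fun k hk =>
    (haJ' k hk).2.1.le.trans (hend k hk)
  refine ⟨a, fun k hk => ⟨(haJ' k hk).1, (haJ' k hk).2.1, ha3 k hk⟩,
    isGoodOnBlock_of_equidistributed hi hκ ha3 hn1' fun h hh hmin => ?_⟩
  have h1 := hanear h (Finset.mem_filter.2 ⟨hh, hmin⟩)
  refine le_trans ?_ h1.le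
  refine Nat.cast_le.2 (Finset.card_le_card fun k hk => ?_)
  obtain ⟨hk1, hk2⟩ := Finset.mem_filter.1 hk
  have hk3 := haJ' k hk1
  have hk4 := (mem_dyadicBlock hb hm).1 hk1
  exact Finset.mem_filter.2 ⟨hk1, mem_nearIntSet.2 ⟨⟨by omega, ha3 k hk1⟩, hk3.2.2, hk2⟩⟩

/-! ### From one good block to completeness. -/

open Classical in
/-- The elements of `S` in `{1, …, t}`. -/
noncomputable def initialPart (S : Set ℕ) (t : ℕ) : Finset ℕ :=
  (Finset.Icc 1 t).filter (· ∈ S)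

theorem mem_initialPart {S : Set ℕ} {t k : ℕ} :
    k ∈ initialPart S t ↔ (1 ≤ k ∧ k ≤ t) ∧ k ∈ S := by
  simp [initialPart]

theorem initialPart_mono (S : Set ℕ) {t u : ℕ} (h : t ≤ u) :
    initialPart S t ⊆ initialPart S u := by
  intro k hk
  rw [mem_initialPart] at hk ⊢
  exact ⟨⟨hk.1.1, hk.1.2.trans h⟩, hk.2⟩

theorem initialPart_succ_of_mem {S : Set ℕ} {t : ℕ} (h : t + 1 ∈ S) :
    initialPart S (t + 1) = insert (t + 1) (initialPart S t) := by
  ext k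
  simp only [Finset.mem_insert, mem_initialPart]
  constructor
  · rintro ⟨h1, h2⟩
    by_cases hk : k = t + 1
    · exact Or.inl hk
    · exact Or.inr ⟨by omega, h2⟩
  · rintro (rfl | h1)
    · exact ⟨by omega, h⟩
    · exact ⟨by omega, h1.2⟩

theorem initialPart_succ_of_notMem {S : Set ℕ} {t : ℕ} (h : t + 1 ∉ S) :
    initialPart S (t + 1) = initialPart S t := by
  ext k
  simp only [mem_initialPart]
  constructor
  · rintro ⟨h1, h2⟩
    have : k ≠ t + 1 := fun hk => h (hk ▸ h2)
    exact ⟨by omega, h2⟩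
  · rintro ⟨h1, h2⟩
    exact ⟨by omega, h2⟩

theorem notMem_initialPart_succ (S : Set ℕ) (t : ℕ) : t + 1 ∉ initialPart S t := by
  rw [mem_initialPart]; omega

/-- Every integer in `[x, y]` is a sum of some of the `a k` with `k ∈ V`. -/
def CoversInterval (a : ℕ → ℕ) (V : Finset ℕ) (x y : ℕ) : Prop :=
  ∀ m, x ≤ m → m ≤ y → ∃ T ⊆ V, ∑ k ∈ T, a k = m

theorem CoversInterval.insert {a : ℕ → ℕ} {V : Finset ℕ} {x y v : ℕ} (h : CoversInterval a V x y)
    (hv : v ∉ V) (hle : x + a v ≤ y + 1) : CoversInterval a (insert v V) x (y + a v) := by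
  intro m hx hy
  rcases le_or_gt m y with hm | hm
  · obtain ⟨T, hT, hs⟩ := h m hx hm
    exact ⟨T, hT.trans (Finset.subset_insert _ _), hs⟩
  · obtain ⟨T, hT, hs⟩ := h (m - a v) (by omega) (by omega)
    refine ⟨Insert.insert v T, Finset.insert_subset_insert _ hT, ?_⟩
    rw [Finset.sum_insert fun h => hv (hT h), hs]
    omega

theorem CoversInterval.union {a : ℕ → ℕ} {V : Finset ℕ} {x y : ℕ} (h : CoversInterval a V x y)
    (W : Finset ℕ) (hW : Disjoint V W) (hle : ∀ v ∈ W, x + a v ≤ y + 1) :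
    CoversInterval a (V ∪ W) x (y + ∑ v ∈ W, a v) := by
  induction W using Finset.induction_on with
  | empty => simpa using h
  | insert w W hw ih =>
    rw [Finset.disjoint_insert_right] at hW
    have h1 := ih hW.2 fun v hv => hle v (Finset.mem_insert_of_mem hv)
    rw [Finset.union_insert, Finset.sum_insert hw, add_comm (a w), ← add_assoc]
    refine h1.insert (by rw [Finset.mem_union]; tauto) ?_
    have := hle w (Finset.mem_insert_self _ _)
    omega

/-- If a finite part of `S` covers an interval that is long enough compared to the terms up to `N`,
and each later term is at most the sum of the unused previous ones, then `S` is complete. -/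
theorem isCompleteOn_of_coversInterval {a : ℕ → ℕ} (ha : IsPosSeq a) {S : Set ℕ}
    (hinf : ∀ C : ℕ, ∃ t, C ≤ (initialPart S t).card) {U : Finset ℕ} {x y N : ℕ} (hxy : x ≤ y)
    (hU : U ⊆ initialPart S N) (hcov : CoversInterval a U x y)
    (hsmall : ∀ s ∈ initialPart S N, x + a s ≤ y + 1)
    (hlarge : ∀ s, N ≤ s → s + 1 ∈ S → a (s + 1) + ∑ k ∈ U, a k ≤ ∑ k ∈ initialPart S s, a k) :
    IsCompleteOn a S := by
  -- The covered interval grows by the sum of all terms outside `U`. A later term is at most that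
  -- sum, hence at most the length of the interval, so no hole appears.
  have key : ∀ t, N ≤ t →
      CoversInterval a (initialPart S t) x (y + ∑ k ∈ initialPart S t \ U, a k) := by
    intro t ht
    induction t, ht using Nat.le_induction with
    | base =>
      have := hcov.union (initialPart S N \ U) Finset.disjoint_sdiff
        fun v hv => hsmall v (Finset.mem_sdiff.1 hv).1
      rwa [Finset.union_sdiff_of_subset hU] at this
    | succ t ht ih =>
      by_cases hS : t + 1 ∈ S
      · have hUt : U ⊆ initialPart S t := hU.trans (initialPart_mono S ht)
        have hnot := notMem_initialPart_succ S t
        have h1 := Finset.sum_sdiff (f := a) hUt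
        have h2 := hlarge t ht hS
        have h3 := ih.insert hnot (by omega)
        rw [initialPart_succ_of_mem hS, Finset.insert_sdiff_of_notMem _ fun h => hnot (hUt h),
          Finset.sum_insert fun h => hnot (Finset.mem_sdiff.1 h).1, add_comm (a (t + 1)),
          ← add_assoc]
        exact h3
      · rw [initialPart_succ_of_notMem hS]; exact ih
  refine eventually_atTop.2 ⟨x, fun m hm => ?_⟩
  obtain ⟨t, ht⟩ := hinf (m + U.card)
  set u := max t N with hu
  have h1 : m + U.card ≤ (initialPart S u).card :=
    ht.trans (Finset.card_le_card (initialPart_mono S (le_max_left _ _)))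
  have h2 : m ≤ ∑ k ∈ initialPart S u \ U, a k := by
    have h3 : (initialPart S u \ U).card • 1 ≤ ∑ k ∈ initialPart S u \ U, a k := by
      refine Finset.card_nsmul_le_sum _ _ _ fun k hk => ?_
      exact ha k (mem_initialPart.1 (Finset.mem_sdiff.1 hk).1).1.1
    have h4 := Finset.le_card_sdiff U (initialPart S u)
    simp only [smul_eq_mul, mul_one] at h3
    omega
  obtain ⟨T, hT, hs⟩ := key u (le_max_right _ _) m hm (by omega)
  exact ⟨T, fun k hk => (mem_initialPart.1 (hT hk)).2, hs⟩

theorem sum_Ioc_card_le {b : ℕ → ℕ} (hm : MonotoneOn b (Set.Ici 1)) (V : Finset ℕ)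
    (hV : ∀ k ∈ V, 1 ≤ k) : ∑ k ∈ Finset.Ioc 0 V.card, b k ≤ ∑ k ∈ V, b k := by
  induction V using Finset.induction_on_max with
  | empty => simp
  | insert v V hmax ih =>
    have hv : v ∉ V := fun h => lt_irrefl _ (hmax v h)
    have h1 := ih fun k hk => hV k (Finset.mem_insert_of_mem hk)
    have hcard : V.card + 1 ≤ v := by
      have hsub : insert v V ⊆ Finset.Icc 1 v := by
        intro k hk
        have := hV k hk
        rw [Finset.mem_Icc]
        rcases Finset.mem_insert.1 hk with rfl | h
        · omega
        · have := hmax k h; omega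
      have := Finset.card_le_card hsub
      rw [Finset.card_insert_of_notMem hv, Nat.card_Icc] at this
      omega
    rw [Finset.card_insert_of_notMem hv, Finset.sum_insert hv,
      Finset.sum_Ioc_succ_top (Nat.zero_le _), add_comm]
    have := hm (Set.mem_Ici.2 (by omega : 1 ≤ V.card + 1)) (Set.mem_Ici.2 (by omega)) hcard
    omega

/-- A set `V` that misses many small indices and contains many large ones has a sum that is
considerably larger than an initial sum of `C` more terms. -/
theorem sum_initial_add_le {b : ℕ → ℕ} (hm : MonotoneOn b (Set.Ici 1)) {V M R : Finset ℕ}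
    {X C : ℕ} {L : ℝ} (hC : 1 ≤ C) (hRV : R ⊆ V) (hVM : Disjoint V M) (hV : ∀ k ∈ V, 1 ≤ k)
    (hM : ∀ k ∈ M, 1 ≤ k) (hRX : ∀ k ∈ R, X ≤ b k) (hMX : ∀ k ∈ M, 2 * b k ≤ X) (hL : 0 ≤ L)
    (hLR : L + C * X ≤ R.card * X / 4) (hLM : L + C * X ≤ M.card * X / 4) (hX : 0 < X) :
    ∑ k ∈ Finset.Ioc 0 (V.card + C), (b k : ℝ) + L ≤ ∑ k ∈ V, (b k : ℝ) := by
  have hXr : (0 : ℝ) < X := by exact_mod_cast hX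
  -- The term at index `V.card + C` is compared with `3 * X / 4`. If it is larger, adjoin `M` to
  -- `V`: the terms of `M` are at most `X / 2`, while the further initial terms are at least `3 * X
  -- / 4`. If it is smaller, remove `R` from `V`: its terms are at least `X`, the initial terms they
  -- replace below `3 * X / 4`. Either way each element gains `X / 4`.
  rcases le_or_gt (3 * X) (4 * b (V.card + C)) with hcase | hcase
  · have hCM : C ≤ M.card := by
      have : (C : ℝ) ≤ M.card := by
        by_contra! hlt
        nlinarith
      exact_mod_cast this
    have h1 := sum_Ioc_card_le hm (V ∪ M) (fun k hk => by
      rcases Finset.mem_union.1 hk with h | h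
      · exact hV k h
      · exact hM k h)
    rw [Finset.card_union_of_disjoint hVM, Finset.sum_union hVM,
      ← Finset.sum_Ioc_consecutive _ (Nat.zero_le (V.card + C)) (by omega)] at h1
    have h2 : (M.card - C) * (3 * X) ≤
        ∑ k ∈ Finset.Ioc (V.card + C) (V.card + M.card), 4 * b k := by
      have := Finset.card_nsmul_le_sum (Finset.Ioc (V.card + C) (V.card + M.card))
        (fun k => 4 * b k) (3 * X) (by
          intro k hk
          rw [Finset.mem_Ioc] at hk
          have := hm (Set.mem_Ici.2 (by omega : 1 ≤ V.card + C)) (Set.mem_Ici.2 (by omega)) hk.1.le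
          omega)
      rw [Nat.card_Ioc, smul_eq_mul] at this
      rwa [show V.card + M.card - (V.card + C) = M.card - C by omega] at this
    have h3 : ∑ k ∈ M, 2 * b k ≤ M.card * X := by
      rw [← smul_eq_mul]
      exact Finset.sum_le_card_nsmul _ _ _ hMX
    rw [← Finset.mul_sum] at h2 h3
    have h1' : (∑ k ∈ Finset.Ioc 0 (V.card + C), (b k : ℝ)) +
        ∑ k ∈ Finset.Ioc (V.card + C) (V.card + M.card), (b k : ℝ) ≤
        ∑ k ∈ V, (b k : ℝ) + ∑ k ∈ M, (b k : ℝ) := by exact_mod_cast h1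
    have h2' : ((M.card : ℝ) - C) * (3 * X) ≤
        4 * ∑ k ∈ Finset.Ioc (V.card + C) (V.card + M.card), (b k : ℝ) := by
      rw [← Nat.cast_sub hCM]; exact_mod_cast h2
    have h3' : 2 * ∑ k ∈ M, (b k : ℝ) ≤ M.card * X := by exact_mod_cast h3
    have : 0 ≤ (C : ℝ) * X := by positivity
    linarith
  · have h1 := sum_Ioc_card_le hm (V \ R) (fun k hk => hV k (Finset.mem_sdiff.1 hk).1)
    have hRc := Finset.card_le_card hRV
    rw [Finset.card_sdiff_of_subset hRV] at h1
    have h2 := Finset.sum_sdiff (f := b) hRV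
    have h3 : R.card * X ≤ ∑ k ∈ R, b k := by
      rw [← smul_eq_mul]
      exact Finset.card_nsmul_le_sum _ _ _ hRX
    have h4 := Finset.sum_Ioc_consecutive b (Nat.zero_le (V.card - R.card))
      (by omega : V.card - R.card ≤ V.card + C)
    have h5 : ∑ k ∈ Finset.Ioc (V.card - R.card) (V.card + C), 4 * b k ≤
        (R.card + C) * (3 * X) := by
      have := Finset.sum_le_card_nsmul (Finset.Ioc (V.card - R.card) (V.card + C))
        (fun k => 4 * b k) (3 * X) (by
          intro k hk
          rw [Finset.mem_Ioc] at hk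
          have := hm (Set.mem_Ici.2 (by omega : 1 ≤ k)) (Set.mem_Ici.2 (by omega)) hk.2
          omega)
      rw [Nat.card_Ioc, smul_eq_mul] at this
      rwa [show V.card + C - (V.card - R.card) = R.card + C by omega] at this
    rw [← Finset.mul_sum] at h5
    have h1' : ∑ k ∈ Finset.Ioc 0 (V.card - R.card), (b k : ℝ) ≤ ∑ k ∈ V \ R, (b k : ℝ) := by
      exact_mod_cast h1
    have h2' : ∑ k ∈ V \ R, (b k : ℝ) + ∑ k ∈ R, (b k : ℝ) = ∑ k ∈ V, (b k : ℝ) := by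
      exact_mod_cast h2
    have h3' : (R.card : ℝ) * X ≤ ∑ k ∈ R, (b k : ℝ) := by exact_mod_cast h3
    have h4' : ∑ k ∈ Finset.Ioc 0 (V.card - R.card), (b k : ℝ) +
        ∑ k ∈ Finset.Ioc (V.card - R.card) (V.card + C), (b k : ℝ) =
        ∑ k ∈ Finset.Ioc 0 (V.card + C), (b k : ℝ) := by exact_mod_cast h4
    have h5' : 4 * ∑ k ∈ Finset.Ioc (V.card - R.card) (V.card + C), (b k : ℝ) ≤
        (R.card + C) * (3 * X) := by exact_mod_cast h5
    have : 0 ≤ (C : ℝ) * X := by positivity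
    linarith

theorem countIn_eq_card_initialPart {a : ℕ → ℕ} {S : Set ℕ} (hS : S ⊆ Set.Ici 1) {x N : ℕ}
    (hN : ∀ i, 1 ≤ i → (a i ≤ x ↔ i ≤ N)) :
    (countIn a S x : ENNReal) = ENNReal.ofReal ((initialPart S N).card : ℝ) := by
  have : {i | i ∈ S ∧ a i ≤ x} = (initialPart S N : Set ℕ) := by
    ext i
    simp only [Set.mem_ofPred_eq, SetLike.mem_coe, mem_initialPart]
    constructor
    · rintro ⟨h1, h2⟩
      exact ⟨⟨hS h1, (hN i (hS h1)).1 h2⟩, h1⟩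
    · rintro ⟨⟨h1, h2⟩, h3⟩
      exact ⟨h3, (hN i h1).2 h2⟩
  rw [countIn, this, Set.encard_coe_eq_coe_finsetCard, ENNReal.ofReal_natCast]
  simp

theorem card_initialPart_Ici (N : ℕ) : (initialPart (Set.Ici 1) N).card = N := by
  have : initialPart (Set.Ici 1) N = Finset.Icc 1 N := by
    ext k
    simp only [mem_initialPart, Set.mem_Ici, Finset.mem_Icc]
    tauto
  rw [this]; simp

theorem eps_mul_countIn_le_iff {a : ℕ → ℕ} {S : Set ℕ} (hS : S ⊆ Set.Ici 1) {x N : ℕ} {ε : ℝ}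
    (hε : 0 ≤ ε) (hN : ∀ i, 1 ≤ i → (a i ≤ x ↔ i ≤ N)) :
    ENNReal.ofReal ε * (countIn a (Set.Ici 1) x : ENNReal) ≤ (countIn a S x : ENNReal) ↔
      ε * N ≤ (initialPart S N).card := by
  rw [countIn_eq_card_initialPart subset_rfl hN, countIn_eq_card_initialPart hS hN,
    card_initialPart_Ici, ← ENNReal.ofReal_mul hε, ENNReal.ofReal_le_ofReal_iff (by positivity)]

/-- The index sets occurring in the definition of `ε`-completeness have lower density at least
`ε`. -/
theorem eventually_density_ge {a : ℕ → ℕ} (hpos : IsPosSeq a) (hm : StrictMonoOn a (Set.Ici 1))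
    {S : Set ℕ} (hS : S ⊆ Set.Ici 1) {ε : ℝ} (hε : 0 ≤ ε)
    (h : ∀ᶠ n in atTop,
      ENNReal.ofReal ε * (countIn a (Set.Ici 1) n : ENNReal) ≤ (countIn a S n : ENNReal)) :
    ∀ᶠ N : ℕ in atTop, ε * N ≤ (initialPart S N).card := by
  obtain ⟨n₀, hn₀⟩ := eventually_atTop.1 h
  filter_upwards [eventually_ge_atTop n₀, eventually_ge_atTop 1] with N hN hN1
  have h1 := hn₀ (a N) (hN.trans (le_self_of_strictMonoOn hpos hm hN1))
  exact (eps_mul_countIn_le_iff hS hε fun i hi => hm.le_iff_le (Set.mem_Ici.2 hi)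
    (Set.mem_Ici.2 hN1)).1 h1

/-- Later gaps are at least a constant times those of block `i`, so a later block of at most eight
times the length cannot hold many more terms. This lets the indices missing from a poor block be
measured against a rich block nearby. -/
theorem IsFriendly.exists_card_block_le {ε : ℝ} {b : ℕ → ℕ} (hb : IsPosSeq b)
    (h : IsFriendly ε b) :
    ∃ K : ℝ, 1 ≤ K ∧ ∀ᶠ i : ℕ in atTop, ∀ j, i ≤ j → j ≤ i + 3 →
      ((dyadicBlock b j).card : ℝ) ≤ K * (dyadicBlock b i).card := by
  obtain ⟨c, hc0, hc1, hgap⟩ := h.exists_gap hb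
  have hc2 : c ^ 2 ≤ 1 := by nlinarith
  refine ⟨17 / c ^ 2, ?_, ?_⟩
  · rw [le_div_iff₀ (by positivity)]; linarith
  filter_upwards [hgap, h.eventually_card_block_ge hb 1, eventually_ge_atTop 1]
    with i ⟨δ, hδ, _, h1, h2⟩ hn hi j hij hj3
  have hir : (1 : ℝ) ≤ i := by exact_mod_cast hi
  have hpow : (2 : ℝ) ^ j ≤ 8 * 2 ^ i := by
    calc (2 : ℝ) ^ j ≤ 2 ^ (i + 3) := by gcongr; norm_num
      _ = 8 * 2 ^ i := by rw [pow_add]; ring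
  have h3 := h2 j hij
  set n : ℝ := ((dyadicBlock b i).card : ℝ)
  set n' : ℝ := ((dyadicBlock b j).card : ℝ)
  have hn1 : 1 ≤ n := by linarith
  have h4 : (n' - 1) * (c * δ) ≤ 8 * (n + 1) / c ^ 2 * (c * δ) := by
    calc (n' - 1) * (c * δ) ≤ 8 * ((n + 1) * (δ / c)) := by linarith
      _ = 8 * (n + 1) / c ^ 2 * (c * δ) := by field_simp
  have h5 : n' - 1 ≤ 8 * (n + 1) / c ^ 2 := le_of_mul_le_mul_right h4 (by positivity)
  have h6 : 8 * (n + 1) / c ^ 2 + 1 ≤ 17 / c ^ 2 * n := by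
    have e : 17 / c ^ 2 * n - (8 * (n + 1) / c ^ 2 + 1) = (17 * n - 8 * (n + 1) - c ^ 2) / c ^ 2 := by
      field_simp; ring
    have : 0 ≤ (17 * n - 8 * (n + 1) - c ^ 2) / c ^ 2 := by
      apply div_nonneg _ (by positivity); linarith
    linarith
  linarith

/-- The indices in the `i`-th block that belong to `S`. -/
noncomputable def blockPart (b : ℕ → ℕ) (S : Set ℕ) (i : ℕ) : Finset ℕ :=
  dyadicBlock b i ∩ initialPart S (idx b (2 ^ (i + 1)))

theorem mem_blockPart {b : ℕ → ℕ} {S : Set ℕ} {i k : ℕ} :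
    k ∈ blockPart b S i ↔ k ∈ dyadicBlock b i ∧ k ∈ S := by
  rw [blockPart, Finset.mem_inter, mem_initialPart, dyadicBlock, Finset.mem_Ioc]
  constructor
  · tauto
  · rintro ⟨h1, h2⟩
    exact ⟨h1, ⟨by omega, by omega⟩, h2⟩

theorem blockPart_subset_initialPart {b : ℕ → ℕ} {S : Set ℕ} {i t : ℕ}
    (h : idx b (2 ^ (i + 1)) ≤ t) : blockPart b S i ⊆ initialPart S t :=
  Finset.inter_subset_right.trans (initialPart_mono S h)

theorem tendsto_idx_two_pow {b : ℕ → ℕ} (hb : IsPosSeq b) (hm : StrictMonoOn b (Set.Ici 1)) :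
    Tendsto (fun i : ℕ => idx b (2 ^ i)) atTop atTop := by
  refine tendsto_atTop.2 fun k => ?_
  filter_upwards [(tendsto_pow_atTop_atTop_of_one_lt
    (by norm_num : 1 < 2)).eventually_ge_atTop (b (k + 1))] with i hi
  have := (le_idx_iff hb hm (by omega : 1 ≤ k + 1)).2 hi
  omega

/-- A set of lower density at least `ε` contains a proportion `η < ε` of infinitely many blocks. -/
theorem frequently_blockPart_ge {b : ℕ → ℕ} (hb : IsPosSeq b) (hm : StrictMonoOn b (Set.Ici 1))
    {S : Set ℕ} {ε η : ℝ} (hη : η < ε)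
    (hS : ∀ᶠ N : ℕ in atTop, ε * N ≤ (initialPart S N).card) :
    ∃ᶠ i : ℕ in atTop, η * (dyadicBlock b i).card ≤ (blockPart b S i).card := by
  intro hcon
  obtain ⟨i₁, hi₁⟩ := eventually_atTop.1 hcon
  simp only [not_le] at hi₁
  -- If all blocks from `i₁` on are poor, the counting function of `S` grows with slope at most `η <
  -- ε` along block ends.
  have key : ∀ i, i₁ ≤ i → ((initialPart S (idx b (2 ^ i))).card : ℝ) ≤
      idx b (2 ^ i₁) + η * (idx b (2 ^ i) - idx b (2 ^ i₁)) := by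
    intro i hi
    induction i, hi using Nat.le_induction with
    | base =>
      have : (initialPart S (idx b (2 ^ i₁))).card ≤ idx b (2 ^ i₁) := by
        refine (Finset.card_le_card (t := Finset.Icc 1 (idx b (2 ^ i₁))) fun k hk => ?_).trans ?_
        · exact Finset.mem_Icc.2 (mem_initialPart.1 hk).1
        · simp
      have : ((initialPart S (idx b (2 ^ i₁))).card : ℝ) ≤ idx b (2 ^ i₁) := by exact_mod_cast this
      linarith
    | succ i hi ih =>
      have h1 : initialPart S (idx b (2 ^ (i + 1))) ⊆
          initialPart S (idx b (2 ^ i)) ∪ blockPart b S i := by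
        intro k hk
        rw [mem_initialPart] at hk
        rw [Finset.mem_union, mem_initialPart, mem_blockPart, dyadicBlock, Finset.mem_Ioc]
        rcases le_or_gt k (idx b (2 ^ i)) with h | h
        · exact Or.inl ⟨⟨hk.1.1, h⟩, hk.2⟩
        · exact Or.inr ⟨⟨h, hk.1.2⟩, hk.2⟩
      have h2 := (Finset.card_le_card h1).trans (Finset.card_union_le _ _)
      have h2' : ((initialPart S (idx b (2 ^ (i + 1)))).card : ℝ) ≤
        (initialPart S (idx b (2 ^ i))).card + (blockPart b S i).card := by exact_mod_cast h2
      have h3 := hi₁ i hi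
      rw [card_dyadicBlock, Nat.cast_sub (idx_mono b (Nat.pow_le_pow_right (by norm_num)
        (Nat.le_succ i)))] at h3
      linarith
  have hN := (tendsto_idx_two_pow hb hm).eventually hS
  have hbig : ∀ᶠ i : ℕ in atTop,
      (idx b (2 ^ i₁) - η * idx b (2 ^ i₁)) / (ε - η) < (idx b (2 ^ i) : ℝ) :=
    (tendsto_natCast_atTop_atTop.comp (tendsto_idx_two_pow hb hm)).eventually_gt_atTop _
  obtain ⟨i, hi1, hi2, hi3⟩ := (hN.and (hbig.and (eventually_ge_atTop i₁))).exists
  have h1 := key i hi3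
  rw [div_lt_iff₀ (by linarith)] at hi2
  linarith

/-- A block of which `S` contains a proportion gives completeness, provided that the later terms are
at most the sum of the previous ones. -/
theorem isCompleteOn_of_block {a b : ℕ → ℕ} (hb : IsPosSeq b) (hm : StrictMonoOn b (Set.Ici 1))
    (hab : ∀ n, 1 ≤ n → b n ≤ a n ∧ a n < b (n + 1)) {S : Set ℕ}
    (hinf : ∀ C : ℕ, ∃ t, C ≤ (initialPart S t).card) {τ : ℝ} {i : ℕ}
    (hgood : IsGoodOnBlock a b τ i) (ha3 : ∀ k ∈ dyadicBlock b i, a k ≤ 3 * 2 ^ i)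
    (hτn : 4 ≤ τ * (dyadicBlock b i).card)
    (hrich : τ * (dyadicBlock b i).card + 1 ≤ (blockPart b S i).card)
    (hlarge : ∀ s, idx b (2 ^ (i + 1)) ≤ s → s + 1 ∈ S →
      (a (s + 1) : ℝ) + (τ * (dyadicBlock b i).card + 1) * (3 * 2 ^ i) ≤
        ∑ k ∈ initialPart S s, (a k : ℝ)) :
    IsCompleteOn a S := by
  set n := (dyadicBlock b i).card with hn
  have hapos : IsPosSeq a := fun k hk => (hb k hk).trans_le (hab k hk).1
  have hamono : ∀ k l, 1 ≤ k → k ≤ l → a k ≤ a l := by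
    intro k l hk hkl
    rcases hkl.eq_or_lt with rfl | h
    · exact le_rfl
    · have h1 := (hab k hk).2
      have h2 := (hab l (by omega)).1
      have h3 := hm.monotoneOn (Set.mem_Ici.2 (by omega : 1 ≤ k + 1))
        (Set.mem_Ici.2 (by omega : 1 ≤ l)) h
      omega
  obtain ⟨U, hUR, hUc⟩ := Finset.exists_subset_card_eq (s := blockPart b S i) (n := ⌈τ * n⌉₊) (by
    have h1 := Nat.ceil_lt_add_one (show 0 ≤ τ * n by linarith)
    have : (⌈τ * n⌉₊ : ℝ) ≤ (blockPart b S i).card := by linarith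
    exact_mod_cast this)
  have hUblock : U ⊆ dyadicBlock b i := fun k hk => (mem_blockPart.1 (hUR hk)).1
  have hUc1 : τ * n ≤ U.card := by rw [hUc]; exact Nat.le_ceil _
  have hUc2 : (U.card : ℝ) ≤ τ * n + 1 := by
    rw [hUc]; exact (Nat.ceil_lt_add_one (by linarith)).le
  have hU4 : 4 ≤ U.card := by
    have : (4 : ℝ) ≤ U.card := by linarith
    exact_mod_cast this
  set σ := ∑ k ∈ U, a k with hσ
  have hσlow : 4 * 2 ^ i ≤ σ := by
    have h1 : U.card • 2 ^ i ≤ σ := Finset.card_nsmul_le_sum _ _ _ fun k hk => by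
      have h2 := (mem_dyadicBlock hb hm).1 (hUblock hk)
      have h3 := (hab k h2.1).1
      omega
    rw [smul_eq_mul] at h1
    exact (Nat.mul_le_mul_right _ hU4).trans h1
  have hσup : (σ : ℝ) ≤ (τ * n + 1) * (3 * 2 ^ i) := by
    have h1 : σ ≤ U.card • (3 * 2 ^ i) := Finset.sum_le_card_nsmul _ _ _ fun k hk =>
      ha3 k (hUblock hk)
    rw [smul_eq_mul] at h1
    have h2 : (σ : ℝ) ≤ U.card * (3 * 2 ^ i) := by exact_mod_cast h1
    exact h2.trans (by gcongr)
  have hpow : 1 ≤ 2 ^ i := Nat.one_le_two_pow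
  -- The interval has length about `4 * 2 ^ i`, enough to absorb any term up to the end of the
  -- block, which is at most `3 * 2 ^ i`. The bound `4 * 2 ^ i ≤ σ` ensures that the subtraction in
  -- the left endpoint does not truncate.
  have hcov : CoversInterval a U ((σ + 1) / 2 - 2 * 2 ^ i) ((σ + 4 * 2 ^ i) / 2) := by
    intro m hx hy
    refine hgood U hUblock hUc1 m ?_
    have h1 : σ ≤ 2 * m + 4 * 2 ^ i := by omega
    have h2 : 2 * m ≤ σ + 4 * 2 ^ i := by omega
    have h1' : (σ : ℝ) ≤ 2 * m + 4 * 2 ^ i := by exact_mod_cast h1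
    have h2' : (2 : ℝ) * m ≤ σ + 4 * 2 ^ i := by exact_mod_cast h2
    rw [hσ] at h1' h2'
    push_cast at h1' h2'
    rw [abs_le]
    constructor <;> linarith
  refine isCompleteOn_of_coversInterval hapos hinf (N := idx b (2 ^ (i + 1))) (by omega)
    (hUR.trans (blockPart_subset_initialPart le_rfl)) hcov ?_ ?_
  · intro s hs
    have hs' := (mem_initialPart.1 hs).1
    have h1 : idx b (2 ^ (i + 1)) ∈ dyadicBlock b i := by
      have : 0 < n := by
        by_contra! h0
        have : n = 0 := by omega
        rw [this] at hτn; norm_num at hτn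
      rw [hn, card_dyadicBlock] at this
      rw [dyadicBlock, Finset.mem_Ioc]; omega
    have h2 := ha3 _ h1
    have h3 := hamono s _ hs'.1 hs'.2
    omega
  · intro s hs hsS
    have h1 := hlarge s hs hsS
    have h2 : (a (s + 1) : ℝ) + σ ≤ ∑ k ∈ initialPart S s, (a k : ℝ) := by linarith
    exact_mod_cast h2

theorem sumUpTo_eq_sum_Ioc (b : ℕ → ℕ) (x : ℝ) : sumUpTo b x = ∑ k ∈ Finset.Ioc 0 ⌊x⌋₊, b k := by
  rw [sumUpTo]
  rfl

theorem le_sum_initialPart {a b : ℕ → ℕ} (hab : ∀ n, 1 ≤ n → b n ≤ a n ∧ a n < b (n + 1))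
    (S : Set ℕ) (s : ℕ) :
    ∑ k ∈ initialPart S s, (b k : ℝ) ≤ ∑ k ∈ initialPart S s, (a k : ℝ) :=
  Finset.sum_le_sum fun k hk => by exact_mod_cast (hab k (mem_initialPart.1 hk).1.1).1

/-- If almost all blocks contain a proportion of `S`, then `S` is complete. -/
theorem isCompleteOn_of_all_blocks_rich {ε : ℝ} {a b : ℕ → ℕ} (hb : IsPosSeq b)
    (h : IsFriendly ε b) (hab : ∀ n, 1 ≤ n → b n ≤ a n ∧ a n < b (n + 1)) {S : Set ℕ}
    (hinf : ∀ C : ℕ, ∃ t, C ≤ (initialPart S t).card) {τ η : ℝ} (hτ : 0 < τ) (hτη : 100 * τ ≤ η)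
    (hgood : ∀ᶠ i : ℕ in atTop, IsGoodOnBlock a b τ i ∧ ∀ k ∈ dyadicBlock b i, a k ≤ 3 * 2 ^ i)
    (hrich : ∀ᶠ i : ℕ in atTop, η * (dyadicBlock b i).card ≤ (blockPart b S i).card) :
    IsCompleteOn a S := by
  have hm := h.strictMono
  obtain ⟨i, hi⟩ := eventually_atTop.1 (hgood.and (hrich.and ((h.eventually_card_block_ge hb
    (4 / τ)).and (eventually_ge_atTop 1))))
  have hcard : ∀ j, i ≤ j → 4 ≤ τ * (dyadicBlock b j).card := by
    intro j hj
    obtain ⟨-, -, h1, h2⟩ := hi j hj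
    have : (1 : ℝ) ≤ j := by exact_mod_cast h2
    rw [div_mul_eq_mul_div, div_le_iff₀ hτ] at h1
    linarith
  have hτn := hcard i le_rfl
  have hmul : ∀ j, 100 * (τ * (dyadicBlock b j).card) ≤ η * (dyadicBlock b j).card := by
    intro j
    rw [← mul_assoc]; gcongr
  refine isCompleteOn_of_block hb hm hab hinf (hi i le_rfl).1.1 (hi i le_rfl).1.2
    hτn (by linarith [(hi i le_rfl).2.1, hmul i]) ?_
  intro s hs hsS
  refine le_trans ?_ (le_sum_initialPart hab S s)
  obtain ⟨j, hj⟩ : ∃ j, j = Nat.log 2 (b (s + 1) - 1) := ⟨_, rfl⟩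
  have hb1 : 2 ^ (i + 1) < b (s + 1) := (idx_lt_iff hb hm (by omega)).1 (by omega)
  have hpi : 1 ≤ 2 ^ (i + 1) := Nat.one_le_two_pow
  have hij : i + 1 ≤ j := hj ▸ (Nat.le_log_iff_pow_le (by norm_num) (by omega)).2 (by omega)
  have hbj : 2 ^ j < b (s + 1) := by
    have := Nat.pow_log_le_self 2 (show b (s + 1) - 1 ≠ 0 by omega)
    rw [← hj] at this
    omega
  have hbj' : b (s + 1) ≤ 2 ^ (j + 1) := by
    have := Nat.lt_pow_succ_log_self (show 1 < 2 by norm_num) (b (s + 1) - 1)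
    rw [← hj] at this
    omega
  have hsj : s + 1 ∈ dyadicBlock b j := (mem_dyadicBlock hb hm).2 ⟨by omega, hbj, hbj'⟩
  have has : (a (s + 1) : ℝ) ≤ 3 * 2 ^ j := by
    exact_mod_cast (hi j (by omega)).1.2 _ hsj
  have hidx : idx b (2 ^ j) ≤ s := by
    have := (Finset.mem_Ioc.1 hsj).1; omega
  -- the contribution of a single block
  have hblock : ∀ l, i ≤ l → η * (dyadicBlock b l).card * 2 ^ l ≤
      ∑ k ∈ blockPart b S l, (b k : ℝ) := by
    intro l hl
    have h1 : (blockPart b S l).card • (2 ^ l : ℝ) ≤ ∑ k ∈ blockPart b S l, (b k : ℝ) :=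
      Finset.card_nsmul_le_sum _ _ _ fun k hk => by
        have := ((mem_dyadicBlock hb hm).1 (mem_blockPart.1 hk).1).2.1.le
        exact_mod_cast this
    rw [nsmul_eq_mul] at h1
    refine le_trans ?_ h1
    have := (hi l hl).2.1
    gcongr
  have hsub : ∀ l, l + 1 ≤ j → blockPart b S l ⊆ initialPart S s := fun l hl =>
    blockPart_subset_initialPart ((idx_mono b (Nat.pow_le_pow_right (by norm_num) hl)).trans hidx)
  obtain ⟨l, rfl⟩ : ∃ l, j = l + 1 := ⟨j - 1, by omega⟩
  have hl := hblock l (by omega)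
  have hi' := hblock i le_rfl
  have hnl := hcard l (by omega)
  have hml := hmul l
  have hmi := hmul i
  have p1 : (0 : ℝ) < 2 ^ i := by positivity
  have p2 : (0 : ℝ) < 2 ^ l := by positivity
  -- Block `i` pays for the reserved set `U`, block `l` just before that of `s + 1` for the new
  -- term. Each uses only half of its sum, because the two blocks coincide when `l = i`.
  have hneed : (a (s + 1) : ℝ) + (τ * (dyadicBlock b i).card + 1) * (3 * 2 ^ i) ≤
      η * (dyadicBlock b i).card * 2 ^ i / 2 + η * (dyadicBlock b l).card * 2 ^ l / 2 := by
    rw [pow_succ] at has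
    have e1 : (6 : ℝ) * 2 ^ l ≤ η * (dyadicBlock b l).card * 2 ^ l / 2 := by nlinarith
    have e2 : (τ * (dyadicBlock b i).card + 1) * (3 * 2 ^ i) ≤
      η * (dyadicBlock b i).card * 2 ^ i / 2 := by nlinarith
    linarith
  refine hneed.trans ?_
  rcases (show i ≤ l by omega).eq_or_lt with hil | hil
  · subst hil
    refine le_trans ?_ (Finset.sum_le_sum_of_subset_of_nonneg (hsub i (by omega))
      fun k _ _ => Nat.cast_nonneg _)
    linarith
  · have hdisj : Disjoint (blockPart b S i) (blockPart b S l) := by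
      rw [Finset.disjoint_left]
      intro k hk hk'
      have h1 := ((mem_dyadicBlock hb hm).1 (mem_blockPart.1 hk).1).2.2
      have h2 := ((mem_dyadicBlock hb hm).1 (mem_blockPart.1 hk').1).2.1
      have := Nat.pow_le_pow_right (show 0 < 2 by norm_num) (show i + 1 ≤ l from hil)
      omega
    have h1 := Finset.sum_le_sum_of_subset_of_nonneg (f := fun k => (b k : ℝ))
      (Finset.union_subset (hsub i (by omega)) (hsub l (by omega))) fun k _ _ => Nat.cast_nonneg _
    rw [Finset.sum_union hdisj] at h1
    have h2 : 0 ≤ η * (dyadicBlock b i).card * 2 ^ i := by nlinarith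
    have h3 : 0 ≤ η * (dyadicBlock b l).card * 2 ^ l := by nlinarith
    linarith

/-- If `S` contains a proportion of a block and misses many indices in lower blocks, then `S` is
complete. -/
theorem isCompleteOn_of_missing {a b : ℕ → ℕ} {ε : ℝ} (hε : 0 < ε) (hε1 : ε < 1)
    (hb : IsPosSeq b) (hm : StrictMonoOn b (Set.Ici 1))
    (hab : ∀ n, 1 ≤ n → b n ≤ a n ∧ a n < b (n + 1)) {S : Set ℕ}
    (hinf : ∀ C : ℕ, ∃ t, C ≤ (initialPart S t).card) {C : ℕ} (hC : 3 ≤ C)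
    (hgrow : ∀ n, 1 ≤ n → b n ≤ sumUpTo b (ε * n + (C - 2 : ℝ)))
    {τ η : ℝ} {i : ℕ} (hτ : 0 < τ) (hτη : 100 * τ ≤ η)
    (hgood : IsGoodOnBlock a b τ i) (ha3 : ∀ k ∈ dyadicBlock b i, a k ≤ 3 * 2 ^ i)
    (hτn : 4 + C ≤ τ * (dyadicBlock b i).card)
    (hrich : η * (dyadicBlock b i).card ≤ (blockPart b S i).card)
    (hdens : ∀ N, idx b (2 ^ (i + 1)) ≤ N → ε * N ≤ (initialPart S N).card)
    {M : Finset ℕ} (hM1 : ∀ k ∈ M, 1 ≤ k) (hMS : ∀ k ∈ M, k ∉ S) (hM : ∀ k ∈ M, 2 * b k ≤ 2 ^ i)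
    (hMcard : 100 * (τ * (dyadicBlock b i).card) ≤ M.card) :
    IsCompleteOn a S := by
  set n := (dyadicBlock b i).card with hn
  have hτηn : 100 * (τ * n) ≤ η * n := by rw [← mul_assoc]; gcongr
  have hC' : (3 : ℝ) ≤ C := by exact_mod_cast hC
  refine isCompleteOn_of_block hb hm hab hinf hgood ha3 (by linarith) (by linarith) ?_
  intro s hs hsS
  refine le_trans ?_ (le_sum_initialPart hab S s)
  have hp : (0 : ℝ) < 2 ^ i := by positivity
  have hkey : ∀ x : ℝ, 100 * (τ * n) ≤ x →
      (τ * n + 1) * (3 * 2 ^ i) + C * ((2 ^ i : ℕ) : ℝ) ≤ x * ((2 ^ i : ℕ) : ℝ) / 4 := by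
    intro x hx
    push_cast
    have : (τ * n + 1) * 3 + C ≤ x / 4 := by linarith
    have := mul_le_mul_of_nonneg_right this hp.le
    linarith
  have hgap := sum_initial_add_le hm.monotoneOn (V := initialPart S s) (M := M)
    (R := blockPart b S i) (X := 2 ^ i) (C := C) (L := (τ * n + 1) * (3 * 2 ^ i)) (by omega)
    (blockPart_subset_initialPart hs)
    (Finset.disjoint_left.2 fun k hk hkM => hMS k hkM (mem_initialPart.1 hk).2)
    (fun k hk => (mem_initialPart.1 hk).1.1) hM1
    (fun k hk => ((mem_dyadicBlock hb hm).1 (mem_blockPart.1 hk).1).2.1.le) hM (by positivity)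
    (hkey _ (by linarith)) (hkey _ hMcard) (by positivity)
  refine le_trans ?_ hgap
  gcongr
  have h1 : a (s + 1) ≤ b (s + 2) := (hab (s + 1) (by omega)).2.le
  have h2 := hgrow (s + 2) (by omega)
  rw [sumUpTo_eq_sum_Ioc] at h2
  -- The `- 2` in `C - 2` pays for passing from index `s` to `s + 2`, as `a (s + 1) < b (s + 2)` and
  -- `ε < 1`.
  have h3 : ⌊ε * ((s + 2 : ℕ) : ℝ) + (C - 2 : ℝ)⌋₊ ≤ (initialPart S s).card + C := by
    apply Nat.floor_le_of_le
    have := hdens s hs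
    push_cast
    linarith
  have h4 : ∑ k ∈ Finset.Ioc 0 ⌊ε * ((s + 2 : ℕ) : ℝ) + (C - 2 : ℝ)⌋₊, b k ≤
      ∑ k ∈ Finset.Ioc 0 ((initialPart S s).card + C), b k :=
    Finset.sum_le_sum_of_subset (Finset.Ioc_subset_Ioc_right h3)
  exact_mod_cast h1.trans (h2.trans h4)

/-- Every friendly sequence is interlaced by an `ε`-complete one. -/
theorem IsFriendly.exists_isEpsComplete {ε : ℝ} (hε : 0 < ε) (hε1 : ε < 1) {b : ℕ → ℕ}
    (hb : IsPosSeq b) (h : IsFriendly ε b) :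
    ∃ a : ℕ → ℕ, (∀ n, 1 ≤ n → b n ≤ a n ∧ a n < b (n + 1)) ∧ IsEpsComplete ε a := by
  have hm := h.strictMono
  obtain ⟨K, hK1, hK⟩ := h.exists_card_block_le hb
  set η := ε / 2 with hη
  -- Small enough that `100 * τ` times the size of the rich block is at most `ε / 4` times that of
  -- the poor one, less than the number of indices the poor block misses.
  set τ := ε / (400 * K) with hτdef
  have hτ : 0 < τ := by positivity
  have hτK : 400 * (τ * K) = ε := by rw [hτdef]; field_simp
  have hτle : τ ≤ τ * K := by nlinarith
  obtain ⟨a, hab, hgood⟩ := h.exists_interlacing hb τ hτ (by linarith)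
  refine ⟨a, hab, fun S hS hcount => ?_⟩
  have hapos : IsPosSeq a := fun k hk => (hb k hk).trans_le (hab k hk).1
  have hamono : StrictMonoOn a (Set.Ici 1) := by
    intro k hk l hl hkl
    rw [Set.mem_Ici] at hk hl
    have h1 := (hab k hk).2
    have h2 := (hab l hl).1
    have h3 := hm.monotoneOn (Set.mem_Ici.2 (by omega : 1 ≤ k + 1)) (Set.mem_Ici.2 hl) hkl
    omega
  have hdens := eventually_density_ge hapos hamono hS hε.le hcount
  have hinf : ∀ C : ℕ, ∃ t, C ≤ (initialPart S t).card := by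
    intro C
    have h1 : ∀ᶠ N : ℕ in atTop, (C / ε : ℝ) ≤ N :=
      tendsto_natCast_atTop_atTop.eventually_ge_atTop _
    obtain ⟨t, h1, h2⟩ := (h1.and hdens).exists
    refine ⟨t, ?_⟩
    rw [div_le_iff₀ hε] at h1
    have : (C : ℝ) ≤ (initialPart S t).card := by linarith
    exact_mod_cast this
  by_cases hall : ∀ᶠ i : ℕ in atTop, η * (dyadicBlock b i).card ≤ (blockPart b S i).card
  · exact isCompleteOn_of_all_blocks_rich hb h hab hinf hτ (by linarith) hgood hall
  have hpoor : ∃ᶠ i : ℕ in atTop, ¬ η * (dyadicBlock b i).card ≤ (blockPart b S i).card :=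
    not_eventually.1 hall
  have hrich := frequently_blockPart_ge hb hm (η := η) (by linarith) hdens
  obtain ⟨C', hC'⟩ := h.growth
  obtain ⟨C, hC⟩ := exists_nat_ge (|C'| + 3)
  have hC3 : 3 ≤ C := by
    have : (3 : ℝ) ≤ C := by linarith [abs_nonneg C']
    exact_mod_cast this
  have hgrow : ∀ n, 1 ≤ n → b n ≤ sumUpTo b (ε * n + (C - 2 : ℝ)) := by
    intro n hn
    refine (hC' n hn).trans (Finset.sum_le_sum_of_subset (Finset.Icc_subset_Icc_right ?_))
    apply Nat.floor_le_floor
    linarith [le_abs_self C']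
  obtain ⟨N₀, hN₀⟩ := eventually_atTop.1 hdens
  have hidx := (tendsto_idx_two_pow hb hm).eventually_ge_atTop N₀
  obtain ⟨I, hI⟩ := eventually_atTop.1 (hgood.and (hK.and (hidx.and
    ((h.eventually_card_block_ge hb ((4 + C) / τ)).and (eventually_ge_atTop 1)))))
  -- a rich block with a poor one shortly before it
  obtain ⟨i', j, hIi', hij1, hij2, hpoor', hrich'⟩ : ∃ i' j, I ≤ i' ∧ i' + 2 ≤ j ∧ j ≤ i' + 3 ∧
      (¬ η * (dyadicBlock b i').card ≤ (blockPart b S i').card) ∧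
      η * (dyadicBlock b j).card ≤ (blockPart b S j).card := by
    classical
    -- Take the first rich block from `i + 2` on. If it is not within three blocks of `i`,
    -- minimality makes the block two before it poor. A distance of two ensures `2 * b k ≤ 2 ^ j`
    -- for the missing indices.
    obtain ⟨i, hi1, hi2⟩ := frequently_atTop.1 hpoor I
    have hex : ∃ j, i + 2 ≤ j ∧ η * (dyadicBlock b j).card ≤ (blockPart b S j).card := by
      obtain ⟨j, hj1, hj2⟩ := frequently_atTop.1 hrich (i + 2)
      exact ⟨j, hj1, hj2⟩
    obtain ⟨hj1, hj2⟩ := Nat.find_spec hex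
    rcases le_or_gt (Nat.find hex) (i + 3) with hle | hlt
    · exact ⟨i, Nat.find hex, hi1, hj1, hle, hi2, hj2⟩
    · refine ⟨Nat.find hex - 2, Nat.find hex, by omega, by omega, by omega, fun hcon => ?_, hj2⟩
      exact Nat.find_min hex (m := Nat.find hex - 2) (by omega) ⟨by omega, hcon⟩
  have hjI := hI j (by omega)
  have hiI := hI i' hIi'
  have hKn := hiI.2.1 j (by omega) hij2
  have hjr : (1 : ℝ) ≤ j := by exact_mod_cast hjI.2.2.2.2
  refine isCompleteOn_of_missing hε hε1 hb hm hab hinf hC3 hgrow hτ (η := η) (i := j)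
    (by linarith) hjI.1.1 hjI.1.2 ?_ hrich' ?_
    (M := dyadicBlock b i' \ blockPart b S i') ?_ ?_ ?_ ?_
  · have h1 := hjI.2.2.2.1
    rw [div_mul_eq_mul_div, div_le_iff₀ hτ] at h1
    have : (0 : ℝ) ≤ C := Nat.cast_nonneg C
    nlinarith
  · intro N hN
    apply hN₀
    exact (hI (j + 1) (by omega)).2.2.1.trans hN
  · intro k hk
    exact ((mem_dyadicBlock hb hm).1 (Finset.mem_sdiff.1 hk).1).1
  · intro k hk hkS
    rw [Finset.mem_sdiff] at hk
    exact hk.2 (mem_blockPart.2 ⟨hk.1, hkS⟩)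
  · intro k hk
    have h1 := ((mem_dyadicBlock hb hm).1 (Finset.mem_sdiff.1 hk).1).2.2
    have h2 := Nat.pow_le_pow_right (show 0 < 2 by norm_num) hij1
    rw [pow_succ] at h1 h2
    rw [pow_succ] at h2
    omega
  · have hsub : blockPart b S i' ⊆ dyadicBlock b i' := Finset.inter_subset_left
    rw [Finset.card_sdiff_of_subset hsub, Nat.cast_sub (Finset.card_le_card hsub)]
    push Not at hpoor'
    have hn' : (0 : ℝ) ≤ (dyadicBlock b i').card := Nat.cast_nonneg _
    have h1 : 100 * (τ * (dyadicBlock b j).card) ≤ 100 * (τ * (K * (dyadicBlock b i').card)) := by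
      gcongr
    have h2 : 100 * (τ * (K * (dyadicBlock b i').card)) = ε / 4 * (dyadicBlock b i').card := by
      rw [← hτK]; ring
    nlinarith

/-! ### Necessity of the growth condition. -/

/-- If the growth condition fails for every constant, then the terms in suitable index intervals can
be removed so that the remaining terms miss infinitely many integers. -/
theorem exists_not_isCompleteOn {a : ℕ → ℕ} {ε : ℝ} (hε : 0 < ε) (hε1 : ε < 1) (ha : IsPosSeq a)
    (hm : MonotoneOn a (Set.Ici 1)) (hunb : ∀ M, ∃ n, 1 ≤ n ∧ M ≤ a n)
    (hno : ∀ C : ℝ, ∃ n : ℕ, 1 ≤ n ∧ sumUpTo a (ε * n + C) < a n) :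
    ∃ S ⊆ Set.Ici 1, (∀ᶠ N : ℕ in atTop, ε * N ≤ (initialPart S N).card) ∧
      ¬ IsCompleteOn a S := by
  classical
  choose g hg1 hg using hno
  have hgt : ∀ C : ℝ, 0 ≤ C → ε * g C + C < g C := by
    intro C hC
    by_contra! hle
    have h1 : g C ≤ ⌊ε * g C + C⌋₊ := Nat.le_floor hle
    have h2 := Finset.single_le_sum (f := a) (fun _ _ => Nat.zero_le _)
      (Finset.mem_Icc.2 ⟨hg1 C, h1⟩)
    have h3 := hg C
    unfold sumUpTo at h3
    omega
  -- Each bad index is chosen with the constant `u k + 3`: the summand `u k` compensates for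
  -- everything possibly deleted up to `u k`, the `3` leaves room for rounding.
  obtain ⟨u, hu0, hu⟩ : ∃ u : ℕ → ℕ, u 0 = 1 ∧ ∀ k : ℕ, u (k + 1) = g ((u k : ℝ) + 3) :=
    ⟨fun k => Nat.rec (motive := fun _ => ℕ) 1 (fun _ x => g ((x : ℝ) + 3)) k, rfl,
      by intro k; rfl⟩
  have hugap : ∀ k : ℕ, ε * u (k + 1) + (u k + 3) < u (k + 1) := by
    intro k
    rw [hu]
    exact hgt _ (by positivity)
  have hustep : ∀ k, u k < u (k + 1) := by
    intro k
    have h1 := hugap k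
    have h2 : 0 ≤ ε * u (k + 1) := by positivity
    have : (u k : ℝ) < u (k + 1) := by linarith
    exact_mod_cast this
  have humono : StrictMono u := strictMono_nat_of_lt_succ hustep
  let S : Set ℕ := {i | 2 ≤ i ∧ ∀ k, i < u (k + 1) → (i : ℝ) ≤ ε * u (k + 1) + (u k + 3)}
  have hS1 : S ⊆ Set.Ici 1 := fun i hi => Set.mem_Ici.2 (by have := hi.1; omega)
  refine ⟨S, hS1, ?_, ?_⟩
  -- The second alternative covers the stretch before the first long deletion, where only index `1`
  -- is missing. At a deleted index, the undeleted run after `u k` already has more than `ε * u (k +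
  -- 1)` elements.
  · have key : ∀ N : ℕ, ε * N ≤ (initialPart S N).card ∨ (N : ℝ) - 1 ≤ (initialPart S N).card := by
      intro N
      induction N with
      | zero => left; simp
      | succ N ih =>
        by_cases hN : N + 1 ∈ S
        · rw [initialPart_succ_of_mem hN,
            Finset.card_insert_of_notMem (notMem_initialPart_succ S N)]
          push_cast
          rcases ih with ih | ih
          · left; linarith
          · right; linarith
        · rcases Nat.eq_zero_or_pos N with h0 | h0
          · right; rw [h0]; simp
          · left
            have hN' : ∃ k, N + 1 < u (k + 1) ∧ ε * u (k + 1) + (u k + 3) < ((N + 1 : ℕ) : ℝ) := by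
              by_contra! hcon
              exact hN ⟨by omega, hcon⟩
            obtain ⟨k, hk1, hk2⟩ := hN'
            have hsub : Finset.Ioc (u k) ⌊ε * u (k + 1) + (u k + 3)⌋₊ ⊆ initialPart S (N + 1) := by
              intro i hi
              rw [Finset.mem_Ioc, Nat.le_floor_iff (by positivity)] at hi
              have huk : 1 ≤ u k := by
                have h1 := humono.monotone (Nat.zero_le k)
                rwa [hu0] at h1
              refine mem_initialPart.2 ⟨⟨by omega, ?_⟩, by omega, fun l hl => ?_⟩
              · have : (i : ℝ) ≤ ((N + 1 : ℕ) : ℝ) := by linarith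
                exact_mod_cast this
              · rcases lt_trichotomy l k with h | h | h
                · have := humono.monotone (show l + 1 ≤ k from h)
                  omega
                · rw [h]; exact hi.2
                · have h1 := humono.monotone (show k + 1 ≤ l from h)
                  have h2 : (i : ℝ) ≤ u l := by
                    have h3 : ((N + 1 : ℕ) : ℝ) < u (k + 1) := by exact_mod_cast hk1
                    have h4 : (u (k + 1) : ℝ) ≤ u l := by exact_mod_cast h1
                    linarith
                  have : 0 ≤ ε * u (l + 1) := by positivity
                  linarith
            have hcard := Finset.card_le_card hsub
            rw [Nat.card_Ioc] at hcard
            have h1 : (⌊ε * u (k + 1) + (u k + 3)⌋₊ : ℝ) ≤ (initialPart S (N + 1)).card + u k := by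
              rw [← Nat.cast_add]
              exact Nat.cast_le.2 (by omega)
            have h2 := Nat.lt_floor_add_one (ε * u (k + 1) + (u k + 3) : ℝ)
            have h3 : ((N + 1 : ℕ) : ℝ) < u (k + 1) := by exact_mod_cast hk1
            have h4 := mul_le_mul_of_nonneg_left h3.le hε.le
            linarith
    have hev : ∀ᶠ N : ℕ in atTop, (1 / (1 - ε) : ℝ) ≤ N :=
      tendsto_natCast_atTop_atTop.eventually_ge_atTop _
    filter_upwards [hev] with N hN
    rw [div_le_iff₀ (by linarith)] at hN
    rcases key N with h | h
    · exact h
    · linarith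
  · intro hcomp
    obtain ⟨m₀, hm₀⟩ := eventually_atTop.1 hcomp
    obtain ⟨n, hn1, hn⟩ := hunb (m₀ + 1)
    set k := n with hk
    have hun : n ≤ u (k + 1) := (by omega : n ≤ k + 1).trans (humono.id_le (k + 1))
    have hau : m₀ + 1 ≤ a (u (k + 1)) :=
      hn.trans (hm (Set.mem_Ici.2 hn1) (Set.mem_Ici.2 (hn1.trans hun)) hun)
    -- Terms from index `u (k + 1)` on exceed this target. The earlier ones in `S` lie in `{2, …,
    -- F}`, and the omission of `a 1` makes their total strictly smaller than the target.
    obtain ⟨T, hTS, hT⟩ := hm₀ (a (u (k + 1)) - 1) (by omega)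
    have hlt := hg ((u k : ℝ) + 3)
    rw [← hu] at hlt
    set F := ⌊ε * u (k + 1) + (u k + 3)⌋₊ with hF
    have hF1 : 1 ≤ F := by
      apply Nat.le_floor
      have : 0 ≤ ε * u (k + 1) := by positivity
      have : (0 : ℝ) ≤ u k := by positivity
      push_cast; linarith
    have hsub : T ⊆ (Finset.Icc 1 F).erase 1 := by
      intro i hi
      have hiS := hTS hi
      have h2 : 2 ≤ i := hiS.1
      have h3 : a i ≤ a (u (k + 1)) - 1 := by
        rw [← hT]; exact Finset.single_le_sum (fun _ _ => Nat.zero_le _) hi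
      have h4 : i < u (k + 1) := by
        by_contra! hcon
        have := hm (Set.mem_Ici.2 (hn1.trans hun)) (Set.mem_Ici.2 (by omega : 1 ≤ i)) hcon
        omega
      have h5 := hiS.2 k h4
      rw [Finset.mem_erase, Finset.mem_Icc]
      exact ⟨by omega, by omega, Nat.le_floor h5⟩
    have h1 := Finset.sum_le_sum_of_subset (f := a) hsub
    have h2 := Finset.add_sum_erase (Finset.Icc 1 F) a (Finset.mem_Icc.2 ⟨le_rfl, hF1⟩)
    have h3 := ha 1 le_rfl
    rw [sumUpTo, ← hF] at hlt
    omega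

theorem le_sumUpTo_of_le {a : ℕ → ℕ} (ha : IsPosSeq a) {M : ℕ} {x : ℝ} (hx : M ≤ x) :
    M ≤ sumUpTo a x := by
  have h1 : M ≤ ⌊x⌋₊ := Nat.le_floor hx
  have h2 : (Finset.Icc 1 ⌊x⌋₊).card • 1 ≤ ∑ i ∈ Finset.Icc 1 ⌊x⌋₊, a i :=
    Finset.card_nsmul_le_sum _ _ _ fun i hi => ha i (Finset.mem_Icc.1 hi).1
  simp only [Nat.card_Icc, smul_eq_mul] at h2
  unfold sumUpTo
  omega

theorem single_le_sumUpTo (a : ℕ → ℕ) {n : ℕ} (hn : 1 ≤ n) {x : ℝ} (hx : n ≤ x) :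
    a n ≤ sumUpTo a x :=
  Finset.single_le_sum (f := a) (fun _ _ => Nat.zero_le _)
    (Finset.mem_Icc.2 ⟨hn, Nat.le_floor hx⟩)

/-- The growth condition is necessary for `ε`-completeness. -/
theorem IsEpsComplete.exists_growth {ε : ℝ} (hε : 0 < ε) {a : ℕ → ℕ} (ha : IsPosSeq a)
    (hm : MonotoneOn a (Set.Ici 1)) (h : IsEpsComplete ε a) :
    ∃ C : ℝ, ∀ n, 1 ≤ n → a n ≤ sumUpTo a (ε * n + C) := by
  rcases le_or_gt 1 ε with hε1 | hε1
  · refine ⟨0, fun n hn => single_le_sumUpTo a hn ?_⟩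
    have : (0 : ℝ) ≤ n := Nat.cast_nonneg n
    nlinarith
  by_cases hunb : ∀ M, ∃ n, 1 ≤ n ∧ M ≤ a n
  · by_contra! hno
    obtain ⟨S, hS1, hdens, hnot⟩ := exists_not_isCompleteOn hε hε1 ha hm hunb hno
    refine hnot (h S hS1 ?_)
    obtain ⟨N₀, hN₀⟩ := eventually_atTop.1 hdens
    filter_upwards [eventually_ge_atTop (a (N₀ + 1))] with x hx
    have hex : ∃ n, 1 ≤ n ∧ x < a n := by
      obtain ⟨n, h1, h2⟩ := hunb (x + 1)
      exact ⟨n, h1, h2⟩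
    classical
    obtain ⟨hn1, hn2⟩ := Nat.find_spec hex
    set n := Nat.find hex with hn
    have hiff : ∀ i, 1 ≤ i → (a i ≤ x ↔ i ≤ n - 1) := by
      intro i hi
      constructor
      · intro hix
        by_contra! hlt
        have := hm (Set.mem_Ici.2 hn1) (Set.mem_Ici.2 hi) (by omega : n ≤ i)
        omega
      · intro hin
        by_contra! hlt
        exact Nat.find_min hex (m := i) (by omega) ⟨hi, hlt⟩
    rw [eps_mul_countIn_le_iff hS1 hε.le hiff]
    apply hN₀
    have := (hiff (N₀ + 1) (by omega)).1 hx
    omega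
  · push Not at hunb
    obtain ⟨M, hM⟩ := hunb
    refine ⟨M, fun n hn => (hM n hn).le.trans (le_sumUpTo_of_le ha ?_)⟩
    have : 0 ≤ ε * n := by positivity
    linarith

/-! ### The functional differential equation behind the recursion. -/

/-- The coefficients of the power series `lagSeries`. -/
noncomputable def lagCoeff (ε : ℝ) (k : ℕ) : ℝ := ε ^ ((k + 1).choose 2) / k.factorial

/-- The solution `F` of the functional differential equation `F' x = ε F (ε x)` with `F 0 = 1`,
given by its power series. -/
noncomputable def lagSeries (ε x : ℝ) : ℝ := ∑' k, lagCoeff ε k * x ^ k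

theorem lagCoeff_pos {ε : ℝ} (hε : 0 < ε) (k : ℕ) : 0 < lagCoeff ε k := by
  unfold lagCoeff; positivity

theorem lagCoeff_zero (ε : ℝ) : lagCoeff ε 0 = 1 := by simp [lagCoeff]

/-- The equation `F' x = ε * F (ε * x)` read off on coefficients. -/
theorem lagCoeff_succ (ε : ℝ) (k : ℕ) :
    lagCoeff ε (k + 1) * (k + 1) = ε * (lagCoeff ε k * ε ^ k) := by
  unfold lagCoeff
  rw [Nat.choose_succ_succ' (k + 1) 1, Nat.choose_one_right, Nat.factorial_succ, pow_add]
  push_cast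
  field_simp
  ring

theorem summable_lagSeries {ε : ℝ} (hε : 0 < ε) (hε1 : ε < 1) {x : ℝ} (hx : 0 ≤ x) :
    Summable fun k => lagCoeff ε k * x ^ k := by
  refine Summable.of_nonneg_of_le
    (fun k => mul_nonneg (lagCoeff_pos hε k).le (pow_nonneg hx k)) (fun k => ?_)
    (Real.summable_pow_div_factorial x)
  rw [lagCoeff, div_mul_eq_mul_div]
  gcongr
  exact mul_le_of_le_one_left (by positivity) (pow_le_one₀ hε.le hε1.le)

theorem lagCoeff_mul_pow_le {ε : ℝ} (hε : 0 < ε) (hε1 : ε < 1) {x : ℝ} (hx : 0 ≤ x) (k : ℕ) :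
    lagCoeff ε k * x ^ k ≤ lagSeries ε x :=
  (summable_lagSeries hε hε1 hx).le_tsum k
    fun j _ => mul_nonneg (lagCoeff_pos hε j).le (pow_nonneg hx j)

theorem one_le_lagSeries {ε : ℝ} (hε : 0 < ε) (hε1 : ε < 1) {x : ℝ} (hx : 0 ≤ x) :
    1 ≤ lagSeries ε x := by
  simpa [lagCoeff_zero] using lagCoeff_mul_pow_le hε hε1 hx 0

theorem lagSeries_mono {ε : ℝ} (hε : 0 < ε) (hε1 : ε < 1) {x y : ℝ} (hx : 0 ≤ x) (hxy : x ≤ y) :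
    lagSeries ε x ≤ lagSeries ε y := by
  refine (summable_lagSeries hε hε1 hx).tsum_le_tsum (fun k => ?_)
    (summable_lagSeries hε hε1 (hx.trans hxy))
  have := (lagCoeff_pos hε k).le
  gcongr

theorem lagSeries_zero (ε : ℝ) : lagSeries ε 0 = 1 := by
  rw [lagSeries, tsum_eq_single 0 (fun k hk => by simp [hk])]
  simp [lagCoeff_zero]

theorem pow_succ_sub_pow_succ_bounds {x y : ℝ} (hx : 0 ≤ x) (hxy : x ≤ y) (k : ℕ) :
    (k + 1) * x ^ k * (y - x) ≤ y ^ (k + 1) - x ^ (k + 1) ∧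
      y ^ (k + 1) - x ^ (k + 1) ≤ (k + 1) * y ^ k * (y - x) := by
  induction k with
  | zero => simp
  | succ k ih =>
    obtain ⟨h1, h2⟩ := ih
    have hy := hx.trans hxy
    have hd : 0 ≤ y - x := sub_nonneg.2 hxy
    have hp : x ^ (k + 1) ≤ y ^ (k + 1) := by gcongr
    have e1 : y ^ (k + 1 + 1) - x ^ (k + 1 + 1) =
        x * (y ^ (k + 1) - x ^ (k + 1)) + y ^ (k + 1) * (y - x) := by ring
    have e2 : y ^ (k + 1 + 1) - x ^ (k + 1 + 1) =
        y * (y ^ (k + 1) - x ^ (k + 1)) + x ^ (k + 1) * (y - x) := by ring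
    have h3 := mul_le_mul_of_nonneg_left h1 hx
    have h4 := mul_le_mul_of_nonneg_left h2 hy
    have h5 := mul_le_mul_of_nonneg_right hp hd
    push_cast
    constructor
    · rw [e1]
      have : ((k : ℝ) + 1 + 1) * x ^ (k + 1) * (y - x) =
        x * ((k + 1) * x ^ k * (y - x)) + x ^ (k + 1) * (y - x) := by ring
      linarith
    · rw [e2]
      have : ((k : ℝ) + 1 + 1) * y ^ (k + 1) * (y - x) =
        y * ((k + 1) * y ^ k * (y - x)) + y ^ (k + 1) * (y - x) := by ring
      linarith

/-- Mean value estimate for `F' t = ε * F (ε * t)` with `F` increasing, carried out termwise on the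
series so that no differentiation is needed. -/
theorem lagSeries_sub_bounds {ε : ℝ} (hε : 0 < ε) (hε1 : ε < 1) {x y : ℝ} (hx : 0 ≤ x)
    (hxy : x ≤ y) :
    (y - x) * (ε * lagSeries ε (ε * x)) ≤ lagSeries ε y - lagSeries ε x ∧
      lagSeries ε y - lagSeries ε x ≤ (y - x) * (ε * lagSeries ε (ε * y)) := by
  have hy := hx.trans hxy
  have hsx := summable_lagSeries hε hε1 hx
  have hsy := summable_lagSeries hε hε1 hy
  have hdiff : lagSeries ε y - lagSeries ε x =
      ∑' k : ℕ, lagCoeff ε (k + 1) * (y ^ (k + 1) - x ^ (k + 1)) := by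
    rw [lagSeries, lagSeries, ← hsy.tsum_sub hsx, (hsy.sub hsx).tsum_eq_zero_add]
    simp [mul_sub]
  have hsd : Summable fun k : ℕ => lagCoeff ε (k + 1) * (y ^ (k + 1) - x ^ (k + 1)) := by
    have := (summable_nat_add_iff 1).2 (hsy.sub hsx)
    simpa [mul_sub] using this
  have hterm : ∀ (z : ℝ) (k : ℕ), (y - x) * (ε * (lagCoeff ε k * (ε * z) ^ k)) =
      lagCoeff ε (k + 1) * ((k + 1) * z ^ k * (y - x)) := by
    intro z k
    calc (y - x) * (ε * (lagCoeff ε k * (ε * z) ^ k))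
        = (ε * (lagCoeff ε k * ε ^ k)) * (z ^ k * (y - x)) := by rw [mul_pow]; ring
      _ = lagCoeff ε (k + 1) * ((k + 1) * z ^ k * (y - x)) := by rw [← lagCoeff_succ]; ring
  have hser : ∀ z, 0 ≤ z → (y - x) * (ε * lagSeries ε (ε * z)) =
      ∑' k : ℕ, lagCoeff ε (k + 1) * ((k + 1) * z ^ k * (y - x)) := by
    intro z hz
    rw [lagSeries, ← tsum_mul_left, ← tsum_mul_left]
    exact tsum_congr (hterm z)
  have hsum : ∀ z, 0 ≤ z →
      Summable fun k : ℕ => lagCoeff ε (k + 1) * ((k + 1) * z ^ k * (y - x)) := by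
    intro z hz
    have := ((summable_lagSeries hε hε1 (mul_nonneg hε.le hz)).mul_left ε).mul_left (y - x)
    exact this.congr (hterm z)
  rw [hdiff, hser x hx, hser y hy]
  constructor
  · refine (hsum x hx).tsum_le_tsum (fun k => ?_) hsd
    exact mul_le_mul_of_nonneg_left (pow_succ_sub_pow_succ_bounds hx hxy k).1
      (lagCoeff_pos hε _).le
  · refine hsd.tsum_le_tsum (fun k => ?_) (hsum y hy)
    exact mul_le_mul_of_nonneg_left (pow_succ_sub_pow_succ_bounds hx hxy k).2
      (lagCoeff_pos hε _).le

/-- Multiplicative convexity of `lagSeries`. -/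
theorem lagSeries_mul_le {ε : ℝ} (hε : 0 < ε) (hε1 : ε < 1) {x y l : ℝ} (hx : 0 ≤ x)
    (hxy : x ≤ y) (hl : 1 ≤ l) :
    lagSeries ε (l * x) * lagSeries ε y ≤ lagSeries ε (l * y) * lagSeries ε x := by
  have hy := hx.trans hxy
  have hl0 : 0 ≤ l := by linarith
  have ht : ∀ z, 0 ≤ z → Tendsto (fun N => ∑ k ∈ Finset.range N, lagCoeff ε k * z ^ k) atTop
      (𝓝 (lagSeries ε z)) := fun z hz => (summable_lagSeries hε hε1 hz).hasSum.tendsto_sum_nat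
  refine le_of_tendsto_of_tendsto' ((ht _ (mul_nonneg hl0 hx)).mul (ht y hy))
    ((ht _ (mul_nonneg hl0 hy)).mul (ht x hx)) fun N => ?_
  rw [Finset.sum_mul_sum, Finset.sum_mul_sum]
  set A := ∑ i ∈ Finset.range N, ∑ j ∈ Finset.range N,
    lagCoeff ε i * (l * x) ^ i * (lagCoeff ε j * y ^ j) with hA
  set B := ∑ i ∈ Finset.range N, ∑ j ∈ Finset.range N,
    lagCoeff ε i * (l * y) ^ i * (lagCoeff ε j * x ^ j) with hB
  have hA' : A = ∑ i ∈ Finset.range N, ∑ j ∈ Finset.range N,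
    lagCoeff ε j * (l * x) ^ j * (lagCoeff ε i * y ^ i) := by rw [hA, Finset.sum_comm]
  have hB' : B = ∑ i ∈ Finset.range N, ∑ j ∈ Finset.range N,
    lagCoeff ε j * (l * y) ^ j * (lagCoeff ε i * x ^ i) := by rw [hB, Finset.sum_comm]
  have key : A + A ≤ B + B := by
    nth_rewrite 2 [hA']
    nth_rewrite 2 [hB']
    rw [hA, hB, ← Finset.sum_add_distrib, ← Finset.sum_add_distrib]
    refine Finset.sum_le_sum fun i _ => ?_
    rw [← Finset.sum_add_distrib, ← Finset.sum_add_distrib]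
    refine Finset.sum_le_sum fun j _ => ?_
    -- After symmetrising in `i` and `j`, each pair contributes a product of two factors of the same
    -- sign.
    have hmain : 0 ≤ (l ^ i - l ^ j) * (y ^ i * x ^ j - x ^ i * y ^ j) := by
      have haux : ∀ m d : ℕ, 0 ≤ (l ^ (m + d) - l ^ m) *
          (y ^ (m + d) * x ^ m - x ^ (m + d) * y ^ m) := by
        intro m d
        apply mul_nonneg
        · rw [sub_nonneg]; exact pow_le_pow_right₀ hl (by omega)
        · have : y ^ (m + d) * x ^ m - x ^ (m + d) * y ^ m =
              (x ^ m * y ^ m) * (y ^ d - x ^ d) := by rw [pow_add, pow_add]; ring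
          rw [this]
          have : x ^ d ≤ y ^ d := by gcongr
          exact mul_nonneg (by positivity) (by linarith)
      rcases le_total j i with h | h
      · obtain ⟨d, rfl⟩ := Nat.exists_eq_add_of_le h
        exact haux j d
      · obtain ⟨d, rfl⟩ := Nat.exists_eq_add_of_le h
        have := haux i d
        linarith
    have := mul_nonneg (mul_nonneg (lagCoeff_pos hε i).le (lagCoeff_pos hε j).le) hmain
    simp only [mul_pow]
    linarith
  linarith

/-- Completing the square bounds `ε ^ (k ^ 2 / 2) * x ^ k` by `exp (log x ^ 2 / (2 L))` uniformly in
`k`; the factorials then sum to `e`. -/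
theorem lagSeries_le {ε : ℝ} (hε : 0 < ε) (hε1 : ε < 1) {x : ℝ} (hx : 0 < x) :
    lagSeries ε x ≤ Real.exp (1 + 1 / (2 * Real.log (1 / ε)) * Real.log x ^ 2) := by
  set L := Real.log (1 / ε) with hL
  have hL0 : 0 < L := Real.log_pos (by rw [lt_div_iff₀ hε]; linarith)
  have hLε : Real.log ε = -L := by rw [hL, one_div, Real.log_inv]; ring
  have hsum : HasSum (fun k : ℕ => (1 : ℝ) ^ k / k.factorial) (Real.exp 1) := by
    rw [Real.exp_eq_exp_ℝ]
    exact NormedSpace.expSeries_div_hasSum_exp (1 : ℝ)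
  have hsum' := hsum.mul_left (Real.exp (1 / (2 * L) * Real.log x ^ 2))
  rw [← Real.exp_add, add_comm _ (1 : ℝ)] at hsum'
  rw [← hsum'.tsum_eq]
  refine (summable_lagSeries hε hε1 hx.le).tsum_le_tsum (fun k => ?_) hsum'.summable
  rw [lagCoeff, one_pow, mul_one_div, div_mul_eq_mul_div]
  gcongr
  have hch : (k : ℝ) ^ 2 / 2 ≤ ((k + 1).choose 2 : ℝ) := by
    rw [Nat.cast_choose_two]; push_cast; nlinarith [Nat.cast_nonneg (α := ℝ) k]
  rw [← Real.exp_log hε, ← Real.exp_nat_mul, hLε]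
  nth_rewrite 1 [← Real.exp_log hx]
  rw [← Real.exp_nat_mul, ← Real.exp_add, Real.exp_le_exp]
  have e : 1 / (2 * L) * Real.log x ^ 2 - (k * Real.log x - L * (k ^ 2 / 2)) =
      (Real.log x - L * k) ^ 2 / (2 * L) := by field_simp; ring
  have : 0 ≤ (Real.log x - L * k) ^ 2 / (2 * L) := by positivity
  have := mul_le_mul_of_nonneg_left hch hL0.le
  linarith

/-- Once `ε * (x + 1) ≤ x`, the increment over a unit step is at most `F x` itself. Smaller `x` are
handled by monotonicity. -/
theorem exists_lagSeries_add_one_le {ε : ℝ} (hε : 0 < ε) (hε1 : ε < 1) :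
    ∃ D : ℝ, 1 ≤ D ∧ ∀ x, 0 ≤ x → lagSeries ε (x + 1) ≤ D * lagSeries ε x := by
  set x₁ := ε / (1 - ε) with hx₁
  have h1ε : 0 < 1 - ε := by linarith
  have hx₁0 : 0 ≤ x₁ := by positivity
  refine ⟨max 2 (lagSeries ε (x₁ + 1)), le_max_of_le_left (by norm_num), fun x hx => ?_⟩
  have hF := one_le_lagSeries hε hε1 hx
  rcases le_total x x₁ with h | h
  · calc lagSeries ε (x + 1) ≤ lagSeries ε (x₁ + 1) :=
          lagSeries_mono hε hε1 (by linarith) (by linarith)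
      _ ≤ max 2 (lagSeries ε (x₁ + 1)) := le_max_right _ _
      _ ≤ _ := le_mul_of_one_le_right (le_max_of_le_left (by norm_num)) hF
  · have h1 := (lagSeries_sub_bounds hε hε1 hx (by linarith : x ≤ x + 1)).2
    have h2 : ε * (x + 1) ≤ x := by
      rw [hx₁, div_le_iff₀ h1ε] at h; linarith
    have h3 := lagSeries_mono hε hε1 (by positivity) h2
    have h4 : (2 : ℝ) ≤ max 2 (lagSeries ε (x₁ + 1)) := le_max_left _ _
    nlinarith

/-- The increment from `M / ε` to `(M + 1) / ε` lies between `F M` and `F (M + 1)`; telescoping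
links `F` to the discrete recursion. -/
theorem lagSeries_natCast_bounds {ε : ℝ} (hε : 0 < ε) (hε1 : ε < 1) (M : ℕ) :
    1 + ∑ i ∈ Finset.Ioc 0 (M - 1), lagSeries ε i ≤ lagSeries ε (M / ε) ∧
      lagSeries ε (M / ε) ≤ 1 + ∑ i ∈ Finset.Ioc 0 M, lagSeries ε i := by
  induction M with
  | zero => simp [lagSeries_zero]
  | succ M ih =>
    have h1 := lagSeries_sub_bounds hε hε1 (x := M / ε) (y := (M + 1 : ℕ) / ε) (by positivity)
      (by gcongr; simp)
    have e1 : (((M + 1 : ℕ) : ℝ) / ε - M / ε) = 1 / ε := by push_cast; field_simp; ring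
    have e2 : ε * ((M : ℝ) / ε) = M := by field_simp
    have e3 : ε * (((M + 1 : ℕ) : ℝ) / ε) = (M + 1 : ℕ) := by field_simp
    have e4 : ∀ z, 1 / ε * (ε * z) = z := by intro z; field_simp
    rw [e1, e2, e3, e4, e4] at h1
    constructor
    · rcases Nat.eq_zero_or_pos M with h0 | h0
      · subst h0
        have := one_le_lagSeries hε hε1 (x := ((0 + 1 : ℕ) : ℝ) / ε) (by positivity)
        simpa using this
      · obtain ⟨k, rfl⟩ : ∃ k, M = k + 1 := ⟨M - 1, by omega⟩
        rw [Nat.add_sub_cancel, Finset.sum_Ioc_succ_top (Nat.zero_le _)]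
        have := ih.1
        rw [Nat.add_sub_cancel] at this
        linarith
    · rw [Finset.sum_Ioc_succ_top (Nat.zero_le _)]
      linarith [ih.2]

theorem lagSeries_le_sum {ε : ℝ} (hε : 0 < ε) (hε1 : ε < 1) (n : ℕ) :
    lagSeries ε n ≤ 1 + ∑ i ∈ Finset.Ioc 0 (⌊ε * n⌋₊ + 1), lagSeries ε i := by
  refine le_trans (lagSeries_mono hε hε1 (by positivity) ?_)
    (lagSeries_natCast_bounds hε hε1 (⌊ε * n⌋₊ + 1)).2
  rw [le_div_iff₀ hε]
  have := Nat.lt_floor_add_one (ε * n : ℝ)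
  push_cast
  linarith

theorem sum_le_lagSeries {ε : ℝ} (hε : 0 < ε) (hε1 : ε < 1) (n : ℕ) :
    ∑ i ∈ Finset.Ioc 0 (⌊ε * n⌋₊ - 1), lagSeries ε i ≤ lagSeries ε n := by
  have h1 := (lagSeries_natCast_bounds hε hε1 ⌊ε * n⌋₊).1
  have h2 : lagSeries ε (⌊ε * n⌋₊ / ε) ≤ lagSeries ε n := by
    apply lagSeries_mono hε hε1 (by positivity)
    rw [div_le_iff₀ hε, mul_comm (n : ℝ)]
    exact Nat.floor_le (by positivity)
  linarith

/-! ### A friendly sequence of extremal size. -/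

/-- An integer sequence comparable to `lagSeries`, with regularly growing gaps. -/
noncomputable def lagSeq (ε : ℝ) (n : ℕ) : ℕ := ⌈10 / ε * lagSeries ε n⌉₊

theorem lagSeq_bounds {ε : ℝ} (hε : 0 < ε) (hε1 : ε < 1) (n : ℕ) :
    10 / ε * lagSeries ε n ≤ lagSeq ε n ∧ (lagSeq ε n : ℝ) < 10 / ε * lagSeries ε n + 1 := by
  have h := one_le_lagSeries hε hε1 (Nat.cast_nonneg n)
  exact ⟨Nat.le_ceil _, Nat.ceil_lt_add_one (by positivity)⟩

theorem ten_le_lagSeq {ε : ℝ} (hε : 0 < ε) (hε1 : ε < 1) (n : ℕ) : (10 : ℝ) ≤ lagSeq ε n := by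
  have h := one_le_lagSeries hε hε1 (Nat.cast_nonneg n)
  have h1 : (10 : ℝ) ≤ 10 / ε := by rw [le_div_iff₀ hε]; linarith
  nlinarith [(lagSeq_bounds hε hε1 n).1]

theorem isPosSeq_lagSeq {ε : ℝ} (hε : 0 < ε) (hε1 : ε < 1) : IsPosSeq (lagSeq ε) := by
  intro n _
  have := ten_le_lagSeq hε hε1 n
  have : (0 : ℝ) < lagSeq ε n := by linarith
  exact_mod_cast this

theorem lagSeries_succ_sub_bounds {ε : ℝ} (hε : 0 < ε) (hε1 : ε < 1) (n : ℕ) :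
    ε * lagSeries ε (ε * n) ≤ lagSeries ε (n + 1 : ℕ) - lagSeries ε n ∧
      lagSeries ε (n + 1 : ℕ) - lagSeries ε n ≤ ε * lagSeries ε (ε * (n + 1 : ℕ)) := by
  have h := lagSeries_sub_bounds hε hε1 (Nat.cast_nonneg n)
    (show (n : ℝ) ≤ (n + 1 : ℕ) by push_cast; linarith)
  have e : ((n + 1 : ℕ) : ℝ) - n = 1 := by push_cast; ring
  rwa [e, one_mul, one_mul] at h

/-- Rounding alters a gap by less than `1`. The factor `10 / ε` makes the unrounded gap at least
`10`, so the constant `10` only moves to `9` or `11`. -/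
theorem discDeriv_lagSeq_bounds {ε : ℝ} (hε : 0 < ε) (hε1 : ε < 1) (n : ℕ) :
    9 * lagSeries ε (ε * n) ≤ discDeriv (lagSeq ε) n ∧
      9 / ε * (lagSeries ε (n + 1 : ℕ) - lagSeries ε n) ≤ discDeriv (lagSeq ε) n ∧
      discDeriv (lagSeq ε) n ≤ 11 / ε * (lagSeries ε (n + 1 : ℕ) - lagSeries ε n) ∧
      discDeriv (lagSeq ε) n ≤ 11 * lagSeries ε (ε * (n + 1 : ℕ)) := by
  obtain ⟨h1, h2⟩ := lagSeries_succ_sub_bounds hε hε1 n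
  have h3 := one_le_lagSeries hε hε1 (x := ε * n) (by positivity)
  have h4 := lagSeq_bounds hε hε1 n
  have h5 := lagSeq_bounds hε hε1 (n + 1)
  set d := lagSeries ε (n + 1 : ℕ) - lagSeries ε n with hd
  have e : d = ε * (d / ε) := by field_simp
  have h1' : lagSeries ε (ε * n) ≤ d / ε := by rw [le_div_iff₀ hε]; linarith
  have h2' : d / ε ≤ lagSeries ε (ε * (n + 1 : ℕ)) := by rw [div_le_iff₀ hε]; linarith
  have e9 : ∀ c : ℝ, c / ε * d = c * (d / ε) := by intro c; field_simp
  have e10 : 10 / ε * lagSeries ε (n + 1 : ℕ) - 10 / ε * lagSeries ε n = 10 * (d / ε) := by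
    rw [← e9, hd]; ring
  unfold discDeriv
  rw [e9, e9]
  refine ⟨by linarith, by linarith, by linarith, by linarith⟩

theorem tendsto_discDeriv_lagSeq {ε : ℝ} (hε : 0 < ε) (hε1 : ε < 1) :
    Tendsto (discDeriv (lagSeq ε)) atTop atTop := by
  have h : ∀ n : ℕ, ε * ε * n ≤ discDeriv (lagSeq ε) n := by
    intro n
    have h1 := (discDeriv_lagSeq_bounds hε hε1 n).1
    have h2 := (lagSeries_sub_bounds hε hε1 le_rfl (show 0 ≤ ε * n by positivity)).1
    rw [mul_zero, lagSeries_zero] at h2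
    have : 0 ≤ ε * n := by positivity
    nlinarith
  refine tendsto_atTop_mono h (Tendsto.const_mul_atTop (by positivity)
    tendsto_natCast_atTop_atTop)

theorem strictMono_lagSeq {ε : ℝ} (hε : 0 < ε) (hε1 : ε < 1) : StrictMono (lagSeq ε) := by
  refine strictMono_nat_of_lt_succ fun n => ?_
  have h1 := (discDeriv_lagSeq_bounds hε hε1 n).1
  have h2 := one_le_lagSeries hε hε1 (x := ε * n) (by positivity)
  unfold discDeriv at h1
  have : (lagSeq ε n : ℝ) < lagSeq ε (n + 1) := by linarith
  exact_mod_cast this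

theorem lagSeq_growth {ε : ℝ} (hε : 0 < ε) (hε1 : ε < 1) :
    ∃ C : ℝ, ∀ n, 1 ≤ n → lagSeq ε n ≤ sumUpTo (lagSeq ε) (ε * n + C) := by
  obtain ⟨C, hC⟩ := exists_nat_ge (10 / ε + 1)
  refine ⟨(C + 1 : ℕ), fun n hn => ?_⟩
  rw [sumUpTo_eq_sum_Ioc, Nat.floor_add_natCast (by positivity)]
  have h1 := lagSeries_le_sum hε hε1 n
  have h2 := (lagSeq_bounds hε hε1 n).2
  have h3 : 10 / ε * ∑ i ∈ Finset.Ioc 0 (⌊ε * n⌋₊ + 1), lagSeries ε i ≤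
      ∑ i ∈ Finset.Ioc 0 (⌊ε * n⌋₊ + 1), (lagSeq ε i : ℝ) := by
    rw [Finset.mul_sum]
    exact Finset.sum_le_sum fun i _ => (lagSeq_bounds hε hε1 i).1
  have h4 : (C : ℝ) ≤ ∑ i ∈ Finset.Ioc (⌊ε * n⌋₊ + 1) (⌊ε * n⌋₊ + (C + 1)), (lagSeq ε i : ℝ) := by
    have := Finset.card_nsmul_le_sum (Finset.Ioc (⌊ε * n⌋₊ + 1) (⌊ε * n⌋₊ + (C + 1)))
      (fun i => (lagSeq ε i : ℝ)) 1 fun i _ => by linarith [ten_le_lagSeq hε hε1 i]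
    rw [Nat.card_Ioc, show ⌊ε * n⌋₊ + (C + 1) - (⌊ε * n⌋₊ + 1) = C by omega] at this
    simpa using this
  have h5 := Finset.sum_Ioc_consecutive (fun i => (lagSeq ε i : ℝ))
    (Nat.zero_le (⌊ε * n⌋₊ + 1)) (by omega : ⌊ε * n⌋₊ + 1 ≤ ⌊ε * n⌋₊ + (C + 1))
  have h6 : 10 / ε * lagSeries ε n ≤
      10 / ε * (1 + ∑ i ∈ Finset.Ioc 0 (⌊ε * n⌋₊ + 1), lagSeries ε i) := by gcongr
  have : (lagSeq ε n : ℝ) ≤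
      ∑ i ∈ Finset.Ioc 0 (⌊ε * n⌋₊ + (C + 1)), (lagSeq ε i : ℝ) := by linarith
  exact_mod_cast this

/-- Gaps have the order of `F (ε * n)`, so the lower bound is monotonicity. For the upper one,
multiplicative convexity with `l = 1 / ε` bounds `F (ε * j) / F (ε * i)` by `F j / F i`, which is at
most `4`. -/
theorem lagSeq_deriv_comparable {ε : ℝ} (hε : 0 < ε) (hε1 : ε < 1) :
    ∃ c : ℝ, 0 < c ∧ c < 1 ∧ ∀ i j, 1 ≤ i → i < j →
      c * discDeriv (lagSeq ε) i ≤ discDeriv (lagSeq ε) j ∧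
      (lagSeq ε j < 2 * lagSeq ε i →
        discDeriv (lagSeq ε) j ≤ (1 / c) * discDeriv (lagSeq ε) i) := by
  obtain ⟨D, hD1, hD⟩ := exists_lagSeries_add_one_le hε hε1
  refine ⟨1 / (5 * D), by positivity, by rw [div_lt_one (by positivity)]; linarith,
    fun i j hi hij => ⟨?_, fun hlt => ?_⟩⟩
  · obtain ⟨h1, -, -, -⟩ := discDeriv_lagSeq_bounds hε hε1 j
    obtain ⟨-, -, -, h2⟩ := discDeriv_lagSeq_bounds hε hε1 i
    have h3 : lagSeries ε (ε * (i + 1 : ℕ)) ≤ lagSeries ε (ε * j) := by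
      apply lagSeries_mono hε hε1 (by positivity)
      have : ((i + 1 : ℕ) : ℝ) ≤ j := by exact_mod_cast hij
      gcongr
    have h4 := one_le_lagSeries hε hε1 (x := ε * j) (by positivity)
    rw [one_div_mul_eq_div, div_le_iff₀ (by positivity)]
    nlinarith
  · obtain ⟨h1, -, -, -⟩ := discDeriv_lagSeq_bounds hε hε1 i
    obtain ⟨-, -, -, h2⟩ := discDeriv_lagSeq_bounds hε hε1 j
    have hlt' : (lagSeq ε j : ℝ) < 2 * lagSeq ε i := by exact_mod_cast hlt
    have hFi := one_le_lagSeries hε hε1 (Nat.cast_nonneg (α := ℝ) i)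
    have h3 : lagSeries ε j ≤ 4 * lagSeries ε i := by
      have h4 := (lagSeq_bounds hε hε1 j).1
      have h5 := (lagSeq_bounds hε hε1 i).2
      have h6 : (10 : ℝ) ≤ 10 / ε := by rw [le_div_iff₀ hε]; linarith
      have h7 : 10 / ε * lagSeries ε j ≤ 10 / ε * (4 * lagSeries ε i) := by nlinarith
      exact le_of_mul_le_mul_left h7 (by positivity)
    have h4 := lagSeries_mul_le hε hε1 (x := ε * i) (y := ε * j) (l := 1 / ε) (by positivity)
      (by gcongr) (by rw [le_div_iff₀ hε]; linarith)
    rw [show 1 / ε * (ε * (i : ℝ)) = i by field_simp,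
      show 1 / ε * (ε * (j : ℝ)) = j by field_simp] at h4
    have hεi := one_le_lagSeries hε hε1 (x := ε * i) (by positivity)
    have h5 : lagSeries ε (ε * j) ≤ 4 * lagSeries ε (ε * i) := by
      have h6 : lagSeries ε i * lagSeries ε (ε * j) ≤
        lagSeries ε i * (4 * lagSeries ε (ε * i)) := by nlinarith
      exact le_of_mul_le_mul_left h6 (by linarith)
    have h6 : lagSeries ε (ε * (j + 1 : ℕ)) ≤ D * lagSeries ε (ε * j) := by
      refine le_trans (lagSeries_mono hε hε1 (by positivity) ?_) (hD (ε * j) (by positivity))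
      push_cast; linarith
    rw [one_div_one_div]
    have h7 : D * lagSeries ε (ε * j) ≤ D * (4 * lagSeries ε (ε * i)) := by gcongr
    have h8 : 5 * D * (9 * lagSeries ε (ε * i)) ≤ 5 * D * discDeriv (lagSeq ε) i := by gcongr
    have h9 : 0 ≤ D * lagSeries ε (ε * i) := by positivity
    linarith

/-- By multiplicative convexity the ratio `F (l * y) / F y` does not decrease in `y`, so a gain of
`A` at `x` recurs at every later step. -/
theorem lagSeries_pow_mul_ge {ε : ℝ} (hε : 0 < ε) (hε1 : ε < 1) {x l A : ℝ} (hx : 0 ≤ x)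
    (hl : 1 ≤ l) (hA : 0 ≤ A) (h : A * lagSeries ε x ≤ lagSeries ε (l * x)) (m : ℕ) :
    A ^ m ≤ lagSeries ε (l ^ m * x) := by
  have hFx := one_le_lagSeries hε hε1 hx
  have key : A ^ m * lagSeries ε x ≤ lagSeries ε (l ^ m * x) := by
    induction m with
    | zero => simp
    | succ m ih =>
      have hlm : 1 ≤ l ^ m := one_le_pow₀ hl
      have h1 := lagSeries_mul_le hε hε1 hx (show x ≤ l ^ m * x by nlinarith) hl
      have h2 : 0 ≤ lagSeries ε (l ^ m * x) :=
        zero_le_one.trans (one_le_lagSeries hε hε1 (by positivity))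
      rw [pow_succ', pow_succ', mul_assoc l]
      refine le_of_mul_le_mul_right (a := lagSeries ε x) ?_ (by linarith)
      have h3 : 0 ≤ lagSeries ε (l * x) :=
        zero_le_one.trans (one_le_lagSeries hε hε1 (by positivity))
      calc A * A ^ m * lagSeries ε x * lagSeries ε x
          = A * lagSeries ε x * (A ^ m * lagSeries ε x) := by ring
        _ ≤ lagSeries ε (l * x) * lagSeries ε (l ^ m * x) := by gcongr
        _ ≤ _ := h1
  have : (0 : ℝ) ≤ A ^ m := by positivity
  nlinarith

theorem exists_log_lagSeries_le {ε : ℝ} (hε : 0 < ε) (hε1 : ε < 1) :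
    ∃ C : ℝ, 1 ≤ C ∧ ∀ x, 1 ≤ x → Real.log (lagSeries ε x) ≤ C * (1 + Real.log x) ^ 2 := by
  have hL0 : 0 < Real.log (1 / ε) := Real.log_pos (by rw [lt_div_iff₀ hε]; linarith)
  refine ⟨1 + 1 / (2 * Real.log (1 / ε)), by
    have : 0 ≤ 1 / (2 * Real.log (1 / ε)) := by positivity
    linarith, fun x hx => ?_⟩
  have h1 := lagSeries_le hε hε1 (show 0 < x by linarith)
  have h2 := one_le_lagSeries hε hε1 (show 0 ≤ x by linarith)
  have h3 := Real.log_le_log (by linarith) h1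
  rw [Real.log_exp] at h3
  have h4 := Real.log_nonneg hx
  have h5 : 0 ≤ 1 / (2 * Real.log (1 / ε)) := by positivity
  nlinarith

/-- The function `lagSeries` needs long steps to double. -/
theorem exists_doubling_step_ge {ε : ℝ} (hε : 0 < ε) (hε1 : ε < 1) :
    ∃ C : ℝ, 1 ≤ C ∧ ∀ x d, 1 ≤ x → 0 < d → 2 * lagSeries ε x ≤ lagSeries ε (x + d) →
      x ≤ C * (1 + Real.log x) ^ 2 * d := by
  obtain ⟨C, hC1, hC⟩ := exists_log_lagSeries_le hε hε1
  refine ⟨8 * C, by linarith, fun x d hx1 hd h2 => ?_⟩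
  have hx0 : 0 < x := by linarith
  have hlogx := Real.log_nonneg hx1
  obtain ⟨ℓ, hℓ⟩ : ∃ ℓ, ℓ = 1 + Real.log x := ⟨_, rfl⟩
  have hℓ1 : 1 ≤ ℓ := by linarith
  have e : (1 + d / x) * x = x + d := by field_simp
  -- Iterating the doubling `m` times multiplies `x` by at most `e`, so `2 ^ m ≤ F (e * x)`. As `log
  -- F` is quadratic in the logarithm, `x / d` is `O((1 + log x) ^ 2)`.
  set m := ⌊x / d⌋₊ with hm'
  have hmle : (m : ℝ) ≤ x / d := Nat.floor_le (by positivity)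
  have hmlt : x / d < m + 1 := Nat.lt_floor_add_one _
  have h1 := lagSeries_pow_mul_ge hε hε1 hx0.le
    (show 1 ≤ 1 + d / x by linarith [show 0 ≤ d / x by positivity]) (by norm_num) (e ▸ h2) m
  have h2 : (1 + d / x) ^ m ≤ Real.exp 1 := by
    calc (1 + d / x) ^ m ≤ Real.exp (d / x) ^ m := by
          gcongr; linarith [Real.add_one_le_exp (d / x)]
      _ = Real.exp (m * (d / x)) := by rw [← Real.exp_nat_mul]
      _ ≤ Real.exp 1 := by
          rw [Real.exp_le_exp]
          calc (m : ℝ) * (d / x) ≤ x / d * (d / x) := by gcongr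
            _ = 1 := by field_simp
  have hex : 1 ≤ Real.exp 1 * x := by
    have := Real.add_one_le_exp (1 : ℝ); nlinarith
  have h3 : (2 : ℝ) ^ m ≤ lagSeries ε (Real.exp 1 * x) :=
    h1.trans (lagSeries_mono hε hε1 (by positivity) (by gcongr))
  have h4 := Real.log_le_log (by positivity) h3
  have h5 := hC _ hex
  rw [Real.log_mul (Real.exp_pos 1).ne' hx0.ne', Real.log_exp, ← hℓ] at h5
  rw [Real.log_pow] at h4
  have h6 := Real.log_two_gt_d9
  have h9 : (m : ℝ) + 1 ≤ 8 * C * ℓ ^ 2 := by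
    have h10 : (m : ℝ) * Real.log 2 ≤ C * (1 + ℓ) ^ 2 := h4.trans h5
    have h13 : (m : ℝ) * 0.69 ≤ m * Real.log 2 := by gcongr; linarith
    have h16 : 1 ≤ ℓ ^ 2 := one_le_pow₀ hℓ1
    have h14 : 1 ≤ C * ℓ ^ 2 := by nlinarith
    have h17 : (1 + ℓ) ^ 2 ≤ 4 * ℓ ^ 2 := by nlinarith
    have h15 : C * (1 + ℓ) ^ 2 ≤ C * (4 * ℓ ^ 2) := by gcongr
    linarith
  rw [div_lt_iff₀ hd] at hmlt
  have : ((m : ℝ) + 1) * d ≤ 8 * C * ℓ ^ 2 * d := by gcongr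
  rw [← hℓ]
  linarith

theorem tendsto_div_mul_log_pow (A : ℝ) (hA : 0 < A) :
    Tendsto (fun x : ℝ => x / (A * (1 + Real.log x) ^ 4)) atTop atTop := by
  have h1 : Tendsto (fun x : ℝ => Real.log x ^ 4 / x) atTop (𝓝[>] 0) := by
    refine tendsto_nhdsWithin_iff.2 ⟨?_, ?_⟩
    · exact (Real.isLittleO_pow_log_id_atTop (n := 4)).tendsto_div_nhds_zero
    · filter_upwards [eventually_gt_atTop 1] with x hx
      have := Real.log_pos hx
      exact Set.mem_Ioi.2 (by positivity)
  have h2 := (tendsto_inv_nhdsGT_zero.comp h1).const_mul_atTop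
    (show 0 < 1 / (16 * A) by positivity)
  refine tendsto_atTop_mono' _ ?_ h2
  filter_upwards [eventually_ge_atTop (Real.exp 1)] with x hx
  have hx0 : 0 < x := (Real.exp_pos 1).trans_le hx
  have hl : 1 ≤ Real.log x := by rwa [Real.le_log_iff_exp_le hx0]
  simp only [Function.comp_apply, inv_div]
  rw [div_mul_div_comm, one_mul]
  have h3 : (1 + Real.log x) ^ 4 ≤ (2 * Real.log x) ^ 4 := by gcongr; linarith
  apply div_le_div_of_nonneg_left hx0.le (by positivity)
  have h4 : A * (1 + Real.log x) ^ 4 ≤ A * (2 * Real.log x) ^ 4 := by gcongr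
  refine h4.trans (le_of_eq ?_)
  ring

/-- Let `P` be the last index before block `i`. Then `i` is `O((1 + log P) ^ 2)`, and since `F` must
double across the block, its size plus one is at least a constant times `P / (1 + log P) ^ 2`. -/
theorem tendsto_card_dyadicBlock_lagSeq {ε : ℝ} (hε : 0 < ε) (hε1 : ε < 1) :
    Tendsto (fun i : ℕ => ((dyadicBlock (lagSeq ε) i).card : ℝ) / i) atTop atTop := by
  have hb := isPosSeq_lagSeq hε hε1
  have hm := (strictMono_lagSeq hε hε1).strictMonoOn (Set.Ici 1)
  obtain ⟨C, hC1, hC⟩ := exists_log_lagSeries_le hε hε1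
  obtain ⟨C', hC'1, hC'⟩ := exists_doubling_step_ge hε hε1
  obtain ⟨D, hD1, hD⟩ := exists_lagSeries_add_one_le hε hε1
  set B := Real.log (10 / ε * D + 1) with hB
  have hB0 : 0 ≤ B := Real.log_nonneg (by
    have : 0 ≤ 10 / ε * D := by positivity
    linarith)
  have hidx := tendsto_idx_two_pow hb hm
  -- comparison with a function tending to infinity
  have hkey : ∀ᶠ i : ℕ in atTop,
      (idx (lagSeq ε) (2 ^ i) : ℝ) /
        (2 * C' * (B + C) * (1 + Real.log (idx (lagSeq ε) (2 ^ i))) ^ 4) - 1 ≤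
      ((dyadicBlock (lagSeq ε) i).card : ℝ) / i := by
    filter_upwards [hidx.eventually_ge_atTop 1, eventually_ge_atTop 1] with i hP hi
    set P := idx (lagSeq ε) (2 ^ i) with hPdef
    set Q := idx (lagSeq ε) (2 ^ (i + 1)) with hQdef
    have hPQ : P ≤ Q := idx_mono _ (Nat.pow_le_pow_right (by norm_num) (by omega))
    set x : ℝ := (P : ℝ) with hx
    have hx1 : 1 ≤ x := by rw [hx]; exact_mod_cast hP
    have hir : (1 : ℝ) ≤ i := by exact_mod_cast hi
    set d : ℝ := (Q + 1 : ℕ) - x with hd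
    have hdn : d = (dyadicBlock (lagSeq ε) i).card + 1 := by
      rw [card_dyadicBlock, Nat.cast_sub hPQ, hd]; push_cast; ring
    have hd1 : 1 ≤ d := by rw [hdn]; linarith [Nat.cast_nonneg (α := ℝ) (dyadicBlock (lagSeq ε) i).card]
    have hbP : lagSeq ε P ≤ 2 ^ i := (le_idx_iff hb hm hP).1 le_rfl
    have hbP1 : 2 ^ i < lagSeq ε (P + 1) := (idx_lt_iff hb hm (by omega)).1 (by omega)
    have hbQ : 2 ^ (i + 1) < lagSeq ε (Q + 1) := (idx_lt_iff hb hm (by omega)).1 (by omega)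
    obtain ⟨ℓ, hℓ⟩ : ∃ ℓ, ℓ = 1 + Real.log x := ⟨_, rfl⟩
    rw [← hℓ]
    have hlogx := Real.log_nonneg hx1
    have hℓ1 : 1 ≤ ℓ := by linarith
    -- upper bound for `i`
    have hi_le : (i : ℝ) ≤ 2 * (B + C) * ℓ ^ 2 := by
      have h1 := (lagSeq_bounds hε hε1 (P + 1)).2
      have h2 := hD x (by linarith)
      have h3 := one_le_lagSeries hε hε1 (show 0 ≤ x by linarith)
      have h4 : (2 : ℝ) ^ i ≤ (10 / ε * D + 1) * lagSeries ε x := by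
        have h5 : (2 : ℝ) ^ i ≤ lagSeq ε (P + 1) := by exact_mod_cast hbP1.le
        have h6 : 10 / ε * lagSeries ε ((P + 1 : ℕ) : ℝ) ≤ 10 / ε * (D * lagSeries ε x) := by
          push_cast; gcongr
        linarith
      have h5 := Real.log_le_log (by positivity) h4
      rw [Real.log_mul (by positivity) (by linarith), Real.log_pow, ← hB] at h5
      have h6 := hC x hx1
      rw [← hℓ] at h6
      have h7 := Real.log_two_gt_d9
      have h8 : 1 ≤ ℓ ^ 2 := one_le_pow₀ hℓ1
      nlinarith
    have hd_ge : x ≤ C' * ℓ ^ 2 * d := by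
      rw [hℓ]
      refine hC' x d hx1 (by linarith) ?_
      have e : x + d = (Q + 1 : ℕ) := by rw [hd]; ring
      rw [e]
      have h1 := (lagSeq_bounds hε hε1 P).1
      have h2 := (lagSeq_bounds hε hε1 (Q + 1)).2
      have h3 : (2 : ℝ) * 2 ^ i + 1 ≤ lagSeq ε (Q + 1) := by
        rw [pow_succ] at hbQ
        exact_mod_cast (by omega : 2 * 2 ^ i + 1 ≤ lagSeq ε (Q + 1))
      have h4 : (lagSeq ε P : ℝ) ≤ 2 ^ i := by exact_mod_cast hbP
      have h5 : 10 / ε * (2 * lagSeries ε x) ≤ 10 / ε * lagSeries ε ((Q + 1 : ℕ) : ℝ) := by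
        linarith
      exact le_of_mul_le_mul_left h5 (by positivity)
    have hBC : 0 < B + C := by linarith
    have hcard : ((dyadicBlock (lagSeq ε) i).card : ℝ) = d - 1 := by rw [hdn]; ring
    rw [hcard, sub_div]
    have h1 : (1 : ℝ) / i ≤ 1 := by rw [div_le_one (by linarith)]; exact hir
    have h2 : x / (2 * C' * (B + C) * ℓ ^ 4) ≤ d / i := by
      rw [div_le_div_iff₀ (by positivity) (by linarith)]
      calc x * i ≤ (C' * ℓ ^ 2 * d) * (2 * (B + C) * ℓ ^ 2) := by gcongr
        _ = d * (2 * C' * (B + C) * ℓ ^ 4) := by ring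
    linarith
  refine tendsto_atTop_mono' _ hkey (tendsto_atTop_add_const_right _ (-1) ?_)
  have hlim := tendsto_div_mul_log_pow (2 * C' * (B + C)) (by positivity)
  exact hlim.comp (tendsto_natCast_atTop_atTop.comp hidx)

theorem isFriendly_lagSeq {ε : ℝ} (hε : 0 < ε) (hε1 : ε < 1) : IsFriendly ε (lagSeq ε) where
  growth := lagSeq_growth hε hε1
  tendsto_deriv := tendsto_discDeriv_lagSeq hε hε1
  tendsto_count := by
    have hb := isPosSeq_lagSeq hε hε1
    have hm := (strictMono_lagSeq hε hε1).strictMonoOn (Set.Ici 1)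
    simp only [countIn_eq_idx hb hm, ENat.toNat_natCast]
    refine (tendsto_card_dyadicBlock_lagSeq hε hε1).congr fun i => ?_
    rw [card_dyadicBlock,
      Nat.cast_sub (idx_mono _ (Nat.pow_le_pow_right (by norm_num) (by omega)))]
  deriv_comparable := lagSeq_deriv_comparable hε hε1
  strictMono := (strictMono_lagSeq hε hε1).strictMonoOn _

/-! ### Comparison of sequences and asymptotics. -/

/-- A sequence bounded by its sums up to `ε n + C` is dominated by every sequence bounded below by
its sums up to `ε n - C`. -/
theorem exists_le_mul_of_sum_le {ε : ℝ} (hε : 0 < ε) (hε1 : ε < 1) {u v : ℕ → ℝ} (C : ℕ)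
    (hu0 : ∀ n, 0 ≤ u n) (hv1 : ∀ n, 1 ≤ n → 1 ≤ v n)
    (hvm : ∀ᶠ n in atTop, ∀ m, n ≤ m → v n ≤ v m)
    (hu : ∀ᶠ n : ℕ in atTop, u n ≤ ∑ i ∈ Finset.Ioc 0 (⌊ε * n⌋₊ + C), u i)
    (hv : ∀ᶠ n : ℕ in atTop, ∑ i ∈ Finset.Ioc 0 (⌊ε * n⌋₊ - C), v i ≤ v n) :
    ∃ A : ℝ, 0 < A ∧ ∀ᶠ n in atTop, u n ≤ A * v n := by
  -- The induction proves `u n ≤ A * v (n - s)`. Shifting by `s` gains `(1 - ε) * s ≥ 2 * C + 2` in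
  -- the range of summation: this outweighs both offsets `C`, rounding, and one spare term.
  obtain ⟨s, hs⟩ := exists_nat_ge ((2 * C + 2) / (1 - ε))
  rw [div_le_iff₀ (by linarith)] at hs
  have hfl : ∀ n : ℕ, s ≤ n → ⌊ε * n⌋₊ + (2 * C + 1) ≤ ⌊ε * (n - s : ℕ)⌋₊ + s := by
    intro n hn
    have h1 := Nat.floor_le (show 0 ≤ ε * n by positivity)
    have h2 := Nat.lt_floor_add_one (ε * (n - s : ℕ) : ℝ)
    rw [Nat.cast_sub hn] at h2
    have h3 : (⌊ε * n⌋₊ : ℝ) + (2 * C + 1) < ⌊ε * (n - s : ℕ)⌋₊ + s + 1 := by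
      rw [Nat.cast_sub hn]; linarith
    have h4 : ⌊ε * n⌋₊ + (2 * C + 1) < ⌊ε * (n - s : ℕ)⌋₊ + s + 1 := by exact_mod_cast h3
    omega
  have hbig1 : ∀ᶠ n : ℕ in atTop, (C / (1 - ε) : ℝ) < n :=
    tendsto_natCast_atTop_atTop.eventually_gt_atTop _
  have hbig2 : ∀ᶠ n : ℕ in atTop, (s / ε : ℝ) ≤ n :=
    tendsto_natCast_atTop_atTop.eventually_ge_atTop _
  have hsub : Tendsto (fun n : ℕ => n - s) atTop atTop := tendsto_sub_atTop_nat s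
  obtain ⟨n₁, hn₁⟩ := eventually_atTop.1 (hu.and ((hsub.eventually hv).and
    ((hsub.eventually hvm).and (hbig1.and (hbig2.and (eventually_gt_atTop s))))))
  have hn₁s : s < n₁ := (hn₁ n₁ le_rfl).2.2.2.2.2
  set A := ∑ i ∈ Finset.range (n₁ + 1), u i + 1 with hA
  have hAsum : 0 ≤ ∑ i ∈ Finset.range (n₁ + 1), u i := Finset.sum_nonneg fun i _ => hu0 i
  have hA0 : 0 < A := by linarith
  have key : ∀ n, s < n → u n ≤ A * v (n - s) := by
    intro n
    induction n using Nat.strong_induction_on with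
    | _ n ih =>
      intro hsn
      rcases lt_or_ge n n₁ with hlt | hge
      · have h1 : u n ≤ ∑ i ∈ Finset.range (n₁ + 1), u i :=
          Finset.single_le_sum (fun i _ => hu0 i) (Finset.mem_range.2 (by omega))
        have h2 := hv1 (n - s) (by omega)
        nlinarith
      · obtain ⟨h1, h2, -, h4, h5, -⟩ := hn₁ n hge
        rw [div_lt_iff₀ (by linarith)] at h4
        rw [div_le_iff₀ hε] at h5
        have hlt : ⌊ε * n⌋₊ + C < n := by
          have := Nat.floor_le (show 0 ≤ ε * n by positivity)
          have : (⌊ε * n⌋₊ : ℝ) + C < n := by linarith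
          exact_mod_cast this
        have hge' : s ≤ ⌊ε * n⌋₊ := Nat.le_floor (by linarith)
        obtain ⟨t, ht⟩ : ∃ t, ⌊ε * n⌋₊ + C = s + t := ⟨⌊ε * n⌋₊ + C - s, by omega⟩
        have haux : ∀ r, s + r < n → ∑ i ∈ Finset.Ioc 0 (s + r), u i ≤
            A + A * ∑ i ∈ Finset.Ioc 0 r, v i := by
          intro r hr
          induction r with
          | zero =>
            simp only [add_zero, Finset.Ioc_self, Finset.sum_empty, mul_zero]
            have : ∑ i ∈ Finset.Ioc 0 s, u i ≤ ∑ i ∈ Finset.range (n₁ + 1), u i :=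
              Finset.sum_le_sum_of_subset_of_nonneg (fun i hi => by
                rw [Finset.mem_Ioc] at hi; rw [Finset.mem_range]; omega) fun i _ _ => hu0 i
            linarith
          | succ r ihr =>
            have h6 := ihr (by omega)
            have h7 := ih (s + (r + 1)) hr (by omega)
            rw [Nat.add_sub_cancel_left] at h7
            rw [← add_assoc, Finset.sum_Ioc_succ_top (Nat.zero_le _),
              Finset.sum_Ioc_succ_top (Nat.zero_le _), mul_add, add_assoc s]
            linarith
        have h6 := haux t (by omega)
        -- The spare term, at least `1`, absorbs the additive `A` from the initial indices, so the
        -- constant does not deteriorate.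
        have h7 : 1 + ∑ i ∈ Finset.Ioc 0 t, v i ≤ ∑ i ∈ Finset.Ioc 0 (t + 1), v i := by
          rw [Finset.sum_Ioc_succ_top (Nat.zero_le _)]
          linarith [hv1 (t + 1) (by omega)]
        have hfln := hfl n hsn.le
        have h8 : ∑ i ∈ Finset.Ioc 0 (t + 1), v i ≤
            ∑ i ∈ Finset.Ioc 0 (⌊ε * (n - s : ℕ)⌋₊ - C), v i :=
          Finset.sum_le_sum_of_subset_of_nonneg (Finset.Ioc_subset_Ioc_right (by omega))
            fun i hi _ => zero_le_one.trans (hv1 i (by rw [Finset.mem_Ioc] at hi; omega))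
        rw [ht] at h1
        have h9 : A * (1 + ∑ i ∈ Finset.Ioc 0 t, v i) ≤ A * v (n - s) := by
          gcongr; linarith
        linarith
  refine ⟨A, hA0, eventually_atTop.2 ⟨n₁, fun n hn => ?_⟩⟩
  refine (key n (by omega)).trans ?_
  have := (hn₁ n hn).2.2.1 n (Nat.sub_le _ _)
  gcongr

theorem lt_one_of_recursion {ε : ℝ} {f : ℕ → ℕ} (hf : IsPosSeq f)
    (hrec : ∀ᶠ n : ℕ in atTop, f n = sumUpTo f (ε * n)) : ε < 1 := by
  by_contra! hε
  obtain ⟨n, hn, hn2⟩ := (hrec.and (eventually_ge_atTop 2)).exists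
  have hle : n ≤ ⌊ε * n⌋₊ := Nat.le_floor (by
    have : (0 : ℝ) ≤ n := Nat.cast_nonneg n
    nlinarith)
  have hsub : ({1, n} : Finset ℕ) ⊆ Finset.Icc 1 ⌊ε * n⌋₊ := by
    intro i hi
    simp only [Finset.mem_insert, Finset.mem_singleton] at hi
    rw [Finset.mem_Icc]; omega
  have h1 := Finset.sum_le_sum_of_subset (f := f) hsub
  rw [Finset.sum_pair (by omega)] at h1
  have := hf 1 le_rfl
  unfold sumUpTo at hn
  omega

section Recursion

variable {ε : ℝ} {f : ℕ → ℕ}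

theorem recursion_eq_sum_Ioc (hrec : ∀ᶠ n : ℕ in atTop, f n = sumUpTo f (ε * n)) :
    ∀ᶠ n : ℕ in atTop, (f n : ℝ) = ∑ i ∈ Finset.Ioc 0 ⌊ε * n⌋₊, (f i : ℝ) := by
  filter_upwards [hrec] with n hn
  rw [sumUpTo_eq_sum_Ioc] at hn
  exact_mod_cast hn

theorem recursion_eventually_mono (hε : 0 < ε)
    (hrec : ∀ᶠ n : ℕ in atTop, f n = sumUpTo f (ε * n)) :
    ∀ᶠ n in atTop, ∀ m, n ≤ m → (f n : ℝ) ≤ f m := by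
  obtain ⟨N, hN⟩ := eventually_atTop.1 (recursion_eq_sum_Ioc hrec)
  refine eventually_atTop.2 ⟨N, fun n hn m hm => ?_⟩
  rw [hN n hn, hN m (hn.trans hm)]
  refine Finset.sum_le_sum_of_subset_of_nonneg (Finset.Ioc_subset_Ioc_right ?_)
    fun i _ _ => Nat.cast_nonneg _
  have : (n : ℝ) ≤ m := by exact_mod_cast hm
  exact Nat.floor_le_floor (by gcongr)

/-- Sequences satisfying the growth condition are dominated by solutions of the recursion. -/
theorem isBigO_of_growth (hε : 0 < ε) (hf : IsPosSeq f)
    (hrec : ∀ᶠ n : ℕ in atTop, f n = sumUpTo f (ε * n)) {a : ℕ → ℕ} {C : ℝ}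
    (ha : ∀ n, 1 ≤ n → a n ≤ sumUpTo a (ε * n + C)) :
    Asymptotics.IsBigO atTop (fun n => (a n : ℝ)) (fun n => (f n : ℝ)) := by
  obtain ⟨c, hc⟩ := exists_nat_ge C
  obtain ⟨A, -, hA⟩ := exists_le_mul_of_sum_le hε (lt_one_of_recursion hf hrec)
    (u := fun n => (a n : ℝ)) (v := fun n => (f n : ℝ)) c (fun n => Nat.cast_nonneg _)
    (fun n hn => by exact_mod_cast hf n hn) (recursion_eventually_mono hε hrec) (by
      filter_upwards [eventually_ge_atTop 1] with n hn
      have h1 := ha n hn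
      rw [sumUpTo_eq_sum_Ioc] at h1
      have h2 : ⌊ε * n + C⌋₊ ≤ ⌊ε * n⌋₊ + c := by
        rw [← Nat.floor_add_natCast (by positivity)]
        exact Nat.floor_le_floor (by linarith)
      exact_mod_cast h1.trans (Finset.sum_le_sum_of_subset (Finset.Ioc_subset_Ioc_right h2))) (by
      filter_upwards [recursion_eq_sum_Ioc hrec] with n hn
      rw [hn]
      exact Finset.sum_le_sum_of_subset_of_nonneg
        (Finset.Ioc_subset_Ioc_right (Nat.sub_le _ _)) fun i _ _ => Nat.cast_nonneg _)
  refine Asymptotics.IsBigO.of_bound A ?_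
  filter_upwards [hA] with n hn
  simpa using hn

/-- Solutions of the recursion are of the same order as `lagSeries`. -/
theorem exists_lagSeries_bounds (hε : 0 < ε) (hf : IsPosSeq f)
    (hrec : ∀ᶠ n : ℕ in atTop, f n = sumUpTo f (ε * n)) :
    ∃ A : ℝ, 0 < A ∧ ∀ᶠ n : ℕ in atTop,
      lagSeries ε n ≤ A * f n ∧ (f n : ℝ) ≤ A * lagSeries ε n := by
  have hε1 := lt_one_of_recursion hf hrec
  have hF1 : ∀ n : ℕ, 1 ≤ lagSeries ε n := fun n => one_le_lagSeries hε hε1 (Nat.cast_nonneg n)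
  obtain ⟨A, hA0, hA⟩ := exists_le_mul_of_sum_le hε hε1
    (u := fun n => lagSeries ε n) (v := fun n => (f n : ℝ)) 2 (fun n => zero_le_one.trans (hF1 n))
    (fun n hn => by exact_mod_cast hf n hn) (recursion_eventually_mono hε hrec)
    (Eventually.of_forall fun n => by
      refine (lagSeries_le_sum hε hε1 n).trans ?_
      rw [show ⌊ε * (n : ℝ)⌋₊ + 2 = ⌊ε * (n : ℝ)⌋₊ + 1 + 1 from rfl,
        Finset.sum_Ioc_succ_top (Nat.zero_le (⌊ε * (n : ℝ)⌋₊ + 1))]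
      linarith [hF1 (⌊ε * n⌋₊ + 1 + 1)]) (by
      filter_upwards [recursion_eq_sum_Ioc hrec] with n hn
      rw [hn]
      exact Finset.sum_le_sum_of_subset_of_nonneg
        (Finset.Ioc_subset_Ioc_right (Nat.sub_le _ _)) fun i _ _ => Nat.cast_nonneg _)
  obtain ⟨B, hB0, hB⟩ := exists_le_mul_of_sum_le hε hε1
    (u := fun n => (f n : ℝ)) (v := fun n => lagSeries ε n) 1 (fun n => Nat.cast_nonneg _)
    (fun n _ => hF1 n)
    (Eventually.of_forall fun n m hnm =>
      lagSeries_mono hε hε1 (Nat.cast_nonneg n) (by exact_mod_cast hnm)) (by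
      filter_upwards [recursion_eq_sum_Ioc hrec] with n hn
      rw [hn]
      exact Finset.sum_le_sum_of_subset_of_nonneg
        (Finset.Ioc_subset_Ioc_right (Nat.le_succ _)) fun i _ _ => Nat.cast_nonneg _)
    (Eventually.of_forall fun n => sum_le_lagSeries hε hε1 n)
  refine ⟨max A B, lt_max_of_lt_left hA0, ?_⟩
  filter_upwards [hA, hB] with n h1 h2
  refine ⟨h1.trans ?_, h2.trans ?_⟩
  · gcongr; exact le_max_left _ _
  · have := hF1 n
    gcongr; exact le_max_right _ _

/-- Interlacing `lagSeq` loses only a constant, because `F (n + 1)` is at most a constant times `F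
n`. -/
theorem exists_isEpsComplete_isTheta (hε : 0 < ε) (hf : IsPosSeq f)
    (hrec : ∀ᶠ n : ℕ in atTop, f n = sumUpTo f (ε * n)) :
    ∃ a : ℕ → ℕ, IsPosSeq a ∧ StrictMonoOn a (Set.Ici 1) ∧ IsEpsComplete ε a ∧
      Asymptotics.IsTheta atTop (fun n => (a n : ℝ)) (fun n => (f n : ℝ)) := by
  have hε1 := lt_one_of_recursion hf hrec
  have hb := isPosSeq_lagSeq hε hε1
  have hm := strictMono_lagSeq hε hε1
  obtain ⟨a, hab, hcomp⟩ := (isFriendly_lagSeq hε hε1).exists_isEpsComplete hε hε1 hb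
  obtain ⟨A, hA0, hA⟩ := exists_lagSeries_bounds hε hf hrec
  obtain ⟨D, hD1, hD⟩ := exists_lagSeries_add_one_le hε hε1
  refine ⟨a, fun k hk => (hb k hk).trans_le (hab k hk).1, ?_, hcomp, ?_, ?_⟩
  · intro k hk l hl hkl
    have h1 := (hab k hk).2
    have h2 := (hab l hl).1
    have h3 := hm.monotone (show k + 1 ≤ l from hkl)
    omega
  · refine Asymptotics.IsBigO.of_bound (11 / ε * D * A) ?_
    filter_upwards [hA, eventually_ge_atTop 1] with n hn hn1
    rw [Real.norm_natCast, Real.norm_natCast]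
    have h1 : (a n : ℝ) ≤ lagSeq ε (n + 1) := by exact_mod_cast (hab n hn1).2.le
    have h2 := (lagSeq_bounds hε hε1 (n + 1)).2
    have h3 := hD n (Nat.cast_nonneg n)
    have h4 := one_le_lagSeries hε hε1 (x := n) (Nat.cast_nonneg n)
    push_cast at h2
    have h5 : 10 / ε * lagSeries ε (n + 1) ≤ 10 / ε * (D * lagSeries ε n) := by gcongr
    have h6 : 1 ≤ 1 / ε * (D * lagSeries ε n) := by
      have : 1 ≤ D * lagSeries ε n := by nlinarith
      rw [one_div_mul_eq_div, le_div_iff₀ hε]; linarith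
    have h7 : 11 / ε * (D * lagSeries ε n) ≤ 11 / ε * (D * (A * f n)) := by
      have := hn.1
      gcongr
    have h8 : 11 / ε * (D * lagSeries ε n) =
      10 / ε * (D * lagSeries ε n) + 1 / ε * (D * lagSeries ε n) := by ring
    linarith
  · refine Asymptotics.IsBigO.of_bound A ?_
    filter_upwards [hA, eventually_ge_atTop 1] with n hn hn1
    rw [Real.norm_natCast, Real.norm_natCast]
    have h1 : (lagSeq ε n : ℝ) ≤ a n := by exact_mod_cast (hab n hn1).1
    have h2 := (lagSeq_bounds hε hε1 n).1
    have h4 := one_le_lagSeries hε hε1 (x := n) (Nat.cast_nonneg n)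
    have h5 : (1 : ℝ) ≤ 10 / ε := by rw [le_div_iff₀ hε]; linarith
    have h6 : lagSeries ε n ≤ a n := by nlinarith
    exact hn.2.trans (by gcongr)

end Recursion

/-- Lower bound for `lagSeries` from a single term of the series. -/
theorem le_log_lagSeries {ε : ℝ} (hε : 0 < ε) (hε1 : ε < 1) {x : ℝ} (hx : 1 ≤ x)
    (hxε : Real.log (1 / ε) ≤ Real.log x) :
    1 / (2 * Real.log (1 / ε)) * Real.log x ^ 2 - Real.log (1 / ε) / 2 - Real.log x / 2 -
        Real.log x / Real.log (1 / ε) * Real.log (Real.log x / Real.log (1 / ε)) ≤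
      Real.log (lagSeries ε x) := by
  set L := Real.log (1 / ε) with hL
  set ℓ := Real.log x with hℓ
  have hL0 : 0 < L := Real.log_pos (by rw [lt_div_iff₀ hε]; linarith)
  have hLε : Real.log ε = -L := by rw [hL, one_div, Real.log_inv]; ring
  have hr1 : 1 ≤ ℓ / L := by rwa [le_div_iff₀ hL0, one_mul]
  -- The quadratic exponent `k * ℓ - L * k ^ 2 / 2` peaks at `ℓ / L`. Rounding down costs at most `L
  -- / 2`, and `k ! ≤ k ^ k` gives the last error term.
  set k := ⌊ℓ / L⌋₊ with hk
  have hk1 : 1 ≤ k := Nat.le_floor (by simpa using hr1)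
  have hkle : (k : ℝ) ≤ ℓ / L := Nat.floor_le (by linarith)
  have hklt : ℓ / L < k + 1 := Nat.lt_floor_add_one _
  have hkr : (1 : ℝ) ≤ k := by exact_mod_cast hk1
  have h1 := Real.log_le_log (mul_pos (lagCoeff_pos hε k) (pow_pos (by linarith) k))
    (lagCoeff_mul_pow_le hε hε1 (show 0 ≤ x by linarith) k)
  refine le_trans ?_ h1
  have hcoeff : Real.log (lagCoeff ε k) =
      (k + 1 : ℕ) * ((k + 1 : ℕ) - 1) / 2 * -L - Real.log k.factorial := by
    rw [lagCoeff, Real.log_div (by positivity) (by positivity), Real.log_pow, hLε,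
      Nat.cast_choose_two]
  rw [Real.log_mul (lagCoeff_pos hε k).ne' (pow_ne_zero _ (by linarith)), hcoeff, Real.log_pow,
    ← hℓ]
  have h2 : Real.log (k.factorial : ℝ) ≤ ℓ / L * Real.log (ℓ / L) := by
    have h3 : (k.factorial : ℝ) ≤ (k : ℝ) ^ k := by exact_mod_cast Nat.factorial_le_pow k
    have h4 := Real.log_le_log (by positivity) h3
    rw [Real.log_pow] at h4
    refine h4.trans ?_
    have h5 : Real.log k ≤ Real.log (ℓ / L) := Real.log_le_log (by linarith) hkle
    have h6 := Real.log_nonneg hkr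
    gcongr
  set r := ℓ / L with hr
  have hℓr : ℓ = L * r := by rw [hr]; field_simp
  have h3 : 1 / (2 * L) * ℓ ^ 2 = L * r ^ 2 / 2 := by rw [hℓr]; field_simp
  rw [h3, hℓr]
  push_cast
  have h4 : (r - k) ^ 2 ≤ 1 := by
    have : 0 ≤ r - k := by linarith
    have : r - k ≤ 1 := by linarith
    nlinarith
  have h5 := mul_le_mul_of_nonneg_left h4 hL0.le
  have h6 := mul_le_mul_of_nonneg_left hkle hL0.le
  nlinarith

theorem tendsto_error_div_sq (L C : ℝ) (hL : 0 < L) :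
    Tendsto (fun y : ℝ => (C + y / 2 + y / L * Real.log (y / L)) / y ^ 2) atTop (𝓝 0) := by
  have h1 : Tendsto (fun y : ℝ => C * (y ^ 2)⁻¹) atTop (𝓝 0) := by
    have := ((tendsto_pow_atTop (α := ℝ) two_ne_zero).inv_tendsto_atTop).const_mul C
    simpa using this
  have h2 : Tendsto (fun y : ℝ => 1 / 2 * y⁻¹) atTop (𝓝 0) := by
    have := (tendsto_inv_atTop_zero (𝕜 := ℝ)).const_mul (1 / 2)
    simpa using this
  have h3 : Tendsto (fun y : ℝ => 1 / L ^ 2 * (Real.log (y / L) / (y / L))) atTop (𝓝 0) := by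
    have h4 : Tendsto (fun y : ℝ => Real.log y / y) atTop (𝓝 0) :=
      Real.isLittleO_log_id_atTop.tendsto_div_nhds_zero
    have := (h4.comp (tendsto_id.atTop_div_const hL)).const_mul (1 / L ^ 2)
    simpa using this
  have h := (h1.add h2).add h3
  simp only [add_zero] at h
  refine h.congr' ?_
  filter_upwards [eventually_gt_atTop 0] with y hy
  field_simp

theorem exists_exp_asymptotics {ε : ℝ} {f : ℕ → ℕ} (hε : 0 < ε) (hf : IsPosSeq f)
    (hrec : ∀ᶠ n : ℕ in atTop, f n = sumUpTo f (ε * n)) :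
    ∃ δ : ℕ → ℝ, Tendsto δ atTop (𝓝 0) ∧ ∀ᶠ n : ℕ in atTop,
      (f n : ℝ) = Real.exp ((1 / (2 * Real.log (1 / ε)) + δ n) * Real.log n ^ 2) := by
  have hε1 := lt_one_of_recursion hf hrec
  obtain ⟨A, hA0, hA⟩ := exists_lagSeries_bounds hε hf hrec
  set L := Real.log (1 / ε) with hL
  have hL0 : 0 < L := Real.log_pos (by rw [lt_div_iff₀ hε]; linarith)
  have hlog : Tendsto (fun n : ℕ => Real.log n) atTop atTop :=
    Real.tendsto_log_atTop.comp tendsto_natCast_atTop_atTop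
  -- The error is defined by solving the formula for it, so only its convergence to zero needs an
  -- estimate.
  refine ⟨fun n => Real.log (f n) / Real.log n ^ 2 - 1 / (2 * L), ?_, ?_⟩
  · have hup : Tendsto (fun n : ℕ => (1 + Real.log A) * ((Real.log n) ^ 2)⁻¹) atTop (𝓝 0) := by
      have := (((tendsto_pow_atTop (α := ℝ) two_ne_zero).comp hlog).inv_tendsto_atTop).const_mul
        (1 + Real.log A)
      simpa using this
    have hlow := ((tendsto_error_div_sq L (L / 2 + Real.log A) hL0).comp hlog).neg
    rw [neg_zero] at hlow
    refine tendsto_of_tendsto_of_tendsto_of_le_of_le' hlow hup ?_ ?_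
    · filter_upwards [hA, hlog.eventually_ge_atTop L, eventually_ge_atTop 1] with n hn hnL hn1
      have hn1r : (1 : ℝ) ≤ n := by exact_mod_cast hn1
      have hℓ : 0 < Real.log n := hL0.trans_le hnL
      have hfn : (0 : ℝ) < f n := by exact_mod_cast hf n hn1
      have h1 := le_log_lagSeries hε hε1 hn1r hnL
      have h2 := Real.log_le_log
        (zero_lt_one.trans_le (one_le_lagSeries hε hε1 (Nat.cast_nonneg n))) hn.1
      rw [Real.log_mul hA0.ne' hfn.ne'] at h2
      rw [Function.comp_apply, ← neg_div, le_sub_iff_add_le, div_add' _ _ _ (by positivity)]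
      gcongr
      rw [← hL] at h1
      linarith
    · filter_upwards [hA, hlog.eventually_ge_atTop L, eventually_ge_atTop 1] with n hn hnL hn1
      have hn1r : (1 : ℝ) ≤ n := by exact_mod_cast hn1
      have hℓ : 0 < Real.log n := hL0.trans_le hnL
      have hfn : (0 : ℝ) < f n := by exact_mod_cast hf n hn1
      have hF := zero_lt_one.trans_le (one_le_lagSeries hε hε1 (Nat.cast_nonneg (α := ℝ) n))
      have h1 := Real.log_le_log hF (lagSeries_le hε hε1 (show (0 : ℝ) < n by linarith))
      have h2 := Real.log_le_log hfn hn.2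
      rw [Real.log_mul hA0.ne' hF.ne'] at h2
      rw [Real.log_exp, ← hL] at h1
      rw [sub_le_iff_le_add, ← div_eq_mul_inv, div_add' _ _ _ (by positivity)]
      gcongr
      linarith
  · filter_upwards [hlog.eventually_gt_atTop 0, eventually_ge_atTop 1] with n hn hn1
    have hfn : (0 : ℝ) < f n := by exact_mod_cast hf n hn1
    rw [add_sub_cancel, div_mul_cancel₀ _ (by positivity), Real.exp_log hfn]

theorem mainTheorem3 (ε : ℝ) (hε : 0 < ε) :
    -- comparison with any sequence `F` satisfying the recursion
    (∀ f : ℕ → ℕ, IsPosSeq f → (∀ᶠ n : ℕ in atTop, f n = sumUpTo f (ε * n)) →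
      (∀ a : ℕ → ℕ, IsPosSeq a → MonotoneOn a (Set.Ici 1) → IsEpsComplete ε a →
        Asymptotics.IsBigO atTop (fun n => (a n : ℝ)) (fun n => (f n : ℝ))) ∧
      (∃ a : ℕ → ℕ, IsPosSeq a ∧ StrictMonoOn a (Set.Ici 1) ∧ IsEpsComplete ε a ∧
        Asymptotics.IsTheta atTop (fun n => (a n : ℝ)) (fun n => (f n : ℝ))) ∧
      (∃ δ : ℕ → ℝ, Tendsto δ atTop (𝓝 0) ∧
        ∀ᶠ n : ℕ in atTop,
          (f n : ℝ) = Real.exp ((1 / (2 * Real.log (1 / ε)) + δ n) * Real.log n ^ 2))) ∧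
    -- the necessary growth condition
    (∀ a : ℕ → ℕ, IsPosSeq a → MonotoneOn a (Set.Ici 1) → IsEpsComplete ε a →
      ∃ C : ℝ, ∀ n, 1 ≤ n → a n ≤ sumUpTo a (ε * n + C)) ∧
    -- every friendly sequence is interlaced by an `ε`-complete sequence
    (ε < 1 → ∀ b : ℕ → ℕ, IsPosSeq b → IsFriendly ε b →
      ∃ a : ℕ → ℕ, (∀ n, 1 ≤ n → b n ≤ a n ∧ a n < b (n + 1)) ∧ IsEpsComplete ε a) := by
  refine ⟨fun f hf hrec => ⟨fun a ha hm hcomp => ?_, exists_isEpsComplete_isTheta hε hf hrec,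
    exists_exp_asymptotics hε hf hrec⟩, fun a ha hm hcomp => hcomp.exists_growth hε ha hm,
    fun hε1 b hb hfr => hfr.exists_isEpsComplete hε hε1 hb⟩
  obtain ⟨C, hC⟩ := hcomp.exists_growth hε ha hm
  exact isBigO_of_growth hε hf hrec hC
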